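/- **Setting.** Binary strings are identified with natural numbers in length-lexicographic order, and $|x|$ is the length of the string $x$. Algorithms are probabilistic register machines with fair coins and (possibly) oracles, with logarithmic-cost running time. Let $\mathcal A_0,\mathcal A_1,\dots$ be the standard recursive enumeration of all probabilistic polynomial-time (oracle) machines: the index $i$ encodes a pair of a program and an exponent $k$, and $\mathcal A_i$ is that program stopped after time $L^k+k$ on inputs of total length $L$. A machine that does not deliver its output in time has no output. Let $\mathsf{GenRSA}$ be a probabilistic polynomial-time algorithm that, on input $1^n$ with $n\ge1$, either fails or outputs $(N,e,d)$ where $N=pq$ for distinct $n$-bit primes $p,q$, and $e,d\ge1$ with $ed\equiv1\pmod{(p-1)(q-1)}$. *Effective RSA assumption (relative to $\mathsf{GenRSA}$).* Let $\mathsf{Succ}^{\mathsf{RSA}}_{\mathcal A}(n)$ be the probability that $(N,e,d)\gets\mathsf{GenRSA}(1^n)$ does not fail and, for a uniformly random unit $y$ modulo $N$, the output $x$ of $\mathcal A(n,N,e,y)$ satisfies $x^e\equiv y\pmod N$. The assumption says that there is a computable function $f$ such that, for all $i$ and all $d,n\ge1$, if $n\ge f(i,d)$ then $\mathsf{Succ}^{\mathsf{RSA}}_{\mathcal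 A_i}(n)\le 1/n^d$. *RSA-FDH.* Let $\ell$ be a polynomial with integer coefficients such that $\ell(n)\ge 2n$ for all $n\ge1$. Keys are generated by $\mathsf{GenRSA}(1^n)$; the public key is $(n,N,e)$ and the private key is $(n,N,d)$. Relative to a hash function $G$ with values in $\{0,1\}^{\ell(n)}$, read as integers in $[0,2^{\ell(n)})$, the signature of a message $m$ is $G(m)^d \bmod N$, and $\sigma$ is a valid signature of $m$ if $\sigma^e\equiv G(m)\pmod N$. In the experiment $\mathsf{Sig\text{-}forge}_{\mathcal A}(n,G)$, the adversary $\mathcal A$ is given the public key and access to the oracle $G$ and to the signing oracle, and outputs $(m,\sigma)$; the result is $1$ if $m$ was not sent to the signing oracle and $\sigma$ is a valid signature of $m$, and $0$ otherwise (in particular, $0$ if the key generation fails or $\mathcal A$ has no output). **Theorem.** Under the effective RSA assumption relative to $\mathsf{GenRSA}$, RSA-FDH is effectively EUF-ACMA secure in the random oracle model. That is, there is a computable function $f$ such that, for all $i$ and all $d,n\ge1$, if $n\ge f(i,d)$ then, for every $q$ that is at least the time bound of $\mathcal A_i$ on every public key $(n,N,e)$ that can be output on the parameter $n$, $$\frac{1}{\#\mathsf{Func}_{\le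 q}^{\ell(n)}}\sum_{G\in\mathsf{Func}_{\le q}^{\ell(n)}}\Pr[\mathsf{Sig\text{-}forge}_{\mathcal A_i}(n,G)=1]\le\frac1{n^d},$$ where $\mathsf{Func}_{\le q}^{\ell(n)}$ is the set of all functions from the binary strings of length at most $q$ to $\{0,1\}^{\ell(n)}$. -/

import Mathlib

namespace RSAFDH

/-! ### Probabilistic oracle machines with a step count

Binary strings are identified with natural numbers in the length-lexicographic order: the string `x`
is the number whose binary expansion is `1x`, minus one. A machine has registers that hold binary
strings (natural numbers), a finite program, fair coins, and two oracles. Its running time is the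
logarithmic cost: each instruction costs one unit plus the lengths of all the values that it reads or
writes. Up to a polynomial this is the running time of a multitape Turing machine. -/

/-- The length of the binary string that is identified with `x`. -/
def strLen (x : ℕ) : ℕ := Nat.log 2 (x + 1)

/-- Instructions; `r`, `s`, `t` are register numbers. -/
inductive Instr where
  /-- `r := c` -/
  | const (r c : ℕ)
  /-- `r := s` -/
  | copy (r s : ℕ)
  /-- `r := s + t` -/
  | add (r s t : ℕ)
  /-- `r := s - t`, truncated at zero -/
  | sub (r s t : ℕ)
  /-- `r := s * t` -/
  | mul (r s t : ℕ)
  /-- `r := ⌊s / t⌋` -/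
  | div (r s t : ℕ)
  /-- `r := s mod t` -/
  | mod (r s t : ℕ)
  /-- if register `r` holds zero, jump to the instruction number `p` -/
  | jz (r p : ℕ)
  /-- `r :=` the result of a fair coin flip, `0` or `1` -/
  | flip (r : ℕ)
  /-- `r :=` the answer of the hash oracle to the content of `s` -/
  | hash (r s : ℕ)
  /-- `r :=` the answer of the signing oracle to the content of `s` -/
  | sign (r s : ℕ)

/-- Instruction codes: an operation number and three operands. Each instruction has a code. -/
def Instr.ofCode : ℕ × ℕ × ℕ × ℕ → Instr
  | (0, r, c, _) => .const r c
  | (1, r, s, _) => .copy r s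
  | (2, r, s, t) => .add r s t
  | (3, r, s, t) => .sub r s t
  | (4, r, s, t) => .mul r s t
  | (5, r, s, t) => .div r s t
  | (6, r, s, t) => .mod r s t
  | (7, r, p, _) => .jz r p
  | (8, r, _, _) => .flip r
  | (9, r, s, _) => .hash r s
  | (_, r, s, _) => .sign r s

/-- The oracles of a machine. -/
structure Oracles where
  hash : ℕ → ℕ
  sign : ℕ → ℕ

/-- No oracles: every query is answered by zero. -/
def noOracles : Oracles := ⟨fun _ => 0, fun _ => 0⟩

structure Config where
  /-- the number of the instruction to be executed next -/
  pc : ℕ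
  /-- the contents of the registers -/
  reg : ℕ → ℕ
  /-- the running time so far -/
  cost : ℕ
  /-- the queries made to the signing oracle so far -/
  signed : List ℕ

/-- Store `v` in register `r`, go to the next instruction and charge one unit plus `k`. -/
def Config.put (c : Config) (r v k : ℕ) : Config :=
  { c with pc := c.pc + 1, reg := Function.update c.reg r v, cost := c.cost + (1 + k) }

/-- `r := f s t`, at the cost of one plus the lengths of the operands and of the result. -/
def Config.binop (c : Config) (f : ℕ → ℕ → ℕ) (r s t : ℕ) : Config :=
  c.put r (f (c.reg s) (c.reg t))
    (strLen (c.reg s) + strLen (c.reg t) + strLen (f (c.reg s) (c.reg t)))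

/-- The effect of one instruction. -/
noncomputable def Instr.exec (O : Oracles) (c : Config) : Instr → PMF Config
  | .const r v => PMF.pure (c.put r v (strLen v))
  | .copy r s => PMF.pure (c.put r (c.reg s) (strLen (c.reg s)))
  | .add r s t => PMF.pure (c.binop (· + ·) r s t)
  | .sub r s t => PMF.pure (c.binop (· - ·) r s t)
  | .mul r s t => PMF.pure (c.binop (· * ·) r s t)
  | .div r s t => PMF.pure (c.binop (· / ·) r s t)
  | .mod r s t => PMF.pure (c.binop (· % ·) r s t)
  | .jz r p => PMF.pure
      { c with pc := if c.reg r = 0 then p else c.pc + 1, cost := c.cost + (1 + strLen (c.reg r)) }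
  | .flip r => (PMF.uniformOfFintype Bool).map fun b => c.put r b.toNat 0
  | .hash r s => PMF.pure
      (c.put r (O.hash (c.reg s)) (strLen (c.reg s) + strLen (O.hash (c.reg s))))
  | .sign r s => PMF.pure
      { c.put r (O.sign (c.reg s)) (strLen (c.reg s) + strLen (O.sign (c.reg s))) with
        signed := c.reg s :: c.signed }

/-- One step of the program `P`; the machine has halted when there is no current instruction. -/
noncomputable def step (P : List Instr) (O : Oracles) (c : Config) : PMF Config :=
  match P[c.pc]? with
  | none => PMF.pure c
  | some I => I.exec O c

/-- `t` steps of the program `P`. -/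
noncomputable def steps (P : List Instr) (O : Oracles) : ℕ → Config → PMF Config
  | 0, c => PMF.pure c
  | t + 1, c => (step P O c).bind (steps P O t)

/-- A clocked machine: it is stopped after time `L ^ exponent + exponent` on inputs of length `L`. -/
structure Machine where
  prog : List Instr
  exponent : ℕ

/-- The start: the components of the input are in the first registers, all others hold zero. -/
def start (input : List ℕ) : Config := ⟨0, fun r => input.getD r 0, 0, []⟩

/-- The time bound of a clocked machine on an input, by the total length of the input. -/
def Machine.clock (M : Machine) (input : List ℕ) : ℕ :=
  (input.map strLen).sum ^ M.exponent + M.exponent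

/-- The final configuration of a clocked machine with `r` output registers `0, …, r - 1`; `none` if the
machine did not halt and deliver the output in time (delivering costs the length of the output). An
instruction costs at least one unit, so that a run of cost `T` has at most `T` steps. -/
noncomputable def Machine.run (M : Machine) (O : Oracles) (input : List ℕ) (r : ℕ) :
    PMF (Option Config) :=
  (steps M.prog O (M.clock input) (start input)).map fun c =>
    if M.prog.length ≤ c.pc ∧
        c.cost + ∑ j ∈ Finset.range r, strLen (c.reg j) ≤ M.clock input then
      some c
    else none

/-- The standard recursive enumeration of all probabilistic polynomial-time (oracle) machines:
the index `i` is a pair of the code of a program and an exponent for the clock. -/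
def ppt (i : ℕ) : Machine :=
  ⟨(Denumerable.ofNat (List (ℕ × ℕ × ℕ × ℕ)) i.unpair.1).map Instr.ofCode, i.unpair.2⟩

/-! ### RSA -/

/-- `N` is the product of two distinct `n`-bit primes, `e` is a public exponent and `d` is a
corresponding private exponent. -/
def IsRSAKey (n N e d : ℕ) : Prop :=
  ∃ p q : ℕ, p.Prime ∧ q.Prime ∧ p ≠ q ∧ p.size = n ∧ q.size = n ∧ N = p * q ∧
    0 < e ∧ 0 < d ∧ e * d ≡ 1 [MOD (p - 1) * (q - 1)]

/-- `(N, e, d)`, or `none` for a failure. The machine is run on the string `1ⁿ`, which is the number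
`2 ^ (n + 1) - 2`. -/
noncomputable def genKey (gen : Machine) (n : ℕ) : PMF (Option (ℕ × ℕ × ℕ)) :=
  (gen.run noOracles [2 ^ (n + 1) - 2] 3).map fun o =>
    o.map fun c => (c.reg 0, c.reg 1, c.reg 2)

/-- A probabilistic polynomial-time RSA key generator. It may fail, but every key that it does output is
an RSA key for the security parameter. -/
def IsRSAGenerator (gen : Machine) : Prop :=
  ∀ n : ℕ, 1 ≤ n → ∀ N e d : ℕ, some (N, e, d) ∈ (genKey gen n).support → IsRSAKey n N e d

/-- The numbers below `N` that are prime to `N`, representing the units modulo `N`. -/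
def unitReps (N : ℕ) : Finset ℕ := (Finset.range N).filter fun y => y.Coprime N

/-- A uniformly random unit modulo `N` (there is none only if `N = 0`). -/
noncomputable def randomUnit (N : ℕ) : PMF ℕ :=
  if h : (unitReps N).Nonempty then PMF.uniformOfFinset (unitReps N) h else PMF.pure 0

/-- The RSA experiment: generate `(N, e, d)`, choose a random unit `y` modulo `N`, and give
`(n, N, e, y)` to the machine, which wins if it outputs an `e`-th root of `y` modulo `N`. -/
noncomputable def rsaInv (gen A : Machine) (n : ℕ) : PMF Bool :=
  (genKey gen n).bind fun key =>
    match key with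
    | none => PMF.pure false
    | some (N, e, _) =>
      (randomUnit N).bind fun y =>
        (A.run noOracles [n, N, e, y] 1).map fun o =>
          match o with
          | none => false
          | some c => decide (c.reg 0 ^ e ≡ y [MOD N])

/-- The success probability in solving the RSA problem on the security parameter `n`. -/
noncomputable def rsaSucc (gen A : Machine) (n : ℕ) : ℝ := (rsaInv gen A n true).toReal

/-- The effective RSA assumption, relative to a key generator. -/
def EffectiveRSAAssumption (gen : Machine) : Prop :=
  ∃ f : ℕ → ℕ → ℕ, Computable₂ f ∧ ∀ i d n : ℕ, 1 ≤ d → 1 ≤ n → f i d ≤ n →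
    rsaSucc gen (ppt i) n ≤ 1 / (n : ℝ) ^ d

/-! ### The RSA-FDH signature scheme

The public key is `(n, N, e)`, the private key is `(n, N, d)`. Hash values are strings of `k` bits, read
as integers in `[0, 2 ^ k)` and reduced modulo `N`. -/

/-- The signature of the message `m` under the private key `(n, N, d)`. -/
def fdhSign (N d : ℕ) (H : ℕ → ℕ) (m : ℕ) : ℕ := H m ^ d % N

/-- The signature `s` of the message `m` is valid for the public key `(n, N, e)`. -/
def FDHValid (N e : ℕ) (H : ℕ → ℕ) (m s : ℕ) : Prop := s ^ e ≡ H m [MOD N]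

/-- The functions from the strings of length at most `q` (they are the numbers below
`2 ^ (q + 1) - 1`) to the strings of length `k`. -/
abbrev Func (q k : ℕ) : Type := Fin (2 ^ (q + 1) - 1) → Fin (2 ^ k)

/-- A function on the strings of length at most `q`, as an oracle. The value outside is never used
when no longer string is queried. -/
def Func.oracle {q k : ℕ} (G : Func q k) (x : ℕ) : ℕ :=
  if h : x < 2 ^ (q + 1) - 1 then (G ⟨x, h⟩ : ℕ) else 0

open Classical in
/-- The signature experiment for RSA-FDH with the hash function `H`: the adversary gets the public key
and access to `H` and to the signing oracle, outputs a message `m` and a string `s`, and wins if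
`m` was not sent to the signing oracle and `s` is a valid signature of `m`. -/
noncomputable def sigForge (gen A : Machine) (n : ℕ) (H : ℕ → ℕ) : PMF Bool :=
  (genKey gen n).bind fun key =>
    match key with
    | none => PMF.pure false
    | some (N, e, d) =>
      (A.run ⟨H, fdhSign N d H⟩ [n, N, e] 2).map fun o =>
        match o with
        | none => false
        | some c => decide (c.reg 0 ∉ c.signed ∧ FDHValid N e H (c.reg 0) (c.reg 1))

/-- The probability that a forgery succeeds on the parameter `n`, averaged over all hash functions from
strings of length at most `q` to strings of length `k`. -/
noncomputable def romForge (gen A : Machine) (n q k : ℕ) : ℝ :=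
  (∑ G : Func q k, (sigForge gen A n G.oracle true).toReal) / Fintype.card (Func q k)

/-- `q` bounds the running time of the adversary on the parameter `n`. Then it also bounds the lengths
of all strings whose hash values are used in the experiment, since signing or verifying a message only
asks for the hash value of that message. -/
def BoundsTime (gen A : Machine) (n q : ℕ) : Prop :=
  ∀ N e d : ℕ, some (N, e, d) ∈ (genKey gen n).support → A.clock [n, N, e] ≤ q

/-- RSA-FDH with hash values of length `l n` is effectively existentially unforgeable under an adaptive
chosen-message attack in the random oracle model. The bound is required for every domain of the random
oracle that is large enough for the experiment, whatever the time for signing and verifying. -/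
def EffectivelyEUFACMASecureROM (gen : Machine) (l : ℕ → ℕ) : Prop :=
  ∃ f : ℕ → ℕ → ℕ, Computable₂ f ∧ ∀ i d n : ℕ, 1 ≤ d → 1 ≤ n → f i d ≤ n →
    ∀ q : ℕ, BoundsTime gen (ppt i) n q → romForge gen (ppt i) n q (l n) ≤ 1 / (n : ℝ) ^ d

end RSAFDH

/-!
The proof is the reduction for the full-domain hash, carried out at the level of register machines because
the security bound has to be computable from the index of the forger.

*Lazy sampling.* Averaging over all hash functions is the same as choosing hash values when they are first
asked for (`sum_ev_steps_le_game`). The resulting quantity `game` takes arbitrary weights for the hash values.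
The forged message is hashed at some position `j` in the order of the queries, at most one more than the
running time, so that the payoff splits into a sum over `j` (`game_le_sum`). For fixed `j` the game is linear in
the weights of the `j`-th hash value (`game_linear`), and so it is the sum over all residues `y` modulo `N` of
the games in which this value is congruent to `y`. The residues that are not units have negligible total
weight (`game_residue_le`, `IsRSAKey.card_nonunits`).

*The inverter.* Given `y`, it simulates this game. The `j`-th hash value is `N * t + y`; any other is
`N * t + (s ^ e mod N)` for random `t` and `s`, and then `s` is its signature. Such a value is rejected if it has
more than `l` bits; since exponentiation by `e` permutes the residues, exactly half of the random numbers `u`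
with `l + 1` bits, where `s = u mod N` and `t = u / N`, are accepted, and the accepted values are uniform
(`le_sum_attempts`). If the `j`-th message is sent to the signing oracle, the simulation is wrong, but then a
forgery at position `j` is impossible (`game_eq_zero_of_signed`). With `T + 1` attempts for each of `T + 1` hash
values all succeed with probability at least one half (`inv_two_le_accept_pow`).

*A uniform program.* Neither the polynomial `ℓ` nor the clock of the forger is known to the inverter. It
guesses `j`, the length of the hash values and the size of its table by coin flips, such that each number `x`
appears with probability at least `1 / (2 * x ^ 2)` (`guess_spec`). This costs a polynomial factor only, and it
makes the program of the inverter a primitive recursive function of the program of the forger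
(`primrec_reduction`); the exponent of its clock grows linearly.

*The machine.* The parts of the inverter are written in a small structured language, whose compiler is
correct with respect to `wp`, a quantitative weakest precondition that gives lower bounds for expected payoffs
and counts steps (`wp_le_valueAt`). The code of the forger is translated instruction by instruction
(`game_le_valueAt`). A run is worth counting only as long as all numbers have at most `M` bits, and then each
step costs at most `1 + 3 * M`, which bounds the running time.
-/

namespace RSAFDH
open scoped ENNReal

/-! ### Expectations -/

/-- The expectation of `f` under `p`. -/
noncomputable def ev {α : Type*} (p : PMF α) (f : α → ℝ≥0∞) : ℝ≥0∞ := ∑' a, p a * f a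

section ev
variable {α β : Type*}

@[simp] lemma ev_pure (a : α) (f : α → ℝ≥0∞) : ev (PMF.pure a) f = f a := by
  classical
  unfold ev
  rw [tsum_eq_single a]
  · simp
  · intro b hb
    simp [PMF.pure_apply, hb]

lemma ev_bind (p : PMF α) (g : α → PMF β) (f : β → ℝ≥0∞) :
    ev (p.bind g) f = ev p fun a => ev (g a) f := by
  unfold ev
  simp_rw [PMF.bind_apply, ← ENNReal.tsum_mul_right, ← ENNReal.tsum_mul_left]
  rw [ENNReal.tsum_comm]
  simp_rw [mul_assoc]

lemma ev_map (p : PMF α) (g : α → β) (f : β → ℝ≥0∞) : ev (p.map g) f = ev p fun a => f (g a) := by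
  rw [← PMF.bind_pure_comp, ev_bind]
  simp

lemma ev_mono_support {p : PMF α} {f g : α → ℝ≥0∞} (h : ∀ a ∈ p.support, f a ≤ g a) :
    ev p f ≤ ev p g := by
  refine ENNReal.tsum_le_tsum fun a => ?_
  by_cases ha : a ∈ p.support
  · exact mul_le_mul_right (h a ha) _
  · rw [PMF.mem_support_iff, not_not] at ha
    simp [ha]

lemma ev_mono {p : PMF α} {f g : α → ℝ≥0∞} (h : ∀ a, f a ≤ g a) : ev p f ≤ ev p g :=
  ev_mono_support fun a _ => h a

lemma ev_eq_zero {p : PMF α} {f : α → ℝ≥0∞} (h : ∀ a ∈ p.support, f a = 0) : ev p f = 0 := by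
  have : ev p f ≤ ev p fun _ => 0 := ev_mono_support fun a ha => (h a ha).le
  simpa [ev] using this

@[simp] lemma ev_const (p : PMF α) (k : ℝ≥0∞) : ev p (fun _ => k) = k := by
  simp [ev, ENNReal.tsum_mul_right, p.tsum_coe]

lemma ev_mul_left (p : PMF α) (k : ℝ≥0∞) (f : α → ℝ≥0∞) :
    ev p (fun a => k * f a) = k * ev p f := by
  simp_rw [ev, ← ENNReal.tsum_mul_left]
  congr 1; ext a; ring

lemma ev_add (p : PMF α) (f g : α → ℝ≥0∞) : ev p (fun a => f a + g a) = ev p f + ev p g := by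
  simp_rw [ev, ← ENNReal.tsum_add, mul_add]

lemma ev_finset_sum {ι : Type*} (s : Finset ι) (p : PMF α) (f : ι → α → ℝ≥0∞) :
    ev p (fun a => ∑ i ∈ s, f i a) = ∑ i ∈ s, ev p (f i) := by
  classical
  induction s using Finset.induction_on with
  | empty => simp [ev]
  | insert a s ha ih => simp only [Finset.sum_insert ha, ev_add, ih]

lemma ev_indicator (p : PMF Bool) : p true = ev p fun b => if b then 1 else 0 := by
  simp [ev]

lemma ev_coin (f : Bool → ℝ≥0∞) : ev (PMF.uniformOfFintype Bool) f = (f false + f true) / 2 := by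
  simp [ev, PMF.uniformOfFintype_apply, ENNReal.div_eq_inv_mul, mul_add, add_comm]

end ev

/-! ### Runs and their costs -/

/-- The register whose content an instruction sends to an oracle, if it is an oracle call. -/
def Instr.queryReg : Instr → Option ℕ
  | .hash _ s => some s
  | .sign _ s => some s
  | _ => none

/-- Oracles that answer every query as if the hash value were `h`. -/
def answer (N d h : ℕ) : Oracles := ⟨fun _ => h, fun _ => h ^ d % N⟩

lemma exec_of_no_query {I : Instr} (hI : I.queryReg = none) (O O' : Oracles) (c : Config) :
    I.exec O c = I.exec O' c := by
  cases I <;> simp_all [Instr.queryReg, Instr.exec]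

lemma exec_query {I : Instr} {s : ℕ} (hI : I.queryReg = some s) (N d : ℕ) (H : ℕ → ℕ) (c : Config) :
    I.exec ⟨H, fdhSign N d H⟩ c = I.exec (answer N d (H (c.reg s))) c := by
  cases I <;> simp_all [Instr.queryReg, Instr.exec, answer, fdhSign]

lemma cost_lt_of_exec {O : Oracles} {c c' : Config} {I : Instr} (h : c' ∈ (I.exec O c).support) :
    c.cost < c'.cost := by
  cases I <;> simp [Instr.exec, Config.put, Config.binop] at h <;>
    first
    | (subst h; simp)
    | (rcases h with rfl | rfl <;> simp)

lemma cost_query_of_exec {O : Oracles} {c c' : Config} {I : Instr} {s : ℕ}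
    (hI : I.queryReg = some s) (h : c' ∈ (I.exec O c).support) :
    c.cost + strLen (c.reg s) < c'.cost := by
  cases I <;> simp [Instr.queryReg] at hI <;> subst hI <;>
    simp [Instr.exec, Config.put] at h <;> subst h <;> simp <;> omega

lemma signed_subset_of_exec {O : Oracles} {c c' : Config} {I : Instr}
    (h : c' ∈ (I.exec O c).support) {m : ℕ} (hm : m ∈ c.signed) : m ∈ c'.signed := by
  cases I <;> simp [Instr.exec, Config.put, Config.binop] at h <;>
    first
    | (subst h; simp [hm])
    | (rcases h with rfl | rfl <;> simp [hm])

lemma cost_le_of_step {P : List Instr} {O : Oracles} {c c' : Config}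
    (h : c' ∈ (step P O c).support) : c.cost ≤ c'.cost := by
  unfold step at h
  split at h
  · simp at h; rw [h]
  · exact (cost_lt_of_exec h).le

/-- Nothing is gained on a run that is already too expensive. -/
lemma ev_steps_eq_zero {P : List Instr} {O : Oracles} {B : ℕ} {f : Config → ℝ≥0∞}
    (hf : ∀ c, B < c.cost → f c = 0) (t : ℕ) :
    ∀ c : Config, B < c.cost → ev (steps P O t c) f = 0 := by
  induction t with
  | zero => intro c hc; simp [steps, hf c hc]
  | succ t ih =>
    intro c hc
    rw [steps, ev_bind]
    exact ev_eq_zero fun c' h => ih c' (hc.trans_le (cost_le_of_step h))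

/-! ### The game with a lazily sampled hash function -/

/-- The position (counted from one, in the order of the queries) and the hash value of the message `x`
in a table of hash values. The last query comes first in the table. -/
def lookup : List (ℕ × ℕ) → ℕ → Option (ℕ × ℕ)
  | [], _ => none
  | (m, h) :: τ, x => if m = x then some (τ.length + 1, h) else lookup τ x

/-- Look up the hash value of `x`, or choose the value `h` of the `i`-th new query with weight `μ i h`;
then go on with the position, the value and the new table. -/
noncomputable def query (μ : ℕ → ℕ → ℝ≥0∞) (l : ℕ) (τ : List (ℕ × ℕ)) (x : ℕ)
    (k : ℕ → ℕ → List (ℕ × ℕ) → ℝ≥0∞) : ℝ≥0∞ :=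
  match lookup τ x with
  | some (i, h) => k i h τ
  | none => ∑ h ∈ Finset.range (2 ^ l), μ (τ.length + 1) h * k (τ.length + 1) h ((x, h) :: τ)

/-- The expected payoff of `t` steps of the program `P` from the configuration `c`, when the hash function
is sampled lazily and `τ` is the table of the hash values so far. At the end the message in register
zero is hashed; the payoff depends on the final configuration and on the position and the hash value of
this message. -/
noncomputable def game (P : List Instr) (N d l : ℕ) (μ : ℕ → ℕ → ℝ≥0∞)
    (fin : Config → ℕ → ℕ → ℝ≥0∞) : ℕ → Config → List (ℕ × ℕ) → ℝ≥0∞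
  | 0, c, τ => query μ l τ (c.reg 0) fun i h _ => fin c i h
  | t + 1, c, τ =>
    match P[c.pc]? with
    | none => game P N d l μ fin t c τ
    | some I =>
      match I.queryReg with
      | none => ev (I.exec noOracles c) fun c' => game P N d l μ fin t c' τ
      | some s => query μ l τ (c.reg s) fun _ h τ' =>
          ev (I.exec (answer N d h) c) fun c' => game P N d l μ fin t c' τ'

lemma query_mono {μ : ℕ → ℕ → ℝ≥0∞} {l : ℕ} {τ : List (ℕ × ℕ)} {x : ℕ}
    {k k' : ℕ → ℕ → List (ℕ × ℕ) → ℝ≥0∞}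
    (h₁ : ∀ i h, lookup τ x = some (i, h) → k i h τ ≤ k' i h τ)
    (h₂ : lookup τ x = none → ∀ h < 2 ^ l,
      k (τ.length + 1) h ((x, h) :: τ) ≤ k' (τ.length + 1) h ((x, h) :: τ)) :
    query μ l τ x k ≤ query μ l τ x k' := by
  unfold query
  split
  · next i h e => exact h₁ _ _ e
  · next e =>
    refine Finset.sum_le_sum fun h hh => ?_
    gcongr
    exact h₂ e h (Finset.mem_range.1 hh)

lemma query_eq_zero {μ : ℕ → ℕ → ℝ≥0∞} {l : ℕ} {τ : List (ℕ × ℕ)} {x : ℕ}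
    {k : ℕ → ℕ → List (ℕ × ℕ) → ℝ≥0∞}
    (h₁ : ∀ i h, lookup τ x = some (i, h) → k i h τ = 0)
    (h₂ : lookup τ x = none → ∀ h < 2 ^ l, k (τ.length + 1) h ((x, h) :: τ) = 0) :
    query μ l τ x k = 0 := by
  have : query μ l τ x k ≤ query μ l τ x fun _ _ _ => 0 :=
    query_mono (fun i h e => (h₁ i h e).le) fun e h hh => (h₂ e h hh).le
  refine le_antisymm (this.trans ?_) zero_le
  unfold query
  split <;> simp

lemma lookup_index {τ : List (ℕ × ℕ)} {x i h : ℕ} (e : lookup τ x = some (i, h)) :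
    1 ≤ i ∧ i ≤ τ.length := by
  induction τ with
  | nil => simp [lookup] at e
  | cons a τ ih =>
    obtain ⟨m, v⟩ := a
    simp only [lookup] at e
    split at e
    · simp at e; simp; omega
    · have := ih e; simp; omega

/-- A run whose cost is too high has no payoff. -/
lemma game_eq_zero_of_cost {P : List Instr} {N d l B : ℕ} {μ : ℕ → ℕ → ℝ≥0∞}
    {fin : Config → ℕ → ℕ → ℝ≥0∞} (hf : ∀ c i h, B < c.cost → fin c i h = 0) (t : ℕ) :
    ∀ c τ, B < c.cost → game P N d l μ fin t c τ = 0 := by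
  induction t with
  | zero => intro c τ hc; exact query_eq_zero (fun _ _ _ => hf _ _ _ hc) fun _ _ _ => hf _ _ _ hc
  | succ t ih =>
    intro c τ hc
    rw [game]
    split
    · exact ih c τ hc
    · split
      · exact ev_eq_zero fun c' h => ih _ _ (hc.trans (cost_lt_of_exec h))
      · exact query_eq_zero
          (fun _ _ _ => ev_eq_zero fun c' h => ih _ _ (hc.trans (cost_lt_of_exec h)))
          fun _ _ _ => ev_eq_zero fun c' h => ih _ _ (hc.trans (cost_lt_of_exec h))

/-- If the message at position `j` has been signed, a payoff for a forgery at position `j` is out of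
reach. -/
lemma game_eq_zero_of_signed {P : List Instr} {N d l j : ℕ} {μ : ℕ → ℕ → ℝ≥0∞}
    {fin : Config → ℕ → ℕ → ℝ≥0∞} (hf : ∀ c i h, i ≠ j ∨ c.reg 0 ∈ c.signed → fin c i h = 0)
    (t : ℕ) : ∀ c τ, (∀ i x h, lookup τ x = some (i, h) → i = j → x ∈ c.signed) → j ≤ τ.length →
      game P N d l μ fin t c τ = 0 := by
  induction t with
  | zero =>
    intro c τ hc hj
    refine query_eq_zero (fun i h e => ?_) fun _ _ _ => hf _ _ _ (.inl (by omega))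
    by_cases hi : i = j
    · exact hf _ _ _ (.inr (hc _ _ _ e hi))
    · exact hf _ _ _ (.inl hi)
  | succ t ih =>
    intro c τ hc hj
    rw [game]
    split
    · exact ih c τ hc hj
    · split
      · exact ev_eq_zero fun c' h => ih _ _
          (fun i x v e hi => signed_subset_of_exec h (hc i x v e hi)) hj
      · refine query_eq_zero
          (fun _ _ _ => ev_eq_zero fun c' h => ih _ _
            (fun i x v e hi => signed_subset_of_exec h (hc i x v e hi)) hj)
          fun _ v hv => ev_eq_zero fun c' h => ih _ _ ?_ (by simp; omega)
        intro i x w e hi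
        simp only [lookup] at e
        split at e
        · simp at e; omega
        · exact signed_subset_of_exec h (hc i x w e hi)

/-- The query form of a pointwise bound by a finite sum, for splitting a game into finitely many games. -/
lemma query_le_sum {ι : Type*} {J : Finset ι} {μ : ℕ → ℕ → ℝ≥0∞} {l : ℕ} {τ : List (ℕ × ℕ)} {x : ℕ}
    {k : ℕ → ℕ → List (ℕ × ℕ) → ℝ≥0∞} {k' : ι → ℕ → ℕ → List (ℕ × ℕ) → ℝ≥0∞}
    (h₁ : ∀ i h, lookup τ x = some (i, h) → k i h τ ≤ ∑ j ∈ J, k' j i h τ)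
    (h₂ : lookup τ x = none → ∀ h < 2 ^ l,
      k (τ.length + 1) h ((x, h) :: τ) ≤ ∑ j ∈ J, k' j (τ.length + 1) h ((x, h) :: τ)) :
    query μ l τ x k ≤ ∑ j ∈ J, query μ l τ x (k' j) := by
  refine (query_mono (k' := fun i h τ' => ∑ j ∈ J, k' j i h τ') h₁ h₂).trans (le_of_eq ?_)
  unfold query
  split
  · rfl
  · rw [Finset.sum_comm]
    simp_rw [Finset.mul_sum]

/-- The payoff is split according to the position of the forged message. -/
lemma game_le_sum {P : List Instr} {N d l J : ℕ} {μ : ℕ → ℕ → ℝ≥0∞}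
    (fin : Config → ℕ → ℕ → ℝ≥0∞) (t : ℕ) : ∀ c τ, τ.length + t + 1 ≤ J →
      game P N d l μ fin t c τ ≤
        ∑ j ∈ Finset.Icc 1 J, game P N d l μ (fun c i h => if i = j then fin c i h else 0) t c τ := by
  induction t with
  | zero =>
    intro c τ hJ
    have key : ∀ i h, 1 ≤ i → i ≤ J →
        fin c i h ≤ ∑ j ∈ Finset.Icc 1 J, if i = j then fin c i h else 0 := by
      intro i h h1 h2
      rw [Finset.sum_ite_eq]
      simp [h1, h2]
    refine query_le_sum (fun i h e => ?_) fun _ h _ => key _ _ (by omega) (by omega)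
    have := lookup_index e
    exact key _ _ (by omega) (by omega)
  | succ t ih =>
    intro c τ hJ
    simp only [game]
    split
    · exact ih c τ (by omega)
    · split
      · rw [← ev_finset_sum]
        exact ev_mono fun c' => ih _ _ (by omega)
      · refine query_le_sum (fun i h e => ?_) fun _ h _ => ?_
        · rw [← ev_finset_sum]
          exact ev_mono fun c' => ih _ _ (by omega)
        · rw [← ev_finset_sum]
          exact ev_mono fun c' => ih _ _ (by simp; omega)

lemma game_congr_weights {P : List Instr} {N d l j : ℕ} {μ μ' : ℕ → ℕ → ℝ≥0∞}
    {fin : Config → ℕ → ℕ → ℝ≥0∞} (hμ : ∀ i, i ≠ j → μ i = μ' i) (t : ℕ) :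
    ∀ c τ, j ≤ τ.length → game P N d l μ fin t c τ = game P N d l μ' fin t c τ := by
  induction t with
  | zero =>
    intro c τ hj
    simp only [game, query]
    split
    · rfl
    · rw [hμ _ (by omega)]
  | succ t ih =>
    intro c τ hj
    simp only [game]
    split
    · exact ih c τ hj
    · split
      · simp_rw [ih _ _ hj]
      · simp only [query]
        split
        · simp_rw [ih _ _ hj]
        · rw [hμ _ (by omega)]
          refine Finset.sum_congr rfl fun h _ => ?_
          simp_rw [ih _ ((_, _) :: τ) (by simp; omega)]

/-- If only a forgery at position `j` pays, then the game is linear in the weights of the `j`-th hash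
value. -/
lemma game_linear {ι : Type*} {Y : Finset ι} {P : List Instr} {N d l j : ℕ}
    {μ : ℕ → ℕ → ℝ≥0∞} {w : ι → ℝ≥0∞} {μ' : ι → ℕ → ℕ → ℝ≥0∞} {fin : Config → ℕ → ℕ → ℝ≥0∞}
    (hf : ∀ c i h, i ≠ j → fin c i h = 0)
    (hμ : ∀ y ∈ Y, ∀ i, i ≠ j → μ i = μ' y i)
    (hj : ∀ h, h < 2 ^ l → μ j h = ∑ y ∈ Y, w y * μ' y j h) (t : ℕ) :
    ∀ c τ, τ.length < j →
      game P N d l μ fin t c τ = ∑ y ∈ Y, w y * game P N d l (μ' y) fin t c τ := by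
  induction t with
  | zero =>
    intro c τ hτ
    simp only [game, query]
    split
    · next i h e =>
      have := lookup_index e
      rw [hf _ _ _ (by omega)]
      simp
    · by_cases hlen : τ.length + 1 = j
      · simp_rw [Finset.mul_sum]
        rw [Finset.sum_comm]
        refine Finset.sum_congr rfl fun h hh => ?_
        rw [hlen, hj _ (Finset.mem_range.1 hh), Finset.sum_mul]
        simp_rw [mul_assoc]
      · simp [hf _ _ _ hlen]
  | succ t ih =>
    intro c τ hτ
    simp only [game]
    split
    · exact ih c τ hτ
    · split
      · simp_rw [ih _ _ hτ, ev_finset_sum, ev_mul_left]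
      · simp only [query]
        split
        · simp_rw [ih _ _ hτ, ev_finset_sum, ev_mul_left]
        · by_cases hlen : τ.length + 1 = j
          · simp_rw [Finset.mul_sum]
            rw [Finset.sum_comm]
            refine Finset.sum_congr rfl fun h hh => ?_
            rw [hlen, hj _ (Finset.mem_range.1 hh), Finset.sum_mul]
            refine Finset.sum_congr rfl fun y hy => ?_
            rw [mul_assoc]
            congr 3
            ext c'
            exact game_congr_weights (hμ y hy) t _ _ (by simp; omega)
          · simp_rw [ih _ ((_, _) :: τ) (by simp; omega), ev_finset_sum, ev_mul_left, Finset.mul_sum]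
            rw [Finset.sum_comm]
            refine Finset.sum_congr rfl fun y hy => Finset.sum_congr rfl fun h _ => ?_
            rw [hμ y hy _ hlen]
            ring

/-- If all weights are scaled down by `k ≤ 1`, the expected payoff drops at most by a power of `k`. -/
lemma pow_mul_game_le {P : List Instr} {N d l : ℕ} {μ : ℕ → ℕ → ℝ≥0∞} {k : ℝ≥0∞} (hk : k ≤ 1)
    {fin : Config → ℕ → ℕ → ℝ≥0∞} (t : ℕ) :
    ∀ c τ, k ^ (t + 1) * game P N d l μ fin t c τ ≤
      game P N d l (fun i h => k * μ i h) fin t c τ := by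
  have drop : ∀ (t : ℕ) (x : ℝ≥0∞), k ^ (t + 1) * x ≤ k ^ t * x := fun t x => by
    gcongr ?_ * x
    exact pow_le_pow_of_le_one zero_le hk (Nat.le_succ t)
  induction t with
  | zero =>
    intro c τ
    simp only [game, query]
    split
    · simpa using drop 0 _
    · rw [Finset.mul_sum]
      refine le_of_eq (Finset.sum_congr rfl fun h _ => ?_)
      ring
  | succ t ih =>
    intro c τ
    simp only [game]
    split
    · exact (drop _ _).trans (ih c τ)
    · split
      · refine (drop _ _).trans ?_
        rw [← ev_mul_left]
        exact ev_mono fun c' => ih _ _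
      · simp only [query]
        split
        · refine (drop _ _).trans ?_
          rw [← ev_mul_left]
          exact ev_mono fun c' => ih _ _
        · rw [Finset.mul_sum]
          refine Finset.sum_le_sum fun h _ => ?_
          rw [pow_succ, mul_comm (k ^ (t + 1)) k, mul_assoc, mul_left_comm (k ^ (t + 1)), ← mul_assoc]
          refine mul_le_mul_right ?_ _
          rw [← ev_mul_left]
          exact ev_mono fun c' => ih _ _

/-- If only a forgery at position `j` pays, and at most one, then the expected payoff is at most the total
weight of the `j`-th hash value. -/
lemma game_le_mass {P : List Instr} {N d l j : ℕ} {μ : ℕ → ℕ → ℝ≥0∞}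
    {fin : Config → ℕ → ℕ → ℝ≥0∞} (hf : ∀ c i h, i ≠ j → fin c i h = 0)
    (hf1 : ∀ c i h, fin c i h ≤ 1)
    (hμ : ∀ i, i ≠ j → ∑ h ∈ Finset.range (2 ^ l), μ i h ≤ 1) (t : ℕ) :
    ∀ c τ, game P N d l μ fin t c τ ≤
      if τ.length < j then ∑ h ∈ Finset.range (2 ^ l), μ j h else 1 := by
  have sum_le : ∀ (i : ℕ) (x : ℝ≥0∞) (g : ℕ → ℝ≥0∞), (∀ h, g h ≤ x) →
      ∑ h ∈ Finset.range (2 ^ l), μ i h * g h ≤ (∑ h ∈ Finset.range (2 ^ l), μ i h) * x := by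
    intro i x g hg
    rw [Finset.sum_mul]
    exact Finset.sum_le_sum fun h _ => by gcongr; exact hg h
  have new : ∀ (n : ℕ) (g : ℕ → ℝ≥0∞),
      (∀ h, g h ≤ if n + 1 < j then ∑ h ∈ Finset.range (2 ^ l), μ j h else 1) →
      ∑ h ∈ Finset.range (2 ^ l), μ (n + 1) h * g h ≤
        if n < j then ∑ h ∈ Finset.range (2 ^ l), μ j h else 1 := by
    intro n g hg
    refine (sum_le _ _ _ hg).trans ?_
    rcases lt_trichotomy (n + 1) j with h | h | h
    · rw [if_pos h, if_pos (by omega)]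
      exact (mul_le_mul_left (hμ _ (by omega)) _).trans (by simp)
    · rw [if_neg (by omega), if_pos (by omega), h]; simp
    · rw [if_neg (by omega), if_neg (by omega)]; simpa using hμ _ (by omega)
  induction t with
  | zero =>
    intro c τ
    simp only [game, query]
    split
    · next i h e =>
      have := lookup_index e
      split
      · rw [hf _ _ _ (by omega)]; exact zero_le
      · exact hf1 _ _ _
    · refine new _ _ fun h => ?_
      split
      · rw [hf _ _ _ (by omega)]; exact zero_le
      · exact hf1 _ _ _
  | succ t ih =>
    intro c τ
    simp only [game]
    split
    · exact ih c τ
    · split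
      · exact (ev_mono fun c' => ih c' τ).trans (by simp)
      · simp only [query]
        split
        · exact (ev_mono fun c' => ih c' τ).trans (by simp)
        · exact new _ _ fun h => (ev_mono fun c' => ih c' _).trans (by simp)

/-! ### Random functions and lazy sampling -/

/-- The hash functions that agree with a table. -/
noncomputable def extensions (q l : ℕ) (τ : List (ℕ × ℕ)) : Finset (Func q l) := by
  classical
  exact Finset.univ.filter fun G => ∀ x i h, lookup τ x = some (i, h) → G.oracle x = h

lemma mem_extensions {q l : ℕ} {τ : List (ℕ × ℕ)} {G : Func q l} :
    G ∈ extensions q l τ ↔ ∀ x i h, lookup τ x = some (i, h) → G.oracle x = h := by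
  simp [extensions]

lemma mem_extensions_cons {q l : ℕ} {τ : List (ℕ × ℕ)} {x h : ℕ} (hx : lookup τ x = none)
    {G : Func q l} :
    G ∈ extensions q l ((x, h) :: τ) ↔ G ∈ extensions q l τ ∧ G.oracle x = h := by
  simp only [mem_extensions, lookup]
  constructor
  · intro H
    refine ⟨fun x' i h' e => H x' i h' ?_, H x (τ.length + 1) h (by simp)⟩
    rw [if_neg, e]
    rintro rfl
    simp [hx] at e
  · rintro ⟨H, rfl⟩ x' i h' e
    split at e
    · next hxx => subst hxx; simp at e; exact e.2
    · exact H _ _ _ e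

lemma oracle_lt {q l : ℕ} (G : Func q l) (x : ℕ) : G.oracle x < 2 ^ l := by
  unfold Func.oracle
  split
  · exact Fin.is_lt _
  · positivity

lemma sum_extensions {q l : ℕ} {τ : List (ℕ × ℕ)} {x : ℕ} (hx : lookup τ x = none)
    {M : Type*} [AddCommMonoid M] (f : Func q l → M) :
    ∑ G ∈ extensions q l τ, f G =
      ∑ h ∈ Finset.range (2 ^ l), ∑ G ∈ extensions q l ((x, h) :: τ), f G := by
  classical
  rw [← Finset.sum_fiberwise_of_maps_to (g := fun G : Func q l => G.oracle x)
    (t := Finset.range (2 ^ l)) fun G _ => Finset.mem_range.2 (oracle_lt G x)]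
  refine Finset.sum_congr rfl fun h _ => Finset.sum_congr ?_ fun _ _ => rfl
  ext G
  rw [mem_extensions_cons hx, Finset.mem_filter]

lemma oracle_update {q l : ℕ} (G : Func q l) (x : Fin (2 ^ (q + 1) - 1)) (v : Fin (2 ^ l)) (z : ℕ) :
    Func.oracle (Function.update G x v) z = if z = x then (v : ℕ) else G.oracle z := by
  unfold Func.oracle
  by_cases hz : z = x
  · subst hz; simp
  · rw [if_neg hz]
    split
    · rw [Function.update_of_ne]
      rintro rfl
      exact hz rfl
    · rfl

lemma card_extensions {q l : ℕ} {τ : List (ℕ × ℕ)} {x h : ℕ} (hx : lookup τ x = none)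
    (hq : x < 2 ^ (q + 1) - 1) (hh : h < 2 ^ l) :
    (extensions q l ((x, h) :: τ)).card * 2 ^ l = (extensions q l τ).card := by
  classical
  have key : ∀ h' < 2 ^ l, (extensions q l ((x, h') :: τ)).card =
      (extensions q l ((x, h) :: τ)).card := by
    have maps : ∀ a (ha : a < 2 ^ l) b, ∀ G ∈ extensions q l ((x, b) :: τ),
        Function.update G ⟨x, hq⟩ ⟨a, ha⟩ ∈ extensions q l ((x, a) :: τ) := by
      intro a ha b G hG
      rw [mem_extensions_cons hx] at hG ⊢
      refine ⟨mem_extensions.2 fun z i v e => ?_, by rw [oracle_update]; simp⟩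
      rw [oracle_update, if_neg]
      · exact mem_extensions.1 hG.1 z i v e
      · rintro rfl
        simp [hx] at e
    have inv : ∀ a (ha : a < 2 ^ l) b (hb : b < 2 ^ l), ∀ G ∈ extensions q l ((x, b) :: τ),
        Function.update (Function.update G ⟨x, hq⟩ ⟨a, ha⟩) ⟨x, hq⟩ ⟨b, hb⟩ = G := by
      intro a ha b hb G hG
      have := ((mem_extensions_cons hx).1 hG).2
      simp only [Func.oracle, hq, dif_pos] at this
      rw [Function.update_idem, Function.update_eq_self_iff]
      exact Fin.ext this.symm
    intro h' hh'
    exact Finset.card_nbij' (fun G => Function.update G ⟨x, hq⟩ ⟨h, hh⟩)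
      (fun G => Function.update G ⟨x, hq⟩ ⟨h', hh'⟩)
      (maps h hh h') (maps h' hh' h) (inv h hh h' hh') (inv h' hh' h hh)
  have := sum_extensions (q := q) (l := l) hx fun _ => (1 : ℕ)
  simp only [Finset.sum_const, smul_eq_mul, mul_one] at this
  rw [this, Finset.sum_congr rfl fun h' hh' => key h' (Finset.mem_range.1 hh')]
  simp [mul_comm]

lemma lt_of_strLen_le {x q : ℕ} (h : strLen x ≤ q) : x < 2 ^ (q + 1) - 1 := by
  unfold strLen at h
  have := Nat.lt_pow_of_log_lt (b := 2) (by norm_num) (Nat.lt_succ_of_le h)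
  simp only [Nat.succ_eq_add_one] at this
  omega

/-- A query to a random function that agrees with the table so far is a query to the lazy oracle, as
long as no string outside its domain yields a payoff. -/
lemma sum_extensions_le_query {q l : ℕ} (τ : List (ℕ × ℕ)) (x : ℕ) (f : ℕ → Func q l → ℝ≥0∞)
    (k : ℕ → ℕ → List (ℕ × ℕ) → ℝ≥0∞) (hout : q < strLen x → ∀ h G, f h G = 0)
    (h₁ : ∀ i h, lookup τ x = some (i, h) →
      ∑ G ∈ extensions q l τ, f h G ≤ (extensions q l τ).card * k i h τ)
    (h₂ : ∀ h, ∑ G ∈ extensions q l ((x, h) :: τ), f h G ≤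
      (extensions q l ((x, h) :: τ)).card * k (τ.length + 1) h ((x, h) :: τ)) :
    ∑ G ∈ extensions q l τ, f (G.oracle x) G ≤
      (extensions q l τ).card * query (fun _ _ => (2 ^ l)⁻¹) l τ x k := by
  by_cases hq : q < strLen x
  · simp [hout hq]
  have hq := lt_of_strLen_le (not_lt.1 hq)
  unfold query
  split
  · next i h e =>
    rw [Finset.sum_congr rfl fun G hG => by rw [mem_extensions.1 hG _ _ _ e]]
    exact h₁ i h e
  · next e =>
    rw [sum_extensions e, Finset.mul_sum]
    refine Finset.sum_le_sum fun h hh => ?_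
    rw [Finset.sum_congr rfl fun G hG => by rw [((mem_extensions_cons e).1 hG).2]]
    refine (h₂ h).trans (le_of_eq ?_)
    rw [← card_extensions e hq (Finset.mem_range.1 hh), ← mul_assoc]
    congr 1
    push_cast
    rw [mul_assoc, ENNReal.mul_inv_cancel (by simp) (by simp), mul_one]

/-- Averaging over all functions that agree with a table is the same as sampling new hash values
lazily. -/
lemma sum_ev_steps_le_game {P : List Instr} {N d l q : ℕ} {fin : Config → ℕ → ℝ≥0∞}
    (hf : ∀ c h, q < c.cost + strLen (c.reg 0) → fin c h = 0) (t : ℕ) : ∀ c τ,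
    ∑ G ∈ extensions q l τ, ev (steps P ⟨G.oracle, fdhSign N d G.oracle⟩ t c)
        (fun c' => fin c' (G.oracle (c'.reg 0))) ≤
      (extensions q l τ).card *
        game P N d l (fun _ _ => (2 ^ l)⁻¹) (fun c _ h => fin c h) t c τ := by
  induction t with
  | zero =>
    intro c τ
    simp only [steps, ev_pure, game]
    refine sum_extensions_le_query τ (c.reg 0) (fun h _ => fin c h) _
      (fun h _ _ => hf _ _ (by omega)) (fun i h e => by simp) fun h => by simp
  | succ t ih =>
    intro c τ
    simp only [steps, ev_bind, game]
    cases hP : P[c.pc]? with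
    | none => simpa [step, hP] using ih c τ
    | some I =>
      simp only [step, hP]
      cases hI : I.queryReg with
      | none =>
        simp_rw [exec_of_no_query hI _ noOracles]
        rw [← ev_finset_sum, ← ev_mul_left]
        exact ev_mono fun c' => ih c' τ
      | some s =>
        simp_rw [exec_query hI]
        refine sum_extensions_le_query τ (c.reg s)
          (fun h G => ev (I.exec (answer N d h) c) fun c' =>
            ev (steps P ⟨G.oracle, fdhSign N d G.oracle⟩ t c')
              fun c' => fin c' (G.oracle (c'.reg 0))) _ ?_ ?_ ?_
        · intro hq h G
          refine ev_eq_zero fun c' hc' => ev_steps_eq_zero (B := q)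
            (fun c hc => hf _ _ (by omega)) t c' ?_
          have := cost_query_of_exec hI hc'
          omega
        · intro i h e
          rw [← ev_finset_sum, ← ev_mul_left]
          exact ev_mono fun c' => ih c' τ
        · intro h
          rw [← ev_finset_sum, ← ev_mul_left]
          exact ev_mono fun c' => ih c' _

/-! ### Lower bounds for the expected payoff of a machine -/

/-- The code of an instruction. -/
abbrev Code : Type := ℕ × ℕ × ℕ × ℕ

/-- The expected payoff of an unlimited run of a machine without oracles, if only halting
configurations pay. -/
noncomputable def value (P : List Instr) (pay : Config → ℝ≥0∞) (c : Config) : ℝ≥0∞ :=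
  ⨆ t, ev (steps P noOracles t c) pay

lemma ev_steps_mono {P : List Instr} {pay : Config → ℝ≥0∞}
    (hpay : ∀ c, c.pc < P.length → pay c = 0) (c : Config) :
    Monotone fun t => ev (steps P noOracles t c) pay := by
  refine monotone_nat_of_le_succ fun t => ?_
  induction t generalizing c with
  | zero =>
    simp only [steps, ev_pure, ev_bind]
    by_cases hc : c.pc < P.length
    · simp [hpay c hc]
    · simp [step, List.getElem?_eq_none (not_lt.1 hc)]
  | succ t ih =>
    simp only [steps, ev_bind] at ih ⊢
    exact ev_mono fun c' => ih c'

lemma ev_steps_halted {P : List Instr} {O : Oracles} {c : Config} (hP : P[c.pc]? = none)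
    (f : Config → ℝ≥0∞) (t : ℕ) : ev (steps P O t c) f = f c := by
  induction t with
  | zero => simp [steps]
  | succ t ih => simpa [steps, step, hP] using ih

lemma pay_le_value {P : List Instr} {pay : Config → ℝ≥0∞} (c : Config) : pay c ≤ value P pay c :=
  le_iSup_of_le 0 (by simp [steps])

lemma value_le_of_step {P : List Instr} {pay : Config → ℝ≥0∞} {c c' : Config}
    (h : step P noOracles c = PMF.pure c') : value P pay c' ≤ value P pay c :=
  iSup_le fun t => le_iSup_of_le (t + 1) (by rw [steps, ev_bind, h, ev_pure])

lemma value_le_of_coin {P : List Instr} {pay : Config → ℝ≥0∞}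
    (hpay : ∀ c, c.pc < P.length → pay c = 0) {c : Config} {f : Bool → Config}
    (h : step P noOracles c = (PMF.uniformOfFintype Bool).map f) :
    (value P pay (f false) + value P pay (f true)) / 2 ≤ value P pay c := by
  unfold value
  rw [ENNReal.iSup_add_iSup_of_monotone (ev_steps_mono hpay _) (ev_steps_mono hpay _),
    ENNReal.iSup_div]
  refine iSup_le fun t => le_iSup_of_le (t + 1) (le_of_eq ?_)
  rw [steps, ev_bind, h, ev_map, ev_coin]

/-- If every payoff is for a halting run of cost at most `B`, then `B` steps are enough. -/
lemma value_eq {P : List Instr} {pay : Config → ℝ≥0∞} {B : ℕ}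
    (hpay : ∀ c, c.pc < P.length → pay c = 0) (hB : ∀ c, B < c.cost → pay c = 0) (c : Config) :
    value P pay c = ev (steps P noOracles B c) pay := by
  have key : ∀ t c, B < c.cost + (t + 1) →
      ev (steps P noOracles (t + 1) c) pay ≤ ev (steps P noOracles t c) pay := by
    intro t
    induction t with
    | zero =>
      intro c hc
      simp only [steps, ev_bind, ev_pure]
      cases hP : P[c.pc]? with
      | none => simp [step, hP]
      | some I =>
        simp only [step, hP]
        refine (ev_eq_zero fun c' hc' => hB c' ?_).le.trans zero_le
        have := cost_lt_of_exec hc'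
        omega
    | succ t ih =>
      intro c hc
      rw [steps, ev_bind, steps, ev_bind]
      cases hP : P[c.pc]? with
      | none =>
        simp only [step, hP, ev_pure]
        rw [ev_steps_halted hP, ev_steps_halted hP]
      | some I =>
        simp only [step, hP]
        refine ev_mono_support fun c' hc' => ih c' ?_
        have := cost_lt_of_exec hc'
        omega
  refine le_antisymm (iSup_le fun t => ?_) (le_iSup (fun t => ev (steps P noOracles t c) pay) B)
  rcases le_total t B with h | h
  · exact ev_steps_mono hpay c h
  · induction t, h using Nat.le_induction with
    | base => rfl
    | succ t ht ih => exact (key t c (by omega)).trans ih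

/-! ### A structured programming language -/

/-- The arithmetic operations of the machines. -/
inductive Op where
  | add | sub | mul | div | mod

/-- The function that an operation computes. -/
def Op.fn : Op → ℕ → ℕ → ℕ
  | add => (· + ·)
  | sub => (· - ·)
  | mul => (· * ·)
  | div => (· / ·)
  | mod => (· % ·)

/-- The operation number in instruction codes. -/
def Op.num : Op → ℕ
  | add => 2
  | sub => 3
  | mul => 4
  | div => 5
  | mod => 6

/-- Structured programs without oracle calls. -/
inductive Cmd where
  | skip
  | const (r v : ℕ)
  | copy (r s : ℕ)
  | op (o : Op) (r s t : ℕ)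
  | flip (r : ℕ)
  | seq (c c' : Cmd)
  /-- if register `r` holds zero, run `c`, otherwise `c'` -/
  | ite (r : ℕ) (c c' : Cmd)
  /-- as long as register `r` does not hold zero, run `c` -/
  | loop (r : ℕ) (c : Cmd)

/-- Run the given programs one after the other. -/
def Cmd.block : List Cmd → Cmd
  | [] => .skip
  | c :: cs => .seq c (block cs)

/-- The number of instructions of the compiled program. -/
def Cmd.size : Cmd → ℕ
  | skip => 0
  | const _ _ | copy _ _ | op _ _ _ _ | flip _ => 1
  | seq c c' => c.size + c'.size
  | ite _ c c' => c.size + c'.size + 2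
  | loop _ c => c.size + 2

/-- The code of a structured program that is placed at the address `a`. Register `4` must hold zero: it
is used for unconditional jumps. -/
def Cmd.compile : Cmd → ℕ → List Code
  | skip, _ => []
  | const r v, _ => [(0, r, v, 0)]
  | copy r s, _ => [(1, r, s, 0)]
  | op o r s t, _ => [(o.num, r, s, t)]
  | flip r, _ => [(8, r, 0, 0)]
  | seq c c', a => c.compile a ++ c'.compile (a + c.size)
  | ite r c c', a =>
    (7, r, a + (c'.size + 2), 0) :: (c'.compile (a + 1) ++
      ((7, 4, a + (c.size + c'.size + 2), 0) :: c.compile (a + (c'.size + 2))))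
  | loop r c, a => (7, r, a + (c.size + 2), 0) :: (c.compile (a + 1) ++ [(7, 4, a, 0)])

/-- The program does not write to register `4`. -/
def Cmd.Safe : Cmd → Prop
  | skip => True
  | const r _ | copy r _ | op _ r _ _ | flip r => r ≠ 4
  | seq c c' | ite _ c c' => c.Safe ∧ c'.Safe
  | loop _ c => c.Safe

lemma Cmd.length_compile (c : Cmd) (a : ℕ) : (c.compile a).length = c.size := by
  induction c generalizing a with
  | seq c c' h h' => simp [compile, size, h, h']
  | ite r c c' h h' => simp [compile, size, h, h']; omega
  | loop r c h => simp [compile, size, h]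
  | _ => simp [compile, size]

/-- `k` rounds of a loop, as a transformer of lower bounds; `G` stands for the body. -/
noncomputable def rounds (r : ℕ) (G : ((ℕ → ℕ) → ℕ → ℝ≥0∞) → (ℕ → ℕ) → ℕ → ℝ≥0∞)
    (F : (ℕ → ℕ) → ℕ → ℝ≥0∞) : ℕ → (ℕ → ℕ) → ℕ → ℝ≥0∞
  | 0 => fun _ _ => 0
  | k + 1 => fun ρ n =>
    if ρ r = 0 then F ρ (n + 1) else G (fun ρ' n' => rounds r G F k ρ' (n' + 1)) ρ (n + 1)

/-- A quantitative weakest precondition: if `F ρ n` is a lower bound for the expected payoff after the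
program, in the state `ρ` and after `n` steps, then `wp M c F ρ n` is one before the program. Runs
that compute a number of more than `M` bits count for nothing. -/
noncomputable def wp (M : ℕ) : Cmd → ((ℕ → ℕ) → ℕ → ℝ≥0∞) → (ℕ → ℕ) → ℕ → ℝ≥0∞
  | .skip, F => F
  | .const r v, F => fun ρ n => if v < 2 ^ M then F (Function.update ρ r v) (n + 1) else 0
  | .copy r s, F => fun ρ n => F (Function.update ρ r (ρ s)) (n + 1)
  | .op o r s t, F => fun ρ n =>
    if o.fn (ρ s) (ρ t) < 2 ^ M then F (Function.update ρ r (o.fn (ρ s) (ρ t))) (n + 1) else 0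
  | .flip r, F => fun ρ n =>
    (F (Function.update ρ r 0) (n + 1) + F (Function.update ρ r 1) (n + 1)) / 2
  | .seq c c', F => wp M c (wp M c' F)
  | .ite r c c', F => fun ρ n =>
    if ρ r = 0 then wp M c F ρ (n + 1) else wp M c' (fun ρ' n' => F ρ' (n' + 1)) ρ (n + 1)
  | .loop r c, F => fun ρ n => ⨆ k, rounds r (wp M c) F k ρ n

section wp
variable {M : ℕ} {F F' : (ℕ → ℕ) → ℕ → ℝ≥0∞}

lemma rounds_mono {r : ℕ} {G : ((ℕ → ℕ) → ℕ → ℝ≥0∞) → (ℕ → ℕ) → ℕ → ℝ≥0∞}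
    (hG : Monotone G) (h : F ≤ F') (k : ℕ) : rounds r G F k ≤ rounds r G F' k := by
  induction k with
  | zero => exact le_rfl
  | succ k ih =>
    intro ρ n
    simp only [rounds]
    split
    · exact h _ _
    · exact hG (fun ρ' n' => ih ρ' (n' + 1)) _ _

lemma rounds_mono_count {r : ℕ} {G : ((ℕ → ℕ) → ℕ → ℝ≥0∞) → (ℕ → ℕ) → ℕ → ℝ≥0∞}
    (hG : Monotone G) : Monotone (rounds r G F) := by
  refine monotone_nat_of_le_succ fun k => ?_
  induction k with
  | zero => intro ρ n; exact zero_le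
  | succ k ih =>
    intro ρ n
    rw [rounds, rounds]
    dsimp only
    split
    · exact le_rfl
    · exact hG (fun ρ' n' => ih ρ' (n' + 1)) _ _

lemma wp_mono (c : Cmd) : Monotone (wp M c) := by
  induction c with
  | skip => exact monotone_id
  | const r v => intro F F' h ρ n; simp only [wp]; split; exacts [h _ _, le_rfl]
  | copy r s => intro F F' h ρ n; exact h _ _
  | op o r s t => intro F F' h ρ n; simp only [wp]; split; exacts [h _ _, le_rfl]
  | flip r => intro F F' h ρ n; simp only [wp]; gcongr <;> exact h _ _
  | seq c c' hc hc' => intro F F' h; exact hc (hc' h)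
  | ite r c c' hc hc' =>
    intro F F' h ρ n
    simp only [wp]
    split
    · exact hc h _ _
    · exact hc' (fun ρ' n' => h ρ' (n' + 1)) _ _
  | loop r c hc => intro F F' h ρ n; exact iSup_mono fun k => rounds_mono hc h k _ _

/-- The transformers are continuous. -/
lemma wp_iSup_le (c : Cmd) : ∀ {F : ℕ → (ℕ → ℕ) → ℕ → ℝ≥0∞}, Monotone F → ∀ ρ n,
    wp M c (fun ρ n => ⨆ i, F i ρ n) ρ n ≤ ⨆ i, wp M c (F i) ρ n := by
  induction c with
  | skip => intro F _ ρ n; exact le_rfl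
  | const r v => intro F _ ρ n; simp only [wp]; split <;> simp
  | copy r s => intro F _ ρ n; exact le_rfl
  | op o r s t => intro F _ ρ n; simp only [wp]; split <;> simp
  | flip r =>
    intro F hF ρ n
    simp only [wp]
    rw [ENNReal.iSup_add_iSup_of_monotone (fun i j h => hF h _ _) (fun i j h => hF h _ _),
      ENNReal.iSup_div]
  | seq c c' hc hc' =>
    intro F hF ρ n
    simp only [wp]
    exact (wp_mono c (fun ρ n => hc' hF ρ n) ρ n).trans
      (hc (F := fun i => wp M c' (F i)) (fun i j h => wp_mono c' (hF h)) ρ n)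
  | ite r c c' hc hc' =>
    intro F hF ρ n
    simp only [wp]
    split
    · exact hc hF _ _
    · exact hc' (F := fun i ρ' n' => F i ρ' (n' + 1)) (fun i j h ρ n => hF h _ _) _ _
  | loop r c hc =>
    intro F hF ρ n
    simp only [wp]
    refine iSup_le fun k => ?_
    suffices rounds r (wp M c) (fun ρ n => ⨆ i, F i ρ n) k ρ n ≤
        ⨆ i, rounds r (wp M c) (F i) k ρ n from
      this.trans (iSup_mono fun i => le_iSup (fun k => rounds r (wp M c) (F i) k ρ n) k)
    induction k generalizing ρ n with
    | zero => exact zero_le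
    | succ k ih =>
      simp only [rounds]
      split
      · exact le_rfl
      · exact (wp_mono c (fun ρ' n' => ih ρ' (n' + 1)) _ _).trans
          (hc (F := fun i ρ' n' => rounds r (wp M c) (F i) k ρ' (n' + 1))
            (fun i j h ρ n => rounds_mono (wp_mono c) (hF h) k _ _) _ _)

variable {X : ℝ≥0∞} {ρ : ℕ → ℕ} {n : ℕ}

lemma le_const {r v : ℕ} (hv : v < 2 ^ M) (h : X ≤ F (Function.update ρ r v) (n + 1)) :
    X ≤ wp M (.const r v) F ρ n := by
  simpa [wp, hv] using h

lemma le_copy {r s : ℕ} (h : X ≤ F (Function.update ρ r (ρ s)) (n + 1)) :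
    X ≤ wp M (.copy r s) F ρ n := h

lemma le_op {o : Op} {r s t : ℕ} (v : ℕ) (hv : o.fn (ρ s) (ρ t) = v) (hM : v < 2 ^ M)
    (h : X ≤ F (Function.update ρ r v) (n + 1)) : X ≤ wp M (.op o r s t) F ρ n := by
  subst hv
  simpa [wp, hM] using h

lemma le_ite_zero {r : ℕ} {c c' : Cmd} (hr : ρ r = 0) (h : X ≤ wp M c F ρ (n + 1)) :
    X ≤ wp M (.ite r c c') F ρ n := by
  simpa [wp, hr] using h

lemma le_ite_ne {r : ℕ} {c c' : Cmd} (hr : ρ r ≠ 0)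
    (h : X ≤ wp M c' (fun ρ' n' => F ρ' (n' + 1)) ρ (n + 1)) :
    X ≤ wp M (.ite r c c') F ρ n := by
  simpa [wp, hr] using h

lemma le_loop_zero {r : ℕ} {c : Cmd} (hr : ρ r = 0) (h : X ≤ F ρ (n + 1)) :
    X ≤ wp M (.loop r c) F ρ n :=
  h.trans (le_iSup_of_le 1 (by simp [rounds, hr]))

lemma le_loop_ne {r : ℕ} {c : Cmd} (hr : ρ r ≠ 0)
    (h : X ≤ wp M c (fun ρ' n' => wp M (.loop r c) F ρ' (n' + 1)) ρ (n + 1)) :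
    X ≤ wp M (.loop r c) F ρ n := by
  refine h.trans ((wp_iSup_le c (F := fun k ρ' n' => rounds r (wp M c) F k ρ' (n' + 1))
    (fun i j hij ρ' n' => rounds_mono_count (wp_mono c) hij ρ' (n' + 1)) _ _).trans
    (iSup_le fun k => le_iSup_of_le (k + 1) ?_))
  simp [rounds, hr]

end wp

/-! ### Correctness of the compiler -/

/-- The piece `L` of the code `C` starts at the address `a`. -/
def CodeAt (C : List Code) (a : ℕ) (L : List Code) : Prop :=
  ∃ pre post, C = pre ++ L ++ post ∧ pre.length = a

lemma CodeAt.left {C L L' : List Code} {a : ℕ} (h : CodeAt C a (L ++ L')) : CodeAt C a L := by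
  obtain ⟨pre, post, rfl, rfl⟩ := h
  exact ⟨pre, L' ++ post, by simp, rfl⟩

lemma CodeAt.right {C L L' : List Code} {a : ℕ} (h : CodeAt C a (L ++ L')) :
    CodeAt C (a + L.length) L' := by
  obtain ⟨pre, post, rfl, rfl⟩ := h
  exact ⟨pre ++ L, post, by simp, by simp⟩

lemma CodeAt.tail {C L : List Code} {a : ℕ} {I : Code} (h : CodeAt C a (I :: L)) :
    CodeAt C (a + 1) L :=
  CodeAt.right (L := [I]) h

lemma CodeAt.head {C L : List Code} {a : ℕ} {I : Code} (h : CodeAt C a (I :: L)) :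
    (C.map Instr.ofCode)[a]? = some (Instr.ofCode I) := by
  obtain ⟨pre, post, rfl, rfl⟩ := h
  simp

/-- All registers hold numbers of at most `M` bits. -/
def Bounded (M : ℕ) (ρ : ℕ → ℕ) : Prop := ∀ r, ρ r < 2 ^ M

lemma strLen_le_of_lt {x M : ℕ} (h : x < 2 ^ M) : strLen x ≤ M := by
  unfold strLen
  exact (Nat.log_mono_right (Nat.succ_le_of_lt h)).trans (by rw [Nat.log_pow (by norm_num)])

lemma Bounded.update {M : ℕ} {ρ : ℕ → ℕ} (h : Bounded M ρ) {r v : ℕ} (hv : v < 2 ^ M) :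
    Bounded M (Function.update ρ r v) := by
  intro s
  by_cases hs : s = r
  · subst hs; simpa using hv
  · simpa [hs] using h s

/-- The least expected payoff of the machine with code `C` from the instruction number `a` and the
register contents `ρ`, if the cost is at most that of `n` instructions that handle numbers of `M` bits:
such an instruction costs at most `1 + 3 * M`. -/
noncomputable def valueAt (C : List Code) (pay : Config → ℝ≥0∞) (M a : ℕ) (ρ : ℕ → ℕ) (n : ℕ) :
    ℝ≥0∞ :=
  ⨅ (c : Config) (_ : c.pc = a ∧ c.reg = ρ ∧ c.cost ≤ n * (1 + 3 * M)),
    value (C.map Instr.ofCode) pay c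

section valueAt
variable {C : List Code} {pay : Config → ℝ≥0∞} {M a n : ℕ} {ρ : ℕ → ℕ} {I : Code} {L : List Code}

lemma valueAt_le_of_step {a' : ℕ} {ρ' : ℕ → ℕ}
    (h : ∀ c : Config, c.pc = a → c.reg = ρ → ∃ c' : Config,
      step (C.map Instr.ofCode) noOracles c = PMF.pure c' ∧ c'.pc = a' ∧ c'.reg = ρ' ∧
        c'.cost ≤ c.cost + (1 + 3 * M)) :
    valueAt C pay M a' ρ' (n + 1) ≤ valueAt C pay M a ρ n := by
  refine le_iInf₂ fun c hc => ?_
  obtain ⟨c', h1, h2, h3, h4⟩ := h c hc.1 hc.2.1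
  refine (iInf₂_le c' ⟨h2, h3, ?_⟩).trans (value_le_of_step h1)
  have := hc.2.2
  linarith

lemma valueAt_const {r v x : ℕ} (h : CodeAt C a ((0, r, v, x) :: L)) (hv : v < 2 ^ M) :
    valueAt C pay M (a + 1) (Function.update ρ r v) (n + 1) ≤ valueAt C pay M a ρ n := by
  refine valueAt_le_of_step fun c hpc hreg => ⟨c.put r v (strLen v), ?_, ?_, ?_, ?_⟩
  · simp [step, hpc, h.head, Instr.ofCode, Instr.exec]
  · simp [Config.put, hpc]
  · simp [Config.put, hreg]
  · have := strLen_le_of_lt hv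
    simp only [Config.put]
    omega

lemma valueAt_copy {r s x : ℕ} (h : CodeAt C a ((1, r, s, x) :: L)) (hρ : Bounded M ρ) :
    valueAt C pay M (a + 1) (Function.update ρ r (ρ s)) (n + 1) ≤ valueAt C pay M a ρ n := by
  refine valueAt_le_of_step fun c hpc hreg => ⟨c.put r (ρ s) (strLen (ρ s)), ?_, ?_, ?_, ?_⟩
  · simp [step, hpc, h.head, Instr.ofCode, Instr.exec, hreg]
  · simp [Config.put, hpc]
  · simp [Config.put, hreg]
  · have := strLen_le_of_lt (hρ s)
    simp only [Config.put]
    omega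

lemma valueAt_op {o : Op} {r s t : ℕ} (h : CodeAt C a ((o.num, r, s, t) :: L)) (hρ : Bounded M ρ)
    (hv : o.fn (ρ s) (ρ t) < 2 ^ M) :
    valueAt C pay M (a + 1) (Function.update ρ r (o.fn (ρ s) (ρ t))) (n + 1) ≤
      valueAt C pay M a ρ n := by
  refine valueAt_le_of_step fun c hpc hreg => ⟨c.binop o.fn r s t, ?_, ?_, ?_, ?_⟩
  · have := h.head
    cases o <;> simp only [step, hpc, this] <;> rfl
  · simp [Config.put, Config.binop, hpc]
  · simp [Config.put, Config.binop, hreg]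
  · have h1 := strLen_le_of_lt hv
    have h2 := strLen_le_of_lt (hρ s)
    have h3 := strLen_le_of_lt (hρ t)
    simp only [Config.put, Config.binop, hreg]
    omega

lemma valueAt_jump {r p x : ℕ} (h : CodeAt C a ((7, r, p, x) :: L)) (hρ : Bounded M ρ) :
    valueAt C pay M (if ρ r = 0 then p else a + 1) ρ (n + 1) ≤ valueAt C pay M a ρ n := by
  refine valueAt_le_of_step fun c hpc hreg =>
    ⟨{ c with pc := if c.reg r = 0 then p else c.pc + 1, cost := c.cost + (1 + strLen (c.reg r)) },
      ?_, ?_, ?_, ?_⟩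
  · simp [step, hpc, h.head, Instr.ofCode, Instr.exec]
  · simp [hreg, hpc]
  · simp [hreg]
  · have := strLen_le_of_lt (hρ r)
    simp only [hreg]
    omega

lemma valueAt_flip (hpay : ∀ c, c.pc < C.length → pay c = 0) {r x y : ℕ}
    (h : CodeAt C a ((8, r, x, y) :: L)) :
    (valueAt C pay M (a + 1) (Function.update ρ r 0) (n + 1) +
      valueAt C pay M (a + 1) (Function.update ρ r 1) (n + 1)) / 2 ≤ valueAt C pay M a ρ n := by
  refine le_iInf₂ fun c hc => ?_
  have hstep : step (C.map Instr.ofCode) noOracles c =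
      (PMF.uniformOfFintype Bool).map fun b => c.put r b.toNat 0 := by
    simp [step, hc.1, h.head, Instr.ofCode, Instr.exec]
  refine le_trans ?_ (value_le_of_coin (by simpa using hpay) hstep)
  have hcost := hc.2.2
  gcongr <;> refine iInf₂_le _ ⟨?_, ?_, ?_⟩ <;> simp [Config.put, hc.1, hc.2.1] <;> linarith

/-- The compiler is correct: a weakest precondition is a lower bound for the expected payoff of the
compiled program. -/
theorem wp_le_valueAt (hM : 1 ≤ M) (hpay : ∀ c, c.pc < C.length → pay c = 0) (c : Cmd) :
    ∀ {a : ℕ} {F : (ℕ → ℕ) → ℕ → ℝ≥0∞}, c.Safe → CodeAt C a (c.compile a) →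
      (∀ ρ n, Bounded M ρ → ρ 4 = 0 → F ρ n ≤ valueAt C pay M (a + c.size) ρ n) →
      ∀ ρ n, Bounded M ρ → ρ 4 = 0 → wp M c F ρ n ≤ valueAt C pay M a ρ n := by
  induction c with
  | skip => intro a F _ _ hF ρ n hρ h4; exact hF ρ n hρ h4
  | const r v =>
    intro a F hs hC hF ρ n hρ h4
    simp only [wp]
    split
    · next hv =>
      exact (hF _ _ (hρ.update hv) (by rw [Function.update_of_ne (Ne.symm hs), h4])).trans
        (valueAt_const hC hv)
    · exact zero_le
  | copy r s =>
    intro a F hs hC hF ρ n hρ h4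
    exact (hF _ _ (hρ.update (hρ s)) (by rw [Function.update_of_ne (Ne.symm hs), h4])).trans
      (valueAt_copy hC hρ)
  | op o r s t =>
    intro a F hs hC hF ρ n hρ h4
    simp only [wp]
    split
    · next hv =>
      exact (hF _ _ (hρ.update hv) (by rw [Function.update_of_ne (Ne.symm hs), h4])).trans
        (valueAt_op hC hρ hv)
    · exact zero_le
  | flip r =>
    intro a F hs hC hF ρ n hρ h4
    refine le_trans ?_ (valueAt_flip hpay hC)
    simp only [wp]
    have h1 : 1 < 2 ^ M := Nat.one_lt_two_pow (by omega)
    gcongr <;> exact hF _ _ (hρ.update (by omega)) (by rw [Function.update_of_ne (Ne.symm hs), h4])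
  | seq c c' ih ih' =>
    intro a F hs hC hF ρ n hρ h4
    have hr := hC.right
    rw [Cmd.length_compile] at hr
    refine ih hs.1 hC.left (fun ρ n hρ h4 => ih' hs.2 hr (fun ρ n hρ h4 => ?_) ρ n hρ h4) ρ n hρ h4
    rw [add_assoc]
    exact hF ρ n hρ h4
  | ite r c c' ih ih' =>
    intro a F hs hC hF ρ n hρ h4
    have hl := hC.tail.left
    have hr := hC.tail.right
    rw [Cmd.length_compile, add_right_comm] at hr
    refine le_trans ?_ (valueAt_jump hC hρ)
    simp only [wp]
    split
    · refine ih hs.1 hr.tail (fun ρ n hρ h4 => (hF ρ n hρ h4).trans (le_of_eq ?_)) ρ _ hρ h4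
      congr 1
      simp only [Cmd.size]
      omega
    · refine ih' hs.2 hl (fun ρ n hρ h4 => (hF ρ (n + 1) hρ h4).trans ?_) ρ _ hρ h4
      have := valueAt_jump (pay := pay) (n := n) hr hρ
      rw [if_pos h4] at this
      rw [add_right_comm]
      simpa only [Cmd.size] using this
  | loop r c ih =>
    intro a F hs hC hF ρ n hρ h4
    simp only [wp]
    refine iSup_le fun k => ?_
    have hl := hC.tail.left
    have hr := hC.tail.right
    rw [Cmd.length_compile] at hr
    induction k generalizing ρ n with
    | zero => exact zero_le
    | succ k ihk =>
      refine le_trans ?_ (valueAt_jump hC hρ)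
      simp only [rounds]
      split
      · exact hF ρ _ hρ h4
      · refine ih hs hl (fun ρ n hρ h4 => (ihk ρ (n + 1) hρ h4).trans ?_) ρ _ hρ h4
        have := valueAt_jump (pay := pay) (n := n) hr hρ
        rwa [if_pos h4] at this

end valueAt

/-! ### The program that answers hash queries -/

section steps
variable {M : ℕ} {F : (ℕ → ℕ) → ℕ → ℝ≥0∞} {X : ℝ≥0∞} {ρ : ℕ → ℕ} {n : ℕ}

lemma le_cons {c : Cmd} {cs : List Cmd} (h : X ≤ wp M c (wp M (.block cs) F) ρ n) :
    X ≤ wp M (.block (c :: cs)) F ρ n := h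

lemma le_nil (h : X ≤ F ρ n) : X ≤ wp M (.block []) F ρ n := h

lemma le_flip {r : ℕ} {X₀ X₁ : ℝ≥0∞} (h₀ : X₀ ≤ F (Function.update ρ r 0) (n + 1))
    (h₁ : X₁ ≤ F (Function.update ρ r 1) (n + 1)) : (X₀ + X₁) / 2 ≤ wp M (.flip r) F ρ n := by
  simp only [wp]
  gcongr

end steps

/-- A table of triples of a message, its hash value and a number that is used as its signature, as a
number in base `D`. Messages are shifted by one, so that the code of a nonempty table is not zero. -/
def encodeTable (D : ℕ) : List (ℕ × ℕ × ℕ) → ℕ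
  | [] => 0
  | (m, h, s) :: τ => ((encodeTable D τ * D + (m + 1)) * D + h) * D + s

/-- The table of the messages and hash values only. -/
def hashTable (τ : List (ℕ × ℕ × ℕ)) : List (ℕ × ℕ) := τ.map fun a => (a.1, a.2.1)

/-- The hash value and the signature of a message in a table. -/
def findEntry : List (ℕ × ℕ × ℕ) → ℕ → Option (ℕ × ℕ)
  | [], _ => none
  | (m, h, s) :: τ, x => if m = x then some (h, s) else findEntry τ x

/-- Look for the entry with the first component in register `12` (a message plus one). If there is one,
put its hash value into register `14` and its signature into register `15`, and clear register
`13`. -/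
def lookupLoop : Cmd :=
  .loop 16 (.block [.op .mod 15 16 7, .op .div 16 16 7, .op .mod 14 16 7, .op .div 16 16 7,
    .op .mod 17 16 7, .op .div 16 16 7, .op .sub 18 17 12, .op .sub 17 12 17, .op .add 18 18 17,
    .ite 18 (.block [.const 16 0, .const 13 0]) .skip])

lemma lookupLoop_spec {M D x : ℕ} {F : (ℕ → ℕ) → ℕ → ℝ≥0∞} {X : ℝ≥0∞} (τ : List (ℕ × ℕ × ℕ)) :
    ∀ (ρ : ℕ → ℕ) (n : ℕ), (∀ a ∈ τ, a.1 + 1 < D ∧ a.2.1 < D ∧ a.2.2 < D) →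
    encodeTable D τ < 2 ^ M → 2 * D ≤ 2 ^ M → x + 1 < D →
    ρ 16 = encodeTable D τ → ρ 12 = x + 1 → ρ 7 = D →
    (∀ ρ' n', n' ≤ n + 20 * τ.length + 20 → (∀ r, r < 13 ∨ 24 ≤ r → ρ' r = ρ r) →
      (findEntry τ x = none → ρ' 13 = ρ 13) →
      (∀ h s, findEntry τ x = some (h, s) → ρ' 13 = 0 ∧ ρ' 14 = h ∧ ρ' 15 = s) → X ≤ F ρ' n') →
    X ≤ wp M lookupLoop F ρ n := by
  induction τ with
  | nil =>
    intro ρ n _ _ _ _ h16 h12 h7 hF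
    exact le_loop_zero h16 (hF _ _ (by omega) (fun _ _ => rfl) (fun _ => rfl)
      (fun h s e => by simp [findEntry] at e))
  | cons a τ ih =>
    obtain ⟨m, h, s⟩ := a
    intro ρ n hτ hM hDM hx h16 h12 h7 hF
    obtain ⟨hm, hh, hs⟩ := hτ _ (List.mem_cons_self ..)
    simp only at hm hh hs
    simp only [encodeTable] at h16 hM
    have hD : 0 < D := by omega
    set E := encodeTable D τ with hE
    have d1 : ((E * D + (m + 1)) * D + h) * D + s = s + D * ((E * D + (m + 1)) * D + h) := by ring
    have d2 : (E * D + (m + 1)) * D + h = h + D * (E * D + (m + 1)) := by ring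
    have d3 : E * D + (m + 1) = (m + 1) + D * E := by ring
    have m1 : (((E * D + (m + 1)) * D + h) * D + s) % D = s := by
      rw [d1, Nat.add_mul_mod_self_left, Nat.mod_eq_of_lt hs]
    have q1 : (((E * D + (m + 1)) * D + h) * D + s) / D = (E * D + (m + 1)) * D + h := by
      rw [d1, Nat.add_mul_div_left _ _ hD, Nat.div_eq_of_lt hs, zero_add]
    have m2 : ((E * D + (m + 1)) * D + h) % D = h := by
      rw [d2, Nat.add_mul_mod_self_left, Nat.mod_eq_of_lt hh]
    have q2 : ((E * D + (m + 1)) * D + h) / D = E * D + (m + 1) := by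
      rw [d2, Nat.add_mul_div_left _ _ hD, Nat.div_eq_of_lt hh, zero_add]
    have m3 : (E * D + (m + 1)) % D = m + 1 := by
      rw [d3, Nat.add_mul_mod_self_left, Nat.mod_eq_of_lt hm]
    have q3 : (E * D + (m + 1)) / D = E := by
      rw [d3, Nat.add_mul_div_left _ _ hD, Nat.div_eq_of_lt hm, zero_add]
    have b1 : (E * D + (m + 1)) * D + h < 2 ^ M := by
      rw [← q1]; exact (Nat.div_le_self _ _).trans_lt hM
    have b2 : E * D + (m + 1) < 2 ^ M := by rw [← q2]; exact (Nat.div_le_self _ _).trans_lt b1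
    have b3 : E < 2 ^ M := by rw [← q3]; exact (Nat.div_le_self _ _).trans_lt b2
    refine le_loop_ne ?_ ?_
    · rw [h16, d1]
      have : 0 < D * ((E * D + (m + 1)) * D + h) := by positivity
      omega
    apply le_cons; refine le_op s (by simp [Op.fn, h16, h7, m1]) (by omega) ?_
    apply le_cons; refine le_op _ (by simp [Op.fn, h16, h7, q1]) b1 ?_
    apply le_cons; refine le_op h (by simp [Op.fn, h7, m2]) (by omega) ?_
    apply le_cons; refine le_op _ (by simp [Op.fn, h7, q2]) b2 ?_
    apply le_cons; refine le_op (m + 1) (by simp [Op.fn, h7, m3]) (by omega) ?_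
    apply le_cons; refine le_op E (by simp [Op.fn, h7, q3]) b3 ?_
    apply le_cons; refine le_op (m - x) (by simp [Op.fn, h12]) (by omega) ?_
    apply le_cons; refine le_op (x - m) (by simp [Op.fn, h12]) (by omega) ?_
    apply le_cons; refine le_op (m - x + (x - m)) (by simp [Op.fn]) (by omega) ?_
    apply le_cons
    by_cases hmx : m = x
    · subst hmx
      refine le_ite_zero (by simp) ?_
      apply le_cons; refine le_const (by positivity) ?_
      apply le_cons; refine le_const (by positivity) ?_
      apply le_nil; apply le_nil
      refine le_loop_zero (by simp) (hF _ _ (by simp; omega) ?_ ?_ ?_)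
      · intro r hr
        have : r ≠ 13 ∧ r ≠ 14 ∧ r ≠ 15 ∧ r ≠ 16 ∧ r ≠ 17 ∧ r ≠ 18 := by omega
        simp [this]
      · intro e; simp [findEntry] at e
      · intro h' s' e
        simp [findEntry] at e
        simp [e]
    · refine le_ite_ne (by simp; omega) ?_
      change X ≤ wp M (.block []) _ _ _
      apply le_nil
      refine ih _ _ (fun a ha => hτ a (List.mem_cons_of_mem _ ha)) b3 hDM hx (by simp [hE])
        (by simp [h12]) (by simp [h7]) fun ρ' n' hn' hfr hnone hsome => hF ρ' n' ?_ ?_ ?_ ?_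
      · simp only [List.length_cons]; omega
      · intro r hr
        have : r ≠ 13 ∧ r ≠ 14 ∧ r ≠ 15 ∧ r ≠ 16 ∧ r ≠ 17 ∧ r ≠ 18 := by omega
        simp [hfr r hr, this]
      · intro e
        simp only [findEntry, hmx, if_false] at e
        simp [hnone e]
      · intro h' s' e
        simp only [findEntry, hmx, if_false] at e
        exact hsome _ _ e

/-- Put a uniformly random number of `l + 1` bits into register `19`, if register `8` holds `2 ^ l`. -/
def sampleBits : List Cmd :=
  [.const 19 0, .copy 20 8,
    .loop 20 (.block [.op .add 19 19 19, .flip 18, .op .add 19 19 18, .op .div 20 20 6])]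

lemma sampleLoop_spec {M : ℕ} {F : (ℕ → ℕ) → ℕ → ℝ≥0∞} {cs : List Cmd} {G : ℕ → ℝ≥0∞} (k : ℕ) :
    ∀ (ρ : ℕ → ℕ) (n u : ℕ), ρ 20 = 2 ^ k / 2 → ρ 19 = u → ρ 6 = 2 → (u + 1) * 2 ^ k ≤ 2 ^ M →
    (∀ v < 2 ^ k, ∀ ρ' n', n' ≤ n + 6 * k + 1 →
      (∀ r, r < 18 ∨ 21 ≤ r → ρ' r = ρ r) → ρ' 19 = u * 2 ^ k + v →
      G (u * 2 ^ k + v) ≤ wp M (.block cs) F ρ' n') →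
    (∑ v ∈ Finset.range (2 ^ k), G (u * 2 ^ k + v)) / 2 ^ k ≤ wp M (.block
      (.loop 20 (.block [.op .add 19 19 19, .flip 18, .op .add 19 19 18, .op .div 20 20 6]) :: cs))
      F ρ n := by
  induction k with
  | zero =>
    intro ρ n u h20 h19 _ _ hF
    apply le_cons
    refine le_loop_zero (by simpa using h20) ?_
    simpa using hF 0 (by simp) ρ (n + 1) (by omega) (fun _ _ => rfl) (by simpa using h19)
  | succ k ih =>
    intro ρ n u h20 h19 h6 hM hF
    have h20' : ρ 20 = 2 ^ k := by rw [h20, pow_succ]; simp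
    have hk : 0 < 2 ^ k := by positivity
    have hM' : (2 * u + 1 + 1) * 2 ^ k ≤ 2 ^ M := by rw [pow_succ] at hM; linarith
    have hM0 : (2 * u + 1) * 2 ^ k ≤ 2 ^ M := by linarith
    have hu : 2 * u + 2 ≤ 2 ^ M := le_trans (Nat.le_mul_of_pos_right _ hk) hM'
    have hkM : 2 ^ k / 2 < 2 ^ M :=
      (Nat.div_lt_self hk (by norm_num)).trans_le (le_trans (Nat.le_mul_of_pos_left _ (by omega)) hM')
    have split : (∑ v ∈ Finset.range (2 ^ (k + 1)), G (u * 2 ^ (k + 1) + v)) / 2 ^ (k + 1) =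
        ((∑ v ∈ Finset.range (2 ^ k), G (2 * u * 2 ^ k + v)) / 2 ^ k +
          (∑ v ∈ Finset.range (2 ^ k), G ((2 * u + 1) * 2 ^ k + v)) / 2 ^ k) / 2 := by
      rw [← ENNReal.add_div, pow_succ 2 k, mul_two (2 ^ k : ℕ), Finset.sum_range_add, pow_succ,
        div_eq_mul_inv, div_eq_mul_inv, div_eq_mul_inv,
        ENNReal.mul_inv (.inl (by simp)) (.inl (by simp)), ← mul_assoc]
      have e1 : ∀ v, u * (2 ^ k + 2 ^ k) + v = 2 * u * 2 ^ k + v := fun v => by ring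
      have e2 : ∀ v, u * (2 ^ k + 2 ^ k) + (2 ^ k + v) = (2 * u + 1) * 2 ^ k + v := fun v => by ring
      simp only [e2]
      simp only [e1]
    rw [split]
    apply le_cons
    refine le_loop_ne (by omega) ?_
    apply le_cons; refine le_op (2 * u) (by simp [Op.fn, h19]; ring) (by omega) ?_
    apply le_cons
    refine le_flip ?_ ?_
    · apply le_cons; refine le_op (2 * u) (by simp [Op.fn]) (by omega) ?_
      apply le_cons; refine le_op (2 ^ k / 2) (by simp [Op.fn, h20', h6]) hkM ?_
      apply le_nil
      refine ih _ _ (2 * u) (by simp) (by simp) (by simp [h6]) hM0 fun v hv ρ' n' hn' hfr h19' => ?_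
      have := hF v (by rw [pow_succ]; omega) ρ' n' (by omega) (fun r hr => ?_)
        (by rw [h19']; ring)
      · have e : u * 2 ^ (k + 1) = 2 * u * 2 ^ k := by ring
        rwa [e] at this
      · have h : r ≠ 18 ∧ r ≠ 19 ∧ r ≠ 20 := by omega
        simp [hfr r hr, h]
    · apply le_cons; refine le_op (2 * u + 1) (by simp [Op.fn]) (by omega) ?_
      apply le_cons; refine le_op (2 ^ k / 2) (by simp [Op.fn, h20', h6]) hkM ?_
      apply le_nil
      refine ih _ _ (2 * u + 1) (by simp) (by simp) (by simp [h6]) hM' fun v hv ρ' n' hn' hfr h19' => ?_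
      have := hF (2 ^ k + v) (by rw [pow_succ]; omega) ρ' n' (by omega) (fun r hr => ?_)
        (by rw [h19']; ring)
      · have e : u * 2 ^ (k + 1) + (2 ^ k + v) = (2 * u + 1) * 2 ^ k + v := by ring
        rwa [e] at this
      · have h : r ≠ 18 ∧ r ≠ 19 ∧ r ≠ 20 := by omega
        simp [hfr r hr, h]

lemma sampleBits_spec {M l : ℕ} {F : (ℕ → ℕ) → ℕ → ℝ≥0∞} {cs : List Cmd} {G : ℕ → ℝ≥0∞}
    (ρ : ℕ → ℕ) (n : ℕ) (h8 : ρ 8 = 2 ^ l) (h6 : ρ 6 = 2) (hM : l + 1 ≤ M)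
    (hF : ∀ u < 2 ^ (l + 1), ∀ ρ' n', n' ≤ n + 6 * (l + 1) + 3 →
      (∀ r, r < 18 ∨ 21 ≤ r → ρ' r = ρ r) → ρ' 19 = u → G u ≤ wp M (.block cs) F ρ' n') :
    (∑ u ∈ Finset.range (2 ^ (l + 1)), G u) / 2 ^ (l + 1) ≤
      wp M (.block (sampleBits ++ cs)) F ρ n := by
  have hpow : 2 ^ (l + 1) ≤ 2 ^ M := Nat.pow_le_pow_right (by norm_num) hM
  have hl : 0 < 2 ^ l := by positivity
  have := @sampleLoop_spec M F cs G (l + 1) (Function.update (Function.update ρ 19 0) 20 (2 ^ l))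
    (n + 1 + 1) 0 (by rw [pow_succ]; simp) (by simp) (by simp [h6]) (by simpa using hpow)
  simp only [zero_mul, zero_add] at this
  rw [sampleBits]
  apply le_cons; refine le_const (by omega) ?_
  apply le_cons; refine le_copy ?_
  rw [Function.update_of_ne (by norm_num), h8]
  refine this fun u hu ρ' n' hn' hfr h19 => hF u hu ρ' n' (by omega) (fun r hr => ?_) h19
  have h : r ≠ 18 ∧ r ≠ 19 ∧ r ≠ 20 := by omega
  simp [hfr r hr, h]

/-- Put the power of register `15` to the exponent in register `2`, modulo register `1`, into register
`21`, by repeated squaring. -/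
def powMod : Cmd :=
  .block [.const 21 1, .copy 22 15, .copy 23 2,
    .loop 23 (.block [.op .mod 18 23 6,
      .ite 18 .skip (.block [.op .mul 21 21 22, .op .mod 21 21 1]),
      .op .mul 22 22 22, .op .mod 22 22 1, .op .div 23 23 6])]

lemma powModLoop_spec {M N v : ℕ} {F : (ℕ → ℕ) → ℕ → ℝ≥0∞} {X : ℝ≥0∞} (hN : 1 < N)
    (hNM : N * N ≤ 2 ^ M) (k : ℕ) :
    ∀ (ρ : ℕ → ℕ) (n acc b x : ℕ), x < 2 ^ k → x < 2 ^ M → ρ 21 = acc → ρ 22 = b → ρ 23 = x →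
    ρ 6 = 2 → ρ 1 = N → acc < N → b < N → acc * b ^ x ≡ v [MOD N] →
    (∀ ρ' n', n' ≤ n + 12 * k + 1 → (∀ r, r < 18 ∨ (19 ≤ r ∧ r < 21) ∨ 24 ≤ r → ρ' r = ρ r) →
      ρ' 21 = v % N → X ≤ F ρ' n') →
    X ≤ wp M (.loop 23 (.block [.op .mod 18 23 6,
      .ite 18 .skip (.block [.op .mul 21 21 22, .op .mod 21 21 1]),
      .op .mul 22 22 22, .op .mod 22 22 1, .op .div 23 23 6])) F ρ n := by
  induction k with
  | zero =>
    intro ρ n acc b x hx _ h21 h22 h23 h6 h1 ha hb hv hF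
    obtain rfl : x = 0 := by simpa using hx
    refine le_loop_zero h23 (hF _ _ (by omega) (fun _ _ => rfl) ?_)
    rw [h21, ← Nat.mod_eq_of_lt ha]
    simpa [Nat.ModEq] using hv
  | succ k ih =>
    intro ρ n acc b x hx hxM h21 h22 h23 h6 h1 ha hb hv hF
    by_cases hx0 : x = 0
    · subst hx0
      refine le_loop_zero h23 (hF _ _ (by omega) (fun _ _ => rfl) ?_)
      rw [h21, ← Nat.mod_eq_of_lt ha]
      simpa [Nat.ModEq] using hv
    have hNN : N ≤ N * N := Nat.le_mul_of_pos_left _ (by omega)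
    have hbN : b * b < 2 ^ M := (Nat.mul_lt_mul'' hb hb).trans_le hNM
    have haN : acc * b < 2 ^ M := (Nat.mul_lt_mul'' ha hb).trans_le hNM
    have hmod : ∀ z, z % N < 2 ^ M := fun z =>
      (Nat.mod_lt _ (by omega)).trans_le (hNN.trans hNM)
    have hxk : x / 2 < 2 ^ k := by rw [pow_succ] at hx; omega
    have hsq : ∀ z, b ^ (2 * z) ≡ (b * b % N) ^ z [MOD N] := fun z => by
      rw [pow_mul, sq]
      exact ((Nat.mod_modEq _ _).pow z).symm
    refine le_loop_ne (by omega) ?_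
    apply le_cons; refine le_op (x % 2) (by simp [Op.fn, h23, h6]) (by omega) ?_
    apply le_cons
    rcases Nat.mod_two_eq_zero_or_one x with hpar | hpar
    · refine le_ite_zero (by simp [hpar]) ?_
      change X ≤ wp M (.block []) _ _ _
      apply le_nil
      apply le_cons; refine le_op (b * b) (by simp [Op.fn, h22]) hbN ?_
      apply le_cons; refine le_op (b * b % N) (by simp [Op.fn, h1]) (hmod _) ?_
      apply le_cons; refine le_op (x / 2) (by simp [Op.fn, h23, h6]) (by omega) ?_
      apply le_nil
      refine ih _ _ acc (b * b % N) (x / 2) hxk (by omega) (by simp [h21]) (by simp) (by simp)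
        (by simp [h6]) (by simp [h1]) ha (Nat.mod_lt _ (by omega)) ?_
        fun ρ' n' hn' hfr h21' => hF ρ' n' (by omega) ?_ h21'
      · refine Nat.ModEq.trans (Nat.ModEq.mul_left _ (hsq _).symm) ?_
        rwa [show 2 * (x / 2) = x by omega]
      · intro r hr
        have h : r ≠ 18 ∧ r ≠ 21 ∧ r ≠ 22 ∧ r ≠ 23 := by omega
        simp [hfr r hr, h]
    · refine le_ite_ne (by simp [hpar]) ?_
      apply le_cons; refine le_op (acc * b) (by simp [Op.fn, h21, h22]) haN ?_
      apply le_cons; refine le_op (acc * b % N) (by simp [Op.fn, h1]) (hmod _) ?_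
      apply le_nil
      apply le_cons; refine le_op (b * b) (by simp [Op.fn, h22]) hbN ?_
      apply le_cons; refine le_op (b * b % N) (by simp [Op.fn, h1]) (hmod _) ?_
      apply le_cons; refine le_op (x / 2) (by simp [Op.fn, h23, h6]) (by omega) ?_
      apply le_nil
      refine ih _ _ (acc * b % N) (b * b % N) (x / 2) hxk (by omega) (by simp) (by simp) (by simp)
        (by simp [h6]) (by simp [h1]) (Nat.mod_lt _ (by omega)) (Nat.mod_lt _ (by omega)) ?_
        fun ρ' n' hn' hfr h21' => hF ρ' n' (by omega) ?_ h21'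
      · refine Nat.ModEq.trans (Nat.ModEq.mul (Nat.mod_modEq _ _) (hsq _).symm) ?_
        rwa [mul_assoc, ← pow_succ', show 2 * (x / 2) + 1 = x by omega]
      · intro r hr
        have h : r ≠ 18 ∧ r ≠ 21 ∧ r ≠ 22 ∧ r ≠ 23 := by omega
        simp [hfr r hr, h]

lemma powMod_spec {M N s e k : ℕ} {F : (ℕ → ℕ) → ℕ → ℝ≥0∞} {X : ℝ≥0∞} (hN : 1 < N)
    (hNM : N * N ≤ 2 ^ M) {ρ : ℕ → ℕ} {n : ℕ} (h15 : ρ 15 = s) (h2 : ρ 2 = e) (h6 : ρ 6 = 2)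
    (h1 : ρ 1 = N) (hs : s < N) (he : e < 2 ^ k) (hkM : k ≤ M)
    (hF : ∀ ρ' n', n' ≤ n + 12 * k + 4 → (∀ r, r < 18 ∨ (19 ≤ r ∧ r < 21) ∨ 24 ≤ r → ρ' r = ρ r) →
      ρ' 21 = s ^ e % N → X ≤ F ρ' n') : X ≤ wp M powMod F ρ n := by
  have hM : 1 < 2 ^ M := lt_of_lt_of_le (by nlinarith) hNM
  have heM : e < 2 ^ M := he.trans_le (Nat.pow_le_pow_right (by norm_num) hkM)
  apply le_cons; refine le_const hM ?_
  apply le_cons; refine le_copy ?_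
  apply le_cons; refine le_copy ?_
  apply le_cons
  refine powModLoop_spec (v := s ^ e) hN hNM k _ _ 1 s e he heM (by simp) (by simp [h15])
    (by simp [h2]) (by simp [h6]) (by simp [h1]) hN hs (by simp [Nat.ModEq]) ?_
  intro ρ' n' hn' hfr h21
  apply le_nil
  refine hF ρ' n' (by omega) (fun r hr => ?_) h21
  have h : r ≠ 21 ∧ r ≠ 22 ∧ r ≠ 23 := by omega
  simp [hfr r hr, h]

/-- One attempt to choose a hash value: choose a random number `u` of `l + 1` bits, put its residue `s`
modulo `N` into register `15`, and put `N * (u / N) + c` into register `14`, where `c` is the challenge `y`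
if the query has the guessed position, and `s ^ e` modulo `N` otherwise. Register `13` is cleared if this is
a number of at most `l` bits. -/
def attempt : Cmd :=
  .block (sampleBits ++ [.op .mod 15 19 1, .op .div 19 19 1, .op .sub 18 10 9, .op .sub 17 9 10,
    .op .add 18 18 17, .ite 18 (.copy 21 3) powMod, .op .mul 14 19 1, .op .add 14 14 21,
    .op .div 13 14 8])

lemma attempt_spec {M N e y l k i j : ℕ} {F : (ℕ → ℕ) → ℕ → ℝ≥0∞} {G : ℕ → ℝ≥0∞} (hN : 1 < N)
    (hNl : N ≤ 2 ^ l) (hM : 2 * l + 2 ≤ M) (he : e < 2 ^ k) (hkM : k ≤ M) (hyN : y < N)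
    (hi : i < 2 ^ M) (hj : j < 2 ^ M)
    {ρ : ℕ → ℕ} {n : ℕ} (h1 : ρ 1 = N) (h2 : ρ 2 = e) (h3 : ρ 3 = y) (h6 : ρ 6 = 2)
    (h8 : ρ 8 = 2 ^ l) (h9 : ρ 9 = j) (h10 : ρ 10 = i)
    (hF : ∀ u < 2 ^ (l + 1), ∀ ρ' n', n' ≤ n + (6 * l + 12 * k + 23) →
      (∀ r, r < 13 ∨ 24 ≤ r → ρ' r = ρ r) →
      ρ' 14 = N * (u / N) + (if i = j then y else (u % N) ^ e % N) → ρ' 15 = u % N →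
      ρ' 13 = (N * (u / N) + (if i = j then y else (u % N) ^ e % N)) / 2 ^ l →
      G u ≤ F ρ' n') :
    (∑ u ∈ Finset.range (2 ^ (l + 1)), G u) / 2 ^ (l + 1) ≤ wp M attempt F ρ n := by
  have hN0 : 0 < N := by omega
  have hNM : N * N ≤ 2 ^ M := by
    calc N * N ≤ 2 ^ l * 2 ^ l := Nat.mul_le_mul hNl hNl
      _ = 2 ^ (l + l) := (pow_add ..).symm
      _ ≤ 2 ^ M := Nat.pow_le_pow_right (by norm_num) (by omega)
  have hlM : 2 ^ l * 4 ≤ 2 ^ M := by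
    calc 2 ^ l * 4 = 2 ^ (l + 2) := by rw [pow_add]; norm_num
      _ ≤ 2 ^ M := Nat.pow_le_pow_right (by norm_num) (by omega)
  refine sampleBits_spec ρ n h8 h6 (by omega) fun u hu ρ₁ n₁ hn₁ hfr₁ h19 => ?_
  rw [pow_succ] at hu
  have hum : u % N < N := Nat.mod_lt _ hN0
  have hud : N * (u / N) ≤ u := Nat.mul_div_le _ _
  have hudiv : u / N ≤ u := Nat.div_le_self _ _
  apply le_cons; refine le_op (u % N) (by simp [Op.fn, h19, hfr₁, h1]) (by omega) ?_
  apply le_cons; refine le_op (u / N) (by simp [Op.fn, h19, hfr₁, h1]) (by omega) ?_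
  apply le_cons; refine le_op (i - j) (by simp [Op.fn, hfr₁, h9, h10]) (by omega) ?_
  apply le_cons; refine le_op (j - i) (by simp [Op.fn, hfr₁, h9, h10]) (by omega) ?_
  apply le_cons; refine le_op (i - j + (j - i)) (by simp [Op.fn]) (by omega) ?_
  apply le_cons
  by_cases hij : i = j
  · simp only [hij, if_true] at hF
    subst hij
    refine le_ite_zero (by simp) ?_
    refine le_copy ?_
    apply le_cons
    refine le_op (N * (u / N)) (by simp [Op.fn, hfr₁, h1]; ring) (by omega) ?_
    apply le_cons
    refine le_op (N * (u / N) + y) (by simp [Op.fn, hfr₁, h3]) (by omega) ?_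
    apply le_cons
    refine le_op ((N * (u / N) + y) / 2 ^ l) (by simp [Op.fn, hfr₁, h8])
      ((Nat.div_le_self _ _).trans_lt (by omega)) ?_
    apply le_nil
    refine hF u (by rwa [pow_succ]) _ _ (by omega) (fun r hr => ?_) (by simp) (by simp) (by simp)
    have h : r ≠ 13 ∧ r ≠ 14 ∧ r ≠ 15 ∧ r ≠ 17 ∧ r ≠ 18 ∧ r ≠ 19 ∧ r ≠ 21 := by omega
    simp only [ne_eq, h, not_false_eq_true, Function.update_of_ne]
    exact hfr₁ r (by omega)
  · simp only [hij, if_false] at hF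
    refine le_ite_ne (by simp; omega) ?_
    refine powMod_spec hN hNM (s := u % N) (e := e) (by simp) (by simp [hfr₁, h2])
      (by simp [hfr₁, h6]) (by simp [hfr₁, h1]) hum he hkM fun ρ₂ n₂ hn₂ hfr₂ h21 => ?_
    have hc : (u % N) ^ e % N < N := Nat.mod_lt _ hN0
    apply le_cons
    refine le_op (N * (u / N)) (by simp [Op.fn, hfr₂, hfr₁, h1]; ring) (by omega) ?_
    apply le_cons
    refine le_op (N * (u / N) + (u % N) ^ e % N) (by simp [Op.fn, h21]) (by omega) ?_
    apply le_cons
    refine le_op ((N * (u / N) + (u % N) ^ e % N) / 2 ^ l) (by simp [Op.fn, hfr₂, hfr₁, h8])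
      ((Nat.div_le_self _ _).trans_lt (by omega)) ?_
    apply le_nil
    refine hF u (by rwa [pow_succ]) _ _ (by omega) (fun r hr => ?_) (by simp) (by simp [hfr₂])
      (by simp)
    have h : r ≠ 13 ∧ r ≠ 14 ∧ r ≠ 15 ∧ r ≠ 17 ∧ r ≠ 18 ∧ r ≠ 19 ∧ r ≠ 21 := by omega
    simp only [ne_eq, h, not_false_eq_true, Function.update_of_ne]
    rw [hfr₂ r (by omega)]
    simp only [ne_eq, h, not_false_eq_true, Function.update_of_ne]
    exact hfr₁ r (by omega)

/-- The probability that one of `K` tosses of a fair coin shows heads. -/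
noncomputable def accept : ℕ → ℝ≥0∞
  | 0 => 0
  | K + 1 => (1 + accept K) / 2

/-- The attempts that succeed are in bijection with the hash values, and so exactly half of the attempts
succeed. -/
lemma le_sum_attempts {N e d l : ℕ} (hN : 0 < N) (hNl : N ≤ 2 ^ l)
    (hroot : ∀ s < N, (s ^ e % N) ^ d % N = s) (hroot' : ∀ h, (h ^ d % N) ^ e % N = h % N)
    (G : ℕ → ℝ≥0∞) (v : ℝ≥0∞) :
    ∑ h ∈ Finset.range (2 ^ l), G h + 2 ^ l * v ≤ ∑ u ∈ Finset.range (2 ^ (l + 1)),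
      if N * (u / N) + (u % N) ^ e % N < 2 ^ l then G (N * (u / N) + (u % N) ^ e % N) else v := by
  classical
  set ι : ℕ → ℕ := fun h => h ^ d % N + N * (h / N) with hι
  have hlt : ∀ h, h ^ d % N < N := fun h => Nat.mod_lt _ hN
  have idiv : ∀ h, ι h / N = h / N := fun h => by
    rw [hι]; simp only; rw [Nat.add_mul_div_left _ _ hN, Nat.div_eq_of_lt (hlt h), zero_add]
  have imod : ∀ h, ι h % N = h ^ d % N := fun h => by
    rw [hι]; simp only; rw [Nat.add_mul_mod_self_left, Nat.mod_mod]
  have back : ∀ h, N * (ι h / N) + (ι h % N) ^ e % N = h := fun h => by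
    rw [idiv, imod, hroot', Nat.div_add_mod]
  have forth : ∀ u, ι (N * (u / N) + (u % N) ^ e % N) = u := fun u => by
    have h1 : (N * (u / N) + (u % N) ^ e % N) / N = u / N := by
      rw [Nat.mul_add_div hN, Nat.div_eq_of_lt (Nat.mod_lt _ hN), add_zero]
    have h2 : (N * (u / N) + (u % N) ^ e % N) ^ d % N = u % N := by
      rw [Nat.pow_mod, Nat.mul_add_mod, Nat.mod_mod, hroot _ (Nat.mod_lt _ hN)]
    rw [hι]; simp only
    rw [h1, h2, Nat.mod_add_div]
  have inj : Function.Injective ι := fun a b hab => by rw [← back a, ← back b, hab]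
  have hsub : (Finset.range (2 ^ l)).image ι ⊆ Finset.range (2 ^ (l + 1)) := by
    intro u hu
    obtain ⟨h, hh, rfl⟩ := Finset.mem_image.1 hu
    have h1 := Finset.mem_range.1 hh
    have h2 := hlt h
    have h3 := Nat.mul_div_le h N
    rw [Finset.mem_range, pow_succ]
    simp only [hι]
    omega
  rw [← Finset.sum_sdiff hsub, add_comm]
  refine add_le_add ?_ ?_
  · rw [Finset.sum_congr rfl (g := fun _ => v), Finset.sum_const, Finset.card_sdiff_of_subset hsub,
      Finset.card_image_of_injective _ inj, Finset.card_range, Finset.card_range, pow_succ, mul_two,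
      Nat.add_sub_cancel, nsmul_eq_mul]
    · push_cast; rfl
    · intro u hu
      rw [if_neg]
      intro hlt
      refine (Finset.mem_sdiff.1 hu).2 (Finset.mem_image.2 ⟨_, Finset.mem_range.2 hlt, forth u⟩)
  · rw [Finset.sum_image inj.injOn]
    refine Finset.sum_le_sum fun h hh => ?_
    rw [back, if_pos (Finset.mem_range.1 hh)]

/-- With the challenge `y` in place of the random power, each hash value that is congruent to `y` results
from `N` attempts. -/
lemma le_sum_attempts_challenge {N y l : ℕ} (hN : 0 < N) (hNl : N ≤ 2 ^ l) (G : ℕ → ℝ≥0∞) :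
    N * ∑ h ∈ Finset.range (2 ^ l), (if h % N = y then G h else 0) ≤
      ∑ u ∈ Finset.range (2 ^ (l + 1)),
        if N * (u / N) + y < 2 ^ l then G (N * (u / N) + y) else 0 := by
  classical
  set ι : ℕ × ℕ → ℕ := fun a => a.2 + N * (a.1 / N) with hι
  set A := ((Finset.range (2 ^ l)).filter fun h => h % N = y) ×ˢ Finset.range N with hA
  have idiv : ∀ a ∈ A, ι a / N = a.1 / N := fun a ha => by
    have := Finset.mem_range.1 (Finset.mem_product.1 ha).2
    rw [hι]; simp only; rw [Nat.add_mul_div_left _ _ hN, Nat.div_eq_of_lt this, zero_add]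
  have imod : ∀ a ∈ A, ι a % N = a.2 := fun a ha => by
    have := Finset.mem_range.1 (Finset.mem_product.1 ha).2
    rw [hι]; simp only; rw [Nat.add_mul_mod_self_left, Nat.mod_eq_of_lt this]
  have hy : ∀ a ∈ A, N * (a.1 / N) + y = a.1 := fun a ha => by
    have := (Finset.mem_filter.1 (Finset.mem_product.1 ha).1).2
    rw [← this, Nat.div_add_mod]
  have inj : Set.InjOn ι A := by
    intro a ha b hb hab
    have h1 : a.1 = b.1 := by rw [← hy a ha, ← hy b hb, ← idiv a ha, ← idiv b hb, hab]
    have h2 : a.2 = b.2 := by rw [← imod a ha, ← imod b hb, hab]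
    exact Prod.ext h1 h2
  have hsub : A.image ι ⊆ Finset.range (2 ^ (l + 1)) := by
    intro u hu
    obtain ⟨a, ha, rfl⟩ := Finset.mem_image.1 hu
    have h1 := Finset.mem_range.1 (Finset.mem_filter.1 (Finset.mem_product.1 ha).1).1
    have h2 := Finset.mem_range.1 (Finset.mem_product.1 ha).2
    have h3 := Nat.mul_div_le a.1 N
    rw [Finset.mem_range, pow_succ]
    simp only [hι]
    omega
  refine le_trans (le_of_eq ?_) (Finset.sum_le_sum_of_subset hsub)
  have hG : ∀ a ∈ A, (if N * (ι a / N) + y < 2 ^ l then G (N * (ι a / N) + y) else 0) = G a.1 := by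
    intro a ha
    have h1 := Finset.mem_range.1 (Finset.mem_filter.1 (Finset.mem_product.1 ha).1).1
    rw [idiv a ha, hy a ha, if_pos h1]
  rw [Finset.sum_image inj, Finset.sum_congr rfl hG, hA, Finset.sum_product]
  simp only [Finset.sum_const, Finset.card_range, nsmul_eq_mul]
  rw [← Finset.mul_sum, Finset.sum_filter]

/-- Up to `K` attempts yield a uniformly random hash value and its signature, with probability `accept K`. -/
lemma attemptLoop_spec {M N e d y l k i j : ℕ} {F : (ℕ → ℕ) → ℕ → ℝ≥0∞} {G : ℕ → ℝ≥0∞} (hN : 1 < N)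
    (hNl : N ≤ 2 ^ l) (hM : 2 * l + 2 ≤ M) (he : e < 2 ^ k) (hkM : k ≤ M) (hyN : y < N)
    (hi : i < 2 ^ M) (hj : j < 2 ^ M) (hij : i ≠ j)
    (hroot : ∀ s < N, (s ^ e % N) ^ d % N = s) (hroot' : ∀ h, (h ^ d % N) ^ e % N = h % N) (K : ℕ) :
    ∀ (ρ : ℕ → ℕ) (n : ℕ), ρ 13 ≠ 0 → ρ 1 = N → ρ 2 = e → ρ 3 = y → ρ 6 = 2 →
    ρ 8 = 2 ^ l → ρ 9 = j → ρ 10 = i →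
    (∀ h < 2 ^ l, ∀ ρ' n', n' ≤ n + K * (6 * l + 12 * k + 25) + 1 →
      (∀ r, r < 13 ∨ 24 ≤ r → ρ' r = ρ r) → ρ' 14 = h → ρ' 15 = h ^ d % N → G h ≤ F ρ' n') →
    ∑ h ∈ Finset.range (2 ^ l), accept K * (2 ^ l)⁻¹ * G h ≤ wp M (.loop 13 attempt) F ρ n := by
  induction K with
  | zero => intro ρ n; simp [accept]
  | succ K ih =>
    intro ρ n h13 h1 h2 h3 h6 h8 h9 h10 hF
    have hN0 : 0 < N := by omega
    refine le_loop_ne h13 (le_trans ?_ (attempt_spec (G := fun u =>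
      if N * (u / N) + (u % N) ^ e % N < 2 ^ l then G (N * (u / N) + (u % N) ^ e % N)
      else ∑ h ∈ Finset.range (2 ^ l), accept K * (2 ^ l)⁻¹ * G h) hN hNl hM he hkM hyN hi hj
      h1 h2 h3 h6 h8 h9 h10 ?_))
    · refine le_trans (le_of_eq ?_)
        (ENNReal.div_le_div_right (le_sum_attempts hN0 hNl hroot hroot' _ _) _)
      have cancel : (2 ^ l : ℝ≥0∞) * (2 ^ l)⁻¹ = 1 := ENNReal.mul_inv_cancel (by simp) (by simp)
      rw [← Finset.mul_sum, ← Finset.mul_sum, mul_assoc (accept K), ← mul_assoc (2 ^ l : ℝ≥0∞),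
        mul_comm (2 ^ l : ℝ≥0∞) (accept K), mul_assoc (accept K), ← mul_assoc (2 ^ l : ℝ≥0∞), cancel,
        one_mul, accept, pow_succ, ENNReal.div_eq_inv_mul, ENNReal.div_eq_inv_mul,
        ENNReal.mul_inv (.inl (by simp)) (.inl (by simp))]
      ring
    · intro u hu ρ' n' hn' hfr h14 h15 h13'
      simp only [hij, if_false] at h14 h13'
      rw [add_mul] at hF
      split
      · next hlt =>
        refine le_loop_zero (by rw [h13', Nat.div_eq_of_lt hlt]) ?_
        refine hF _ hlt ρ' _ (by omega) hfr h14 ?_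
        rw [h15, Nat.pow_mod, Nat.mul_add_mod, Nat.mod_mod, hroot _ (Nat.mod_lt _ hN0)]
      · next hlt =>
        refine ih ρ' _ ?_ (by rw [hfr _ (by omega), h1]) (by rw [hfr _ (by omega), h2])
          (by rw [hfr _ (by omega), h3]) (by rw [hfr _ (by omega), h6])
          (by rw [hfr _ (by omega), h8]) (by rw [hfr _ (by omega), h9])
          (by rw [hfr _ (by omega), h10]) fun h hh ρ'' n'' hn'' hfr' h14' h15' =>
            hF h hh ρ'' n'' (by omega) (fun r hr => by rw [hfr' r hr, hfr r hr]) h14' h15'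
        rw [h13', Nat.div_ne_zero_iff]
        exact ⟨by positivity, not_lt.1 hlt⟩

/-- At the guessed position a single attempt is counted; `N / 2` is what the weights of the hash values that are
congruent to `y` gain over uniform weights. -/
lemma attemptLoop_spec_challenge {M N e y l k j : ℕ} {F : (ℕ → ℕ) → ℕ → ℝ≥0∞} {G : ℕ → ℝ≥0∞}
    (hN : 1 < N) (hNl : N ≤ 2 ^ l) (hM : 2 * l + 2 ≤ M) (he : e < 2 ^ k) (hkM : k ≤ M) (hyN : y < N)
    (hj : j < 2 ^ M) (ρ : ℕ → ℕ) (n : ℕ) (h13 : ρ 13 ≠ 0) (h1 : ρ 1 = N) (h2 : ρ 2 = e) (h3 : ρ 3 = y)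
    (h6 : ρ 6 = 2) (h8 : ρ 8 = 2 ^ l) (h9 : ρ 9 = j) (h10 : ρ 10 = j)
    (hF : ∀ h < 2 ^ l, h % N = y → ∀ ρ' n', n' ≤ n + (6 * l + 12 * k + 25) + 1 →
      (∀ r, r < 13 ∨ 24 ≤ r → ρ' r = ρ r) → ρ' 14 = h → ρ' 15 < N → G h ≤ F ρ' n') :
    ∑ h ∈ Finset.range (2 ^ l), (N / 2 * ((2 ^ l)⁻¹ * if h % N = y then 1 else 0)) * G h ≤
      wp M (.loop 13 attempt) F ρ n := by
  have hN0 : 0 < N := by omega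
  refine le_loop_ne h13 (le_trans ?_ (attempt_spec (G := fun u =>
    if N * (u / N) + y < 2 ^ l then G (N * (u / N) + y) else 0) hN hNl hM he hkM hyN hj hj
    h1 h2 h3 h6 h8 h9 h10 ?_))
  · refine le_trans (le_of_eq ?_)
      (ENNReal.div_le_div_right (le_sum_attempts_challenge hN0 hNl _) _)
    rw [Finset.mul_sum, ENNReal.div_eq_inv_mul (b := 2 ^ (l + 1)), Finset.mul_sum]
    refine Finset.sum_congr rfl fun h _ => ?_
    split
    · rw [ENNReal.div_eq_inv_mul, pow_succ, ENNReal.mul_inv (.inl (by simp)) (.inl (by simp))]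
      ring
    · simp
  · intro u hu ρ' n' hn' hfr h14 h15 h13'
    simp only [if_true] at h14 h13'
    split
    · next hlt =>
      refine le_loop_zero (by rw [h13', Nat.div_eq_of_lt hlt]) ?_
      refine hF _ hlt ?_ ρ' _ (by omega) hfr h14 (by rw [h15]; exact Nat.mod_lt _ hN0)
      rw [Nat.mul_add_mod, Nat.mod_eq_of_lt hyN]
    · exact zero_le

/-! ### The simulated oracles -/

/-- The entries of a table are as the simulation maintains them: the entry at position `j` has a hash value
congruent to the challenge `y`, and all others have correct signatures. -/
def ValidTable (D N d l j y : ℕ) : List (ℕ × ℕ × ℕ) → Prop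
  | [] => True
  | (m, h, s) :: τ => (m + 1 < D ∧ h < 2 ^ l ∧ s < N ∧
      (if τ.length + 1 = j then h % N = y else s = h ^ d % N)) ∧ ValidTable D N d l j y τ

/-- The simulation keeps the table `τ` and its parameters in the registers up to `11`: the input
`(n, N, e, y)` in the first four, the constants `0`, `1` and `2`, the base `D` of the table, the number of
hash values, the guess `j` for the position of the forged message, the size and the code of the table. The
registers from `12` to `23` are for intermediate results, and those from `24` on belong to the adversary. -/
structure Keeps (D N e d l j y : ℕ) (τ : List (ℕ × ℕ × ℕ)) (ρ : ℕ → ℕ) : Prop where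
  r1 : ρ 1 = N
  r2 : ρ 2 = e
  r3 : ρ 3 = y
  r4 : ρ 4 = 0
  r5 : ρ 5 = 1
  r6 : ρ 6 = 2
  r7 : ρ 7 = D
  r8 : ρ 8 = 2 ^ l
  r9 : ρ 9 = j
  r10 : ρ 10 = τ.length
  r11 : ρ 11 = encodeTable D τ
  valid : ValidTable D N d l j y τ

lemma ValidTable.bounds {D N d l j y : ℕ} (hl : 2 ^ l ≤ D) (hN : N ≤ 2 ^ l) :
    ∀ {τ : List (ℕ × ℕ × ℕ)}, ValidTable D N d l j y τ →
      ∀ a ∈ τ, a.1 + 1 < D ∧ a.2.1 < D ∧ a.2.2 < D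
  | (m, h, s) :: τ, hτ, a, ha => by
    obtain ⟨⟨h1, h2, h3, -⟩, h4⟩ := hτ
    rcases List.mem_cons.1 ha with rfl | ha
    · exact ⟨h1, h2.trans_le hl, by simp only; omega⟩
    · exact h4.bounds hl hN a ha

lemma encodeTable_lt {D : ℕ} (hD : 0 < D) : ∀ {τ : List (ℕ × ℕ × ℕ)},
    (∀ a ∈ τ, a.1 + 1 < D ∧ a.2.1 < D ∧ a.2.2 < D) → encodeTable D τ < D ^ (3 * τ.length)
  | [], _ => by simp [encodeTable]
  | (m, h, s) :: τ, hτ => by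
    obtain ⟨h1, h2, h3⟩ := hτ _ (List.mem_cons_self ..)
    have ih := encodeTable_lt hD fun a ha => hτ a (List.mem_cons_of_mem _ ha)
    simp only [encodeTable, List.length_cons, mul_add, mul_one] at *
    have step : ∀ {E n v : ℕ}, E < D ^ n → v < D → E * D + v < D ^ (n + 1) := by
      intro E n v hE hv
      have : (E + 1) * D ≤ D ^ n * D := Nat.mul_le_mul_right _ hE
      rw [pow_succ]
      linarith
    exact step (step (step ih h1) h2) h3

lemma lookup_hashTable (τ : List (ℕ × ℕ × ℕ)) (x : ℕ) :
    (findEntry τ x = none → lookup (hashTable τ) x = none) ∧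
    (∀ D N d l j y h s, ValidTable D N d l j y τ → findEntry τ x = some (h, s) →
      ∃ i, lookup (hashTable τ) x = some (i, h) ∧ h < 2 ^ l ∧ s < N ∧
        if i = j then h % N = y else s = h ^ d % N) := by
  induction τ with
  | nil => simp [findEntry, lookup, hashTable]
  | cons a τ ih =>
    obtain ⟨m, v, w⟩ := a
    have hcons : hashTable ((m, v, w) :: τ) = (m, v) :: hashTable τ := rfl
    have hlen : (hashTable τ).length = τ.length := by simp [hashTable]
    rw [hcons]
    simp only [findEntry, lookup, ValidTable, hlen]
    split
    · refine ⟨by simp, ?_⟩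
      intro D N d l j y h s hv e
      simp only [Option.some.injEq, Prod.mk.injEq] at e
      obtain ⟨rfl, rfl⟩ := e
      exact ⟨_, rfl, hv.1.2⟩
    · exact ⟨ih.1, fun D N d l j y h s hv e => ih.2 D N d l j y h s hv.2 e⟩

/-- Choose a new hash value and enter it into the table. -/
def newEntry : Cmd :=
  .block [.op .add 10 10 5, .const 13 1, .loop 13 attempt, .op .mul 11 11 7, .op .add 11 11 12,
    .op .mul 11 11 7, .op .add 11 11 14, .op .mul 11 11 7, .op .add 11 11 15]

/-- Answer a query for the message in register `12`: put the hash value into register `14` and the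
signature into register `15`. -/
def answerQuery : Cmd :=
  .block [.op .add 12 12 5, .copy 16 11, .const 13 1, lookupLoop, .ite 13 .skip newEntry]

/-- The weights of the hash values in the simulation: the `j`-th hash value is congruent to `y`. -/
noncomputable def challengeWeight (N l j y i h : ℕ) : ℝ≥0∞ :=
  if i = j then N / 2 * ((2 ^ l)⁻¹ * if h % N = y then 1 else 0) else (2 ^ l)⁻¹

/-- What the simulation requires from the numbers involved. The base of the table is `2 ^ S`, and `q` is the
largest number of queries, so that the code of the table has at most `3 * S * q` bits; the reduction handles
only numbers of at most `M` bits. -/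
structure Params (M S N e d y l k j q : ℕ) : Prop where
  one_lt : 1 < N
  le_pow : N ≤ 2 ^ l
  l_lt : l < S
  bits : 3 * S * (q + 1) ≤ M
  e_lt : e < 2 ^ k
  k_le : k ≤ S
  y_lt : y < N
  j_le : j ≤ q
  root : ∀ s < N, (s ^ e % N) ^ d % N = s
  root' : ∀ h, (h ^ d % N) ^ e % N = h % N

lemma Params.q_lt {M S N e d y l k j q : ℕ} (hP : Params M S N e d y l k j q) : q < 2 ^ M := by
  have h1 := hP.bits
  have h2 := hP.l_lt
  have h3 : q + 1 ≤ 3 * S * (q + 1) := Nat.le_mul_of_pos_left _ (by omega)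
  exact (show q < M by omega).trans Nat.lt_two_pow_self

lemma accept_le_one (K : ℕ) : accept K ≤ 1 := by
  induction K with
  | zero => simp [accept]
  | succ K ih =>
    rw [accept]
    calc (1 + accept K) / 2 ≤ (1 + 1) / 2 := by gcongr
      _ = 1 := by rw [one_add_one_eq_two]; exact ENNReal.div_self (by simp) (by simp)

/-- The number of steps that suffice for one query. -/
def querySteps (K l k q : ℕ) : ℕ := K * (6 * l + 12 * k + 25) + 20 * q + 60

lemma answerQuery_spec {M S N e d y l k j q K x : ℕ} (hP : Params M S N e d y l k j q)
    (hx : x + 1 < 2 ^ S) (hK : 0 < K) {τ : List (ℕ × ℕ × ℕ)} (hq : τ.length < q)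
    {κ : ℕ → ℕ → List (ℕ × ℕ) → ℝ≥0∞} {F : (ℕ → ℕ) → ℕ → ℝ≥0∞} {ρ : ℕ → ℕ} {n : ℕ}
    (hρ : Keeps (2 ^ S) N e d l j y τ ρ) (h12 : ρ 12 = x)
    (hF : ∀ i h s τ' ρ' n', n' ≤ n + querySteps K l k q → Keeps (2 ^ S) N e d l j y τ' ρ' →
      τ'.length ≤ τ.length + 1 → lookup (hashTable τ') x = some (i, h) →
      (i ≠ j → s = h ^ d % N) → (∀ r, 24 ≤ r → ρ' r = ρ r) → ρ' 14 = h → ρ' 15 = s →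
      κ i h (hashTable τ') ≤ F ρ' n') :
    query (fun i h => accept K * challengeWeight N l j y i h) l (hashTable τ) x κ ≤
      wp M answerQuery F ρ n := by
  have hlS : 2 ^ l ≤ 2 ^ S := Nat.pow_le_pow_right (by norm_num) hP.l_lt.le
  have hD : 0 < 2 ^ S := by positivity
  have hN0 : 0 < N := by have := hP.one_lt; omega
  have hS3 : 3 * S ≤ M := (Nat.le_mul_of_pos_right _ (by omega)).trans hP.bits
  have hbd := hρ.valid.bounds hlS hP.le_pow
  have hlen : (hashTable τ).length = τ.length := by simp [hashTable]
  have hpow : ∀ t, t ≤ 3 * (τ.length + 1) → (2 ^ S) ^ t ≤ 2 ^ M := fun t ht => by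
    rw [← pow_mul]
    refine Nat.pow_le_pow_right (by norm_num) (le_trans ?_ hP.bits)
    rw [mul_comm 3 S, mul_assoc]
    exact Nat.mul_le_mul_left _ (by omega)
  have hE := encodeTable_lt hD hbd
  have hDM : 2 * 2 ^ S ≤ 2 ^ M := by
    rw [← pow_succ']
    have := hP.l_lt
    exact Nat.pow_le_pow_right (by norm_num) (by omega)
  apply le_cons; refine le_op (x + 1) (by simp [Op.fn, h12, hρ.r5]) (by omega) ?_
  apply le_cons; refine le_copy ?_
  apply le_cons; refine le_const (by omega) ?_
  apply le_cons
  refine lookupLoop_spec (x := x) τ _ _ hbd (hE.trans_le (hpow _ (by omega))) hDM hx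
    (by simp [hρ.r11]) (by simp) (by simp [hρ.r7]) fun ρ₁ n₁ hn₁ hfr₁ hnone hsome => ?_
  have keep₁ : Keeps (2 ^ S) N e d l j y τ ρ₁ := by
    obtain ⟨h1, h2, h3, h4, h5, h6, h7, h8, h9, h10, h11, hv⟩ := hρ
    constructor <;> first | assumption | (rw [hfr₁ _ (by omega)]; simpa)
  have hfr : ∀ r, 24 ≤ r → ρ₁ r = ρ r := fun r hr => by
    rw [hfr₁ r (by omega)]
    have h : r ≠ 12 ∧ r ≠ 13 ∧ r ≠ 16 := by omega
    simp [h]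
  apply le_cons
  cases hfind : findEntry τ x with
  | some a =>
    obtain ⟨h, s⟩ := a
    obtain ⟨i, hi, -, -, hs⟩ := (lookup_hashTable τ x).2 _ _ _ _ _ _ h s hρ.valid hfind
    obtain ⟨h13, h14, h15⟩ := hsome h s hfind
    refine le_ite_zero h13 ?_
    change _ ≤ wp M (.block []) F _ _
    apply le_nil
    simp only [query, hi]
    refine hF i h s τ ρ₁ _ (by unfold querySteps; omega) keep₁ (by omega) hi
      (fun hij => by rwa [if_neg hij] at hs) hfr h14 h15
  | none =>
    have hlook := (lookup_hashTable τ x).1 hfind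
    have h13 : ρ₁ 13 = 1 := by rw [hnone hfind]; simp
    have h12' : ρ₁ 12 = x + 1 := by rw [hfr₁ _ (by omega)]; simp
    refine le_ite_ne (by omega) ?_
    have hqM : q < 2 ^ M := hP.q_lt
    have hiq : τ.length + 1 < 2 ^ M := by omega
    have hjq : j < 2 ^ M := hP.j_le.trans_lt hqM
    apply le_cons
    refine le_op (τ.length + 1) (by simp [Op.fn, keep₁.r5, keep₁.r10]) (by omega) ?_
    apply le_cons; refine le_const (by omega) ?_
    apply le_cons
    simp only [query, hlook, hlen]
    -- entering the new hash value into the table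
    have store : ∀ h s, h < 2 ^ l → s < N →
        (if τ.length + 1 = j then h % N = y else s = h ^ d % N) → ∀ ρ' n',
        n' ≤ n + 20 * τ.length + 30 + (K * (6 * l + 12 * k + 25) + 1) →
        (∀ r, r < 13 ∨ 24 ≤ r → ρ' r =
          Function.update (Function.update ρ₁ 10 (τ.length + 1)) 13 1 r) →
        ρ' 14 = h → ρ' 15 = s →
        κ (τ.length + 1) h ((x, h) :: hashTable τ) ≤ wp M (.block [.op .mul 11 11 7,
          .op .add 11 11 12, .op .mul 11 11 7, .op .add 11 11 14, .op .mul 11 11 7,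
          .op .add 11 11 15]) (fun ρ' n' => wp M (.block []) F ρ' (n' + 1)) ρ' n' := by
      intro h s hh hs hij ρ' n' hn' hfr' h14 h15
      have h7 : ρ' 7 = 2 ^ S := by rw [hfr' _ (by omega)]; simp [keep₁.r7]
      have h11 : ρ' 11 = encodeTable (2 ^ S) τ := by rw [hfr' _ (by omega)]; simp [keep₁.r11]
      have h12 : ρ' 12 = x + 1 := by rw [hfr' _ (by omega)]; simp [h12']
      have hbig : encodeTable (2 ^ S) ((x, h, s) :: τ) < 2 ^ M := by
        refine (encodeTable_lt hD ?_).trans_le (hpow _ (by simp))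
        intro a ha
        rcases List.mem_cons.1 ha with rfl | ha
        · exact ⟨hx, hh.trans_le hlS, hs.trans_le (hP.le_pow.trans hlS)⟩
        · exact hbd a ha
      simp only [encodeTable] at hbig
      set E := encodeTable (2 ^ S) τ
      have b4 := (Nat.le_add_right _ _).trans_lt hbig
      have b3 := (Nat.le_mul_of_pos_right _ hD).trans_lt b4
      have b2 := (Nat.le_add_right _ _).trans_lt b3
      have b1 := (Nat.le_mul_of_pos_right _ hD).trans_lt b2
      have b0 := (Nat.le_add_right _ _).trans_lt b1
      apply le_cons; refine le_op _ (by simp [Op.fn, h11, h7]) b0 ?_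
      apply le_cons; refine le_op _ (by simp [Op.fn, h12]) b1 ?_
      apply le_cons; refine le_op _ (by simp [Op.fn, h7]) b2 ?_
      apply le_cons; refine le_op _ (by simp [Op.fn, h14]) b3 ?_
      apply le_cons; refine le_op _ (by simp [Op.fn, h7]) b4 ?_
      apply le_cons; refine le_op _ (by simp [Op.fn, h15]) hbig ?_
      apply le_nil; apply le_nil
      refine hF (τ.length + 1) h s ((x, h, s) :: τ) _ _ (by unfold querySteps; omega) ?_ (by simp)
        (by simp [hashTable, lookup]) (fun hne => by rwa [if_neg hne] at hij) (fun r hr => ?_)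
        (by simp [h14]) (by simp [h15])
      · obtain ⟨h1, h2, h3, h4, h5, h6, h7', h8, h9, h10, h11', hv⟩ := keep₁
        constructor
        case r10 => simp [hfr']
        case r11 => simp [encodeTable, E]
        case valid => exact ⟨⟨hx, hh, hs, hij⟩, hv⟩
        all_goals simp only [ne_eq, Nat.reduceEqDiff, not_false_eq_true, Function.update_of_ne]
                  rw [hfr' _ (by omega)]
                  simpa
      · have h : r ≠ 10 ∧ r ≠ 11 ∧ r ≠ 13 := by omega
        simp only [ne_eq, h, not_false_eq_true, Function.update_of_ne]
        rw [hfr' r (by omega)]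
        simp only [ne_eq, h, not_false_eq_true, Function.update_of_ne]
        exact hfr r hr
    by_cases hij : τ.length + 1 = j
    · refine le_trans (Finset.sum_le_sum fun h _ => ?_)
        (attemptLoop_spec_challenge (k := k) (e := e) (y := y) (l := l) (N := N) (j := j)
          (G := fun h => κ (τ.length + 1) h ((x, h) :: hashTable τ))
          hP.one_lt hP.le_pow (by have := hP.l_lt; omega)
          hP.e_lt (by have := hP.k_le; omega) hP.y_lt hjq _ _ (by simp)
          (by simp [keep₁.r1]) (by simp [keep₁.r2])
          (by simp [keep₁.r3]) (by simp [keep₁.r6]) (by simp [keep₁.r8]) (by simp [keep₁.r9])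
          (by simp [hij]) ?_)
      · rw [challengeWeight, if_pos hij]
        exact mul_le_mul_left ((mul_le_mul_left (accept_le_one K) _).trans (by rw [one_mul])) _
      · intro h hh hy ρ' n' hn' hfr' h14 h15
        refine store h _ hh h15 (by rwa [if_pos hij]) ρ' n' ?_ hfr' h14 rfl
        have := Nat.le_mul_of_pos_left (6 * l + 12 * k + 25) hK
        omega
    · simp only [challengeWeight, if_neg hij]
      refine attemptLoop_spec (G := fun h => κ (τ.length + 1) h ((x, h) :: hashTable τ))
        hP.one_lt hP.le_pow (by have := hP.l_lt; omega)
        hP.e_lt (by have := hP.k_le; omega) hP.y_lt hiq hjq hij hP.root hP.root' K _ _ (by simp)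
        (by simp [keep₁.r1]) (by simp [keep₁.r2])
        (by simp [keep₁.r3]) (by simp [keep₁.r6]) (by simp [keep₁.r8]) (by simp [keep₁.r9])
        (by simp) ?_
      intro h hh ρ' n' hn' hfr' h14 h15
      exact store h _ hh (Nat.mod_lt _ hN0) (by rw [if_neg hij]) ρ' n' (by omega) hfr' h14 h15

/-! ### Guessing the parameters -/

/-- Guess a positive number: after the leading digit `1`, each further binary digit is preceded by a coin
that decides whether there is one. The result is in register `13`. -/
def guess : Cmd :=
  .block [.const 13 1, .flip 14,
    .loop 14 (.block [.flip 15, .op .add 13 13 13, .op .add 13 13 15, .flip 14])]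

lemma guessLoop_spec {M x : ℕ} (hx : x < 2 ^ M) {F : (ℕ → ℕ) → ℕ → ℝ≥0∞} {X : ℝ≥0∞} (m : ℕ) :
    ∀ (ρ : ℕ → ℕ) (n δ : ℕ), ρ 13 = x / 2 ^ m →
    (∀ ρ' n', n' ≤ n + δ + 6 * m + 2 → (∀ r, r < 13 ∨ 16 ≤ r → ρ' r = ρ r) → ρ' 13 = x → X ≤ F ρ' n') →
    X / (2 * 4 ^ m) ≤ wp M (.flip 14) (fun ρ' n' => wp M (.loop 14 (.block [.flip 15,
      .op .add 13 13 13, .op .add 13 13 15, .flip 14])) F ρ' (n' + δ)) ρ n := by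
  induction m with
  | zero =>
    intro ρ n δ h13 hF
    have : X / (2 * 4 ^ 0) = (X + 0) / 2 := by simp
    rw [this]
    refine le_flip (le_loop_zero (by simp) (hF _ _ (by omega) (fun r hr => ?_) (by simpa using h13)))
      zero_le
    have h : r ≠ 14 := by omega
    simp [h]
  | succ m ih =>
    intro ρ n δ h13 hF
    have hdiv : x / 2 ^ (m + 1) = x / 2 ^ m / 2 := by rw [pow_succ, Nat.div_div_eq_div_mul]
    have hlt : x / 2 ^ m < 2 ^ M := (Nat.div_le_self _ _).trans_lt hx
    have key : ∀ b, x / 2 ^ m % 2 = b → ∀ n', n' ≤ n + δ + 2 → ∀ ρ' : ℕ → ℕ,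
        ρ' = Function.update (Function.update ρ 14 1) 15 b →
        X / (2 * 4 ^ m) ≤ wp M (.block [.op .add 13 13 13, .op .add 13 13 15, .flip 14])
          (fun ρ' n' => wp M (.loop 14 (.block [.flip 15, .op .add 13 13 13, .op .add 13 13 15,
            .flip 14])) F ρ' (n' + 1)) ρ' (n' + 1) := by
      intro b hb n' hn' ρ' hρ'
      subst hρ'
      apply le_cons
      refine le_op (2 * (x / 2 ^ m / 2)) (by simp [Op.fn, h13, hdiv]; ring) (by omega) ?_
      apply le_cons
      refine le_op (x / 2 ^ m) (by simp [Op.fn]; omega) hlt ?_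
      apply le_cons
      refine ih _ _ 1 (by simp) fun ρ'' n'' hn'' hfr h13' => hF ρ'' n'' (by omega) (fun r hr => ?_) h13'
      have h : r ≠ 13 ∧ r ≠ 14 ∧ r ≠ 15 := by omega
      simp [hfr r hr, h]
    have half : X / (2 * 4 ^ (m + 1)) = (0 + X / (2 * 4 ^ m) / 2) / 2 := by
      rw [zero_add, pow_succ, div_eq_mul_inv, div_eq_mul_inv, div_eq_mul_inv, div_eq_mul_inv,
        ← mul_assoc, ENNReal.mul_inv (.inr (by simp)) (.inr (by simp)), mul_assoc, mul_assoc]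
      congr 2
      rw [← ENNReal.mul_inv (by simp) (by simp)]
      norm_num
    rw [half]
    refine le_flip zero_le (le_loop_ne (by simp) ?_)
    apply le_cons
    rcases Nat.mod_two_eq_zero_or_one (x / 2 ^ m) with hb | hb
    · rw [show X / (2 * 4 ^ m) / 2 = (X / (2 * 4 ^ m) + 0) / 2 by rw [add_zero]]
      exact le_flip (key 0 hb _ (by omega) _ rfl) zero_le
    · rw [show X / (2 * 4 ^ m) / 2 = (0 + X / (2 * 4 ^ m)) / 2 by rw [zero_add]]
      exact le_flip zero_le (key 1 hb _ (by omega) _ rfl)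

/-- Each number `x` is guessed with probability at least `1 / (2 * x ^ 2)`. -/
lemma guess_spec {M x : ℕ} (hx0 : x ≠ 0) (hx : x < 2 ^ M) {F : (ℕ → ℕ) → ℕ → ℝ≥0∞} {X : ℝ≥0∞}
    (ρ : ℕ → ℕ) (n : ℕ)
    (hF : ∀ ρ' n', n' ≤ n + 6 * x + 3 → (∀ r, r < 13 ∨ 16 ≤ r → ρ' r = ρ r) → ρ' 13 = x →
      X ≤ F ρ' n') : X / (2 * x ^ 2) ≤ wp M guess F ρ n := by
  have h1 : 1 < 2 ^ M := by
    rcases Nat.eq_zero_or_pos M with rfl | h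
    · simp at hx; omega
    · exact Nat.one_lt_two_pow (by omega)
  have hlog : 2 ^ Nat.log 2 x ≤ x := Nat.pow_log_le_self 2 hx0
  have hlx : Nat.log 2 x ≤ x := Nat.log_le_self 2 x
  apply le_cons; refine le_const h1 ?_
  apply le_cons
  refine le_trans ?_ (guessLoop_spec (X := X) hx (Nat.log 2 x) (Function.update ρ 13 1) (n + 1) 0 ?_ ?_)
  · refine ENNReal.div_le_div_left ?_ _
    refine mul_le_mul_right ?_ _
    have : (4 : ℝ≥0∞) = 2 ^ 2 := by norm_num
    rw [this, ← pow_mul, mul_comm 2, pow_mul]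
    gcongr
    exact_mod_cast hlog
  · simp only [Function.update_self]
    refine (Nat.div_eq_of_lt_le (by simpa using hlog) ?_).symm
    have := Nat.lt_pow_succ_log_self (b := 2) (by norm_num) x
    rw [pow_succ] at this
    linarith
  · intro ρ' n' hn' hfr h13
    apply le_nil
    refine hF ρ' n' (by omega) (fun r hr => ?_) h13
    have h : r ≠ 13 := by omega
    simp [hfr r hr, h]

/-- Put the power of two with the exponent in register `13` into register `r`. -/
def twoPow (r : ℕ) : Cmd :=
  .block [.const r 1, .loop 13 (.block [.op .add r r r, .op .sub 13 13 5])]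

lemma twoPow_spec {M r x : ℕ} (hr : r < 12) (hr5 : r ≠ 5) (hxM : x < M) {F : (ℕ → ℕ) → ℕ → ℝ≥0∞}
    {X : ℝ≥0∞} (ρ : ℕ → ℕ) (n : ℕ) (h13 : ρ 13 = x) (h5 : ρ 5 = 1)
    (hF : ∀ ρ' n', n' ≤ n + 4 * x + 2 → (∀ s, s ≠ r ∧ s ≠ 13 → ρ' s = ρ s) → ρ' r = 2 ^ x → X ≤ F ρ' n') :
    X ≤ wp M (twoPow r) F ρ n := by
  have loop : ∀ (z v : ℕ) (ρ' : ℕ → ℕ) (n' : ℕ), z + v = x → ρ' r = 2 ^ v → ρ' 13 = z → ρ' 5 = 1 →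
      n' ≤ n + 4 * v + 1 → (∀ s, s ≠ r ∧ s ≠ 13 → ρ' s = ρ s) →
      X ≤ wp M (.loop 13 (.block [.op .add r r r, .op .sub 13 13 5])) (wp M (.block []) F) ρ' n' := by
    intro z
    induction z with
    | zero =>
      intro v ρ' n' hv h1 h2 _ hn' hfr
      refine le_loop_zero h2 ?_
      apply le_nil
      exact hF _ _ (by omega) hfr (by rw [h1]; congr 1; omega)
    | succ z ih =>
      intro v ρ' n' hv h1 h2 h3 hn' hfr
      have hpow : 2 ^ (v + 1) < 2 ^ M := Nat.pow_lt_pow_right (by norm_num) (by omega)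
      have hz : z < 2 ^ M := (show z < M by omega).trans Nat.lt_two_pow_self
      have hr13 : r ≠ 13 := by omega
      refine le_loop_ne (by omega) ?_
      apply le_cons; refine le_op (2 ^ (v + 1)) (by simp [Op.fn, h1]; ring) hpow ?_
      apply le_cons
      refine le_op z (by simp [Op.fn, h2, h3, hr13.symm, hr5.symm]) hz ?_
      apply le_nil
      refine ih (v + 1) _ _ (by omega) (by simp [hr13]) (by simp) (by simp [hr5.symm, h3]) (by omega)
        fun s hs => ?_
      simp [hs, hfr s hs]
  have hr13 : r ≠ 13 := by omega
  apply le_cons; refine le_const (Nat.one_lt_two_pow (by omega)) ?_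
  apply le_cons
  exact loop x 0 _ _ (by omega) (by simp) (by simp [hr13.symm, h13]) (by simp [hr5.symm, h5]) (by omega)
    fun s hs => by simp [hs]

/-- Guess the number of bits of the base of the table, the number of bits of the hash values and the
position of the forged message; then copy the public key into the registers of the adversary. -/
def prologue : Cmd :=
  .block [.const 5 1, .const 6 2, guess, twoPow 7, guess, twoPow 8, guess, .copy 9 13,
    .copy 24 0, .copy 25 1, .copy 26 2]

lemma prologue_spec {M N e d y S l j n : ℕ} (hS : S < M) (hl : l < M) (hj : j < M) (hS0 : S ≠ 0)
    (hl0 : l ≠ 0) (hj0 : j ≠ 0) {F : (ℕ → ℕ) → ℕ → ℝ≥0∞} {X : ℝ≥0∞}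
    (hF : ∀ ρ' n', n' ≤ 10 * (S + l + j) + 20 → Keeps (2 ^ S) N e d l j y [] ρ' →
      (∀ r, ρ' (r + 24) = (start [n, N, e]).reg r) → X ≤ F ρ' n') :
    X / (2 * j ^ 2) / (2 * l ^ 2) / (2 * S ^ 2) ≤ wp M prologue F (start [n, N, e, y]).reg 0 := by
  have pow_lt : ∀ x, x < M → x < 2 ^ M := fun x hx => hx.trans Nat.lt_two_pow_self
  have h4 : ∀ s, 4 ≤ s → (start [n, N, e, y]).reg s = 0 := by
    intro s hs
    obtain ⟨s, rfl⟩ := Nat.exists_eq_add_of_le' hs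
    simp [start]
  have h2M : 2 < 2 ^ M := by
    calc 2 < 2 ^ 2 := by norm_num
      _ ≤ 2 ^ M := Nat.pow_le_pow_right (by norm_num) (by omega)
  set ρ₀ := (start [n, N, e, y]).reg with hρ₀
  apply le_cons; refine le_const (by omega) ?_
  apply le_cons; refine le_const h2M ?_
  apply le_cons
  refine guess_spec hS0 (pow_lt S hS) _ _ fun ρ₁ n₁ hn₁ hfr₁ h13 => ?_
  apply le_cons
  refine twoPow_spec (by norm_num) (by norm_num) hS ρ₁ n₁ h13 (by simp [hfr₁]) fun ρ₂ n₂ hn₂ hfr₂ h7 => ?_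
  apply le_cons
  refine guess_spec hl0 (pow_lt l hl) _ _ fun ρ₃ n₃ hn₃ hfr₃ h13 => ?_
  apply le_cons
  refine twoPow_spec (by norm_num) (by norm_num) hl ρ₃ n₃ h13 (by simp [hfr₃, hfr₂, hfr₁])
    fun ρ₄ n₄ hn₄ hfr₄ h8 => ?_
  apply le_cons
  refine guess_spec hj0 (pow_lt j hj) _ _ fun ρ₅ n₅ hn₅ hfr₅ h13 => ?_
  apply le_cons; refine le_copy ?_
  apply le_cons; refine le_copy ?_
  apply le_cons; refine le_copy ?_
  apply le_cons; refine le_copy ?_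
  apply le_nil
  have get : ∀ s, s ≠ 7 ∧ s ≠ 8 → s < 13 ∨ 16 ≤ s →
      ρ₅ s = Function.update (Function.update ρ₀ 5 1) 6 2 s := fun s hs hs' => by
    rw [hfr₅ s hs', hfr₄ s ⟨hs.2, by omega⟩, hfr₃ s hs', hfr₂ s ⟨hs.1, by omega⟩, hfr₁ s hs']
  refine hF _ _ (by omega) ?_ fun r => ?_
  · constructor
    case r7 => simp [hfr₅, hfr₄, hfr₃, h7]
    case r8 => simp [hfr₅, h8]
    case r9 => simp [h13]
    case valid => trivial
    all_goals simp [get, h4, encodeTable]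
    all_goals simp [hρ₀, start]
  · match r with
    | 0 => simp [get]; simp [hρ₀, start]
    | 1 => simp [get]; simp [hρ₀, start]
    | 2 => simp [get]; simp [hρ₀, start]
    | r + 3 =>
      have h : r + 3 + 24 ≠ 9 ∧ r + 3 + 24 ≠ 24 ∧ r + 3 + 24 ≠ 25 ∧ r + 3 + 24 ≠ 26 ∧
        r + 3 + 24 ≠ 5 ∧ r + 3 + 24 ≠ 6 := by omega
      simp only [ne_eq, h, not_false_eq_true, Function.update_of_ne]
      rw [get _ (by omega) (by omega)]
      simp only [ne_eq, h, not_false_eq_true, Function.update_of_ne]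
      rw [h4 _ (by omega)]
      simp [start]

/-! ### The reduction -/

/-- The number of instructions that replace one instruction of the adversary. -/
def blockSize : ℕ := answerQuery.size + 2

/-- The address of the instructions that replace the instruction number `p` of the adversary. -/
def blockAddr (p : ℕ) : ℕ := prologue.size + p * blockSize

/-- The instructions that replace the instruction number `p`, with the code `c`, of an adversary with `len`
instructions. The registers of the adversary are moved by `24` places. Oracle calls are replaced by the
simulation of the oracles, and all other instructions are followed by a jump to the next block. -/
def instrBlock (len p : ℕ) (c : Code) : List Code :=
  if c.1 < 9 then
    (c.1, c.2.1 + 24, if c.1 = 0 then c.2.2.1 else if c.1 = 7 then blockAddr (min c.2.2.1 len)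
      else c.2.2.1 + 24, c.2.2.2 + 24) ::
      (7, 4, blockAddr (p + 1), 0) :: List.replicate answerQuery.size (7, 4, 0, 0)
  else
    (1, 12, c.2.2.1 + 24, 0) :: (answerQuery.compile (blockAddr p + 1) ++
      [(1, c.2.1 + 24, if c.1 = 9 then 14 else 15, 0)])

/-- The RSA inverter that is made from the code of an adversary against the signature scheme. -/
def reduction (cs : List Code) : List Code :=
  prologue.compile 0 ++ ((List.range cs.length).flatMap fun p =>
    instrBlock cs.length p (cs.getD p (0, 0, 0, 0))) ++ [(1, 0, 25, 0)]

lemma length_instrBlock (len p : ℕ) (c : Code) : (instrBlock len p c).length = blockSize := by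
  unfold instrBlock blockSize
  split <;> simp [Cmd.length_compile]

lemma exists_flatMap_range {α : Type*} {f : ℕ → List α} {s : ℕ} (hf : ∀ p, (f p).length = s)
    (len : ℕ) : ((List.range len).flatMap f).length = len * s ∧ ∀ p < len, ∃ pre post,
      (List.range len).flatMap f = pre ++ f p ++ post ∧ pre.length = p * s := by
  induction len with
  | zero => simp
  | succ len ih =>
    have hlast : (List.range (len + 1)).flatMap f = (List.range len).flatMap f ++ f len := by
      simp [List.range_succ]
    rw [hlast]
    refine ⟨by rw [List.length_append, ih.1, hf]; ring, fun p hp => ?_⟩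
    rcases Nat.lt_succ_iff_lt_or_eq.1 hp with h | rfl
    · obtain ⟨pre, post, h1, h2⟩ := ih.2 p h
      exact ⟨pre, post ++ f len, by rw [h1]; simp, h2⟩
    · exact ⟨_, [], by simp, ih.1⟩

lemma codeAt_block (cs : List Code) {p : ℕ} (hp : p < cs.length) :
    CodeAt (reduction cs) (blockAddr p) (instrBlock cs.length p (cs.getD p (0, 0, 0, 0))) := by
  obtain ⟨pre, post, h1, h2⟩ := (exists_flatMap_range
    (fun p => length_instrBlock cs.length p (cs.getD p (0, 0, 0, 0))) cs.length).2 p hp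
  refine ⟨prologue.compile 0 ++ pre, post ++ [(1, 0, 25, 0)], ?_, ?_⟩
  · rw [reduction, h1]; simp
  · simp [Cmd.length_compile, h2, blockAddr]

lemma codeAt_end (cs : List Code) :
    CodeAt (reduction cs) (blockAddr cs.length) [(1, 0, 25, 0)] := by
  refine ⟨prologue.compile 0 ++ ((List.range cs.length).flatMap fun p =>
    instrBlock cs.length p (cs.getD p (0, 0, 0, 0))), [], by simp [reduction], ?_⟩
  rw [List.length_append, Cmd.length_compile, (exists_flatMap_range
    (fun p => length_instrBlock cs.length p (cs.getD p (0, 0, 0, 0))) cs.length).1, blockAddr]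

lemma length_reduction (cs : List Code) : (reduction cs).length = blockAddr cs.length + 1 := by
  obtain ⟨pre, post, h1, h2⟩ := codeAt_end cs
  have h3 := (exists_flatMap_range
    (fun p => length_instrBlock cs.length p (cs.getD p (0, 0, 0, 0))) cs.length).1
  rw [reduction, List.length_append, List.length_append, h3, Cmd.length_compile, blockAddr]
  simp

/-- All values in the registers have been paid for, up to the length `B` of the input. -/
lemma strLen_le_of_exec {O : Oracles} {c c' : Config} {I : Instr} {B : ℕ}
    (h : c' ∈ (I.exec O c).support) (hc : ∀ r, strLen (c.reg r) ≤ B + c.cost) (r : ℕ) :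
    strLen (c'.reg r) ≤ B + c'.cost := by
  have upd : ∀ (s v k : ℕ), strLen v ≤ 1 + k →
      strLen (Function.update c.reg s v r) ≤ B + (c.cost + (1 + k)) := by
    intro s v k hv
    by_cases hrs : r = s
    · subst hrs; rw [Function.update_self]; omega
    · rw [Function.update_of_ne hrs]; have := hc r; omega
  cases I <;> simp only [Instr.exec, Config.binop, Config.put, PMF.support_pure,
    Set.mem_singleton_iff, PMF.mem_support_map_iff] at h
  case jz => subst h; have := hc r; simp only; omega
  case flip =>
    obtain ⟨b, -, rfl⟩ := h
    refine upd _ _ _ ?_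
    refine strLen_le_of_lt (M := 1) ?_
    cases b <;> norm_num
  all_goals subst h; exact upd _ _ _ (by omega)

/-- The payoff for a forgery by the program `P` in time `T`, when `h` is the hash value of the
message. -/
noncomputable def forgery (P : List Instr) (N e T : ℕ) (c : Config) (h : ℕ) : ℝ≥0∞ := by
  classical
  exact if P.length ≤ c.pc ∧ c.cost + ∑ r ∈ Finset.range 2, strLen (c.reg r) ≤ T ∧
    c.reg 0 ∉ c.signed ∧ c.reg 1 ^ e ≡ h [MOD N] then 1 else 0

/-- The payoff for an RSA inversion by the program `P` in time `T`. -/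
noncomputable def inversion (P : List Instr) (N e y T : ℕ) (c : Config) : ℝ≥0∞ := by
  classical
  exact if P.length ≤ c.pc ∧ c.cost + ∑ r ∈ Finset.range 1, strLen (c.reg r) ≤ T ∧
    c.reg 0 ^ e ≡ y [MOD N] then 1 else 0

/-- The payoff for a forgery at position `j` in the order of the hash queries. -/
noncomputable def forgeryAt (P : List Instr) (N e T j : ℕ) (c : Config) (i h : ℕ) : ℝ≥0∞ :=
  if i = j then forgery P N e T c h else 0

lemma forgery_le_one (P : List Instr) (N e T : ℕ) (c : Config) (h : ℕ) :
    forgery P N e T c h ≤ 1 := by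
  unfold forgery; split <;> simp

lemma forgery_eq_zero {P : List Instr} {N e T : ℕ} {c : Config} {h : ℕ}
    (hc : ¬ (P.length ≤ c.pc ∧ c.cost + ∑ r ∈ Finset.range 2, strLen (c.reg r) ≤ T ∧
      c.reg 0 ∉ c.signed ∧ c.reg 1 ^ e ≡ h [MOD N])) : forgery P N e T c h = 0 := by
  rw [forgery, if_neg hc]

lemma forgeryAt_eq_zero_of_cost {P : List Instr} {N e T j : ℕ} (c : Config) (i h : ℕ)
    (hc : T < c.cost) : forgeryAt P N e T j c i h = 0 := by
  unfold forgeryAt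
  split
  · exact forgery_eq_zero fun h => by omega
  · rfl

lemma forgeryAt_eq_zero_of_signed {P : List Instr} {N e T j : ℕ} (c : Config) (i h : ℕ)
    (hc : i ≠ j ∨ c.reg 0 ∈ c.signed) : forgeryAt P N e T j c i h = 0 := by
  unfold forgeryAt
  split
  · next hij => exact forgery_eq_zero fun h => h.2.2.1 (hc.resolve_left (not_not.2 hij))
  · rfl

lemma lookup_inj {τ : List (ℕ × ℕ)} {i x x' h h' : ℕ} (e : lookup τ x = some (i, h))
    (e' : lookup τ x' = some (i, h')) : x = x' := by
  induction τ with
  | nil => simp [lookup] at e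
  | cons a τ ih =>
    obtain ⟨m, v⟩ := a
    simp only [lookup] at e e'
    split at e <;> split at e'
    · omega
    · have := lookup_index e'
      simp at e; omega
    · have := lookup_index e
      simp at e'; omega
    · exact ih e e'

lemma lookup_valid {D N d l j y : ℕ} {x h : ℕ} : ∀ {τ : List (ℕ × ℕ × ℕ)},
    ValidTable D N d l j y τ → lookup (hashTable τ) x = some (j, h) → h % N = y
  | [], _, e => by simp [lookup, hashTable] at e
  | (m, v, s) :: τ, hτ, e => by
    have hlen : (hashTable τ).length = τ.length := by simp [hashTable]
    have hcons : hashTable ((m, v, s) :: τ) = (m, v) :: hashTable τ := rfl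
    rw [hcons] at e
    simp only [lookup, hlen] at e
    split at e
    · simp only [Option.some.injEq, Prod.mk.injEq] at e
      have := hτ.1.2.2.2
      rw [if_pos e.1, e.2] at this
      exact this
    · exact lookup_valid hτ.2 e

/-- The weights of the challenge sum up to at most one. -/
lemma sum_challengeWeight_le {N l j y : ℕ} (hN : 0 < N) (hNl : N ≤ 2 ^ l) :
    ∑ h ∈ Finset.range (2 ^ l), challengeWeight N l j y j h ≤ 1 := by
  have h1 := le_sum_attempts_challenge (y := y) hN hNl fun _ => 1
  have h2 : ∑ u ∈ Finset.range (2 ^ (l + 1)), (if N * (u / N) + y < 2 ^ l then (1 : ℝ≥0∞) else 0) ≤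
      2 ^ (l + 1) := by
    refine (Finset.sum_le_sum (g := fun _ => 1) fun u _ => ?_).trans ?_
    · split <;> simp
    · simp
  simp only [challengeWeight, if_true]
  rw [← Finset.mul_sum, ← Finset.mul_sum]
  calc (N : ℝ≥0∞) / 2 * ((2 ^ l)⁻¹ * ∑ h ∈ Finset.range (2 ^ l), if h % N = y then 1 else 0)
      = (2 ^ (l + 1))⁻¹ * (N * ∑ h ∈ Finset.range (2 ^ l), if h % N = y then 1 else 0) := by
        rw [div_eq_mul_inv, pow_succ, ENNReal.mul_inv (.inl (by simp)) (.inl (by simp))]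
        ring
    _ ≤ (2 ^ (l + 1))⁻¹ * 2 ^ (l + 1) := by gcongr; exact h1.trans h2
    _ = 1 := ENNReal.inv_mul_cancel (by simp) (by simp)

/-- The last query of the game, on the side of the reduction: a forgery at position `j` is a solution of the
RSA problem. -/
lemma query_forgeryAt_le {P : List Instr} {D N e d l j y T K : ℕ} (hN : 0 < N) (hNl : N ≤ 2 ^ l)
    {c : Config} {τ : List (ℕ × ℕ × ℕ)} (hv : ValidTable D N d l j y τ) {w : ℝ≥0∞}
    (hw : P.length ≤ c.pc → c.cost + ∑ r ∈ Finset.range 2, strLen (c.reg r) ≤ T →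
      c.reg 1 ^ e ≡ y [MOD N] → 1 ≤ w) :
    query (fun i h => accept K * challengeWeight N l j y i h) l (hashTable τ) (c.reg 0)
      (fun i h _ => forgeryAt P N e T j c i h) ≤ w := by
  have pay : ∀ h, h % N = y → forgery P N e T c h ≤ w := by
    intro h hh
    by_cases hf : P.length ≤ c.pc ∧ c.cost + ∑ r ∈ Finset.range 2, strLen (c.reg r) ≤ T ∧
      c.reg 0 ∉ c.signed ∧ c.reg 1 ^ e ≡ h [MOD N]
    · refine (forgery_le_one ..).trans (hw hf.1 hf.2.1 (hf.2.2.2.trans ?_))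
      rw [← hh]
      exact (Nat.mod_modEq _ _).symm
    · rw [forgery_eq_zero hf]; exact zero_le
  unfold query
  split
  · next i h e =>
    simp only [forgeryAt]
    split
    · next hij => subst hij; exact pay h (lookup_valid hv e)
    · exact zero_le
  · unfold forgeryAt
    by_cases hij : (hashTable τ).length + 1 = j
    · rw [hij]
      simp only [if_true]
      calc _ ≤ ∑ h ∈ Finset.range (2 ^ l), challengeWeight N l j y j h * w := by
            refine Finset.sum_le_sum fun h _ => ?_
            by_cases hy : h % N = y
            · refine mul_le_mul' ?_ (pay h hy)
              exact (mul_le_mul_left (accept_le_one K) _).trans (by rw [one_mul])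
            · simp [challengeWeight, hy]
        _ ≤ 1 * w := by
            rw [← Finset.sum_mul]
            exact mul_le_mul_left (sum_challengeWeight_le hN hNl) _
        _ = w := one_mul w
    · simp [hij]

lemma answerQuery_safe : answerQuery.Safe := by
  simp [answerQuery, newEntry, attempt, lookupLoop, powMod, sampleBits, Cmd.block, Cmd.Safe]

lemma prologue_safe : prologue.Safe := by
  simp [prologue, guess, twoPow, Cmd.block, Cmd.Safe]

lemma Keeps.congr {D N e d l j y : ℕ} {τ : List (ℕ × ℕ × ℕ)} {ρ ρ' : ℕ → ℕ}
    (h : Keeps D N e d l j y τ ρ) (hρ : ∀ r < 12, ρ' r = ρ r) : Keeps D N e d l j y τ ρ' := by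
  obtain ⟨h1, h2, h3, h4, h5, h6, h7, h8, h9, h10, h11, hv⟩ := h
  constructor <;> first | assumption | (rw [hρ _ (by norm_num)]; assumption)

/-- The number of steps of the reduction for one step of the adversary. -/
def stepBound (K l k q : ℕ) : ℕ := querySteps K l k q + 2

lemma lt_two_pow_of_strLen {x B : ℕ} (h : strLen x ≤ B) : x + 1 < 2 ^ (B + 1) := by
  have := lt_of_strLen_le h
  have h2 : 0 < 2 ^ (B + 1) := by positivity
  omega

/-- The reduction simulates the game in which the `j`-th hash value is congruent to the challenge. -/
theorem game_le_valueAt {cs : List Code} {M S N e d y l k j q K B T Tr : ℕ}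
    (hP : Params M S N e d y l k j q) (hK : 0 < K) (hS : B + T + 1 ≤ S) (t : ℕ) :
    ∀ (c : Config) (τ : List (ℕ × ℕ × ℕ)) (ρ : ℕ → ℕ) (m : ℕ), Keeps (2 ^ S) N e d l j y τ ρ →
      (∀ r, ρ (r + 24) = c.reg r) → Bounded M ρ → (∀ r, strLen (c.reg r) ≤ B + c.cost) →
      τ.length + t ≤ q → (m + t * stepBound K l k q + 1) * (1 + 3 * M) + M ≤ Tr →
      game (cs.map Instr.ofCode) N d l (fun i h => accept K * challengeWeight N l j y i h)
        (forgeryAt (cs.map Instr.ofCode) N e T j) t c (hashTable τ) ≤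
      valueAt (reduction cs) (inversion ((reduction cs).map Instr.ofCode) N e y Tr) M
        (blockAddr (min c.pc cs.length)) ρ m := by
  have hN0 : 0 < N := by have := hP.one_lt; omega
  set C := reduction cs with hC
  set pay := inversion (C.map Instr.ofCode) N e y Tr with hpay
  have hSM : S ≤ M := by
    have := hP.bits
    have h1 : 3 * S ≤ 3 * S * (q + 1) := Nat.le_mul_of_pos_right _ (by omega)
    omega
  have hM1 : 1 ≤ M := by omega
  have hpay0 : ∀ c : Config, c.pc < C.length → pay c = 0 := by
    intro c hc
    rw [hpay, inversion, if_neg]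
    simp only [List.length_map]
    omega
  induction t with
  | zero =>
    intro c τ ρ m hρ hreg hB hlen hq hTr
    refine query_forgeryAt_le hN0 hP.le_pow hρ.valid fun hhalt hcost hy => ?_
    rw [List.length_map] at hhalt
    rw [min_eq_right hhalt]
    refine le_trans ?_ (valueAt_copy (codeAt_end cs) hB)
    refine le_iInf₂ fun c' hc' => le_trans (le_of_eq ?_) (pay_le_value c')
    rw [hpay, inversion, if_pos]
    obtain ⟨h1, h2, h3⟩ := hc'
    refine ⟨by rw [List.length_map, hC, length_reduction, h1], ?_, ?_⟩
    · have h4 : strLen (c'.reg 0) ≤ M := by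
        rw [h2, Function.update_self]
        exact strLen_le_of_lt (hB _)
      simp only [Finset.range_one, Finset.sum_singleton]
      rw [zero_mul, add_zero] at hTr
      omega
    · rw [h2, Function.update_self, hreg 1]
      exact hy
  | succ t ih =>
    intro c τ ρ m hρ hreg hB hlen hq hTr
    have hTr' : ∀ m', m' ≤ m + stepBound K l k q →
        (m' + t * stepBound K l k q + 1) * (1 + 3 * M) + M ≤ Tr := by
      intro m' hm'
      refine le_trans ?_ hTr
      gcongr ?_ * _ + _
      rw [add_mul]
      omega
    by_cases hcT : T < c.cost
    · rw [game_eq_zero_of_cost forgeryAt_eq_zero_of_cost _ _ _ hcT]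
      exact zero_le
    rw [game]
    by_cases hp : c.pc < cs.length
    swap
    · rw [List.getElem?_eq_none (by simpa using hp)]
      exact ih c τ ρ m hρ hreg hB hlen (by omega) (hTr' m (by omega))
    have hat := codeAt_block cs hp
    rw [List.getElem?_map, List.getElem?_eq_getElem hp, min_eq_left hp.le]
    rw [List.getD_eq_getElem _ _ hp] at hat
    generalize cs[c.pc] = code at hat ⊢
    obtain ⟨o, a, b, x⟩ := code
    simp only [Option.map_some]
    unfold instrBlock at hat
    -- the state after an ordinary instruction
    have next : ∀ (c' : Config) (v : ℕ), c' ∈ ((Instr.ofCode (o, a, b, x)).exec noOracles c).support →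
        c'.pc = c.pc + 1 → c'.reg = Function.update c.reg a v → o < 9 → (v < 2 ^ M →
          game (cs.map Instr.ofCode) N d l (fun i h => accept K * challengeWeight N l j y i h)
            (forgeryAt (cs.map Instr.ofCode) N e T j) t c' (hashTable τ) ≤
          valueAt C pay M (blockAddr c.pc + 1) (Function.update ρ (a + 24) v) (m + 1)) ∧
        (¬ v < 2 ^ M →
          game (cs.map Instr.ofCode) N d l (fun i h => accept K * challengeWeight N l j y i h)
            (forgeryAt (cs.map Instr.ofCode) N e T j) t c' (hashTable τ) = 0) := by
      intro c' v hc' hpc' hreg' ho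
      have hlen' := strLen_le_of_exec hc' hlen
      refine ⟨fun hv => ?_, fun hv => ?_⟩
      · simp only [ho, if_true] at hat
        have hkeep : Keeps (2 ^ S) N e d l j y τ (Function.update ρ (a + 24) v) :=
          hρ.congr fun r hr => Function.update_of_ne (by omega) ..
        have hjump := valueAt_jump (pay := pay) (n := m + 1) hat.tail (hB.update (r := a + 24) hv)
        rw [if_pos hkeep.r4] at hjump
        refine le_trans ?_ hjump
        rw [show blockAddr (c.pc + 1) = blockAddr (min c'.pc cs.length) by rw [hpc', min_eq_left hp]]
        refine ih c' τ _ _ hkeep (fun r => ?_) (hB.update hv) hlen' (by omega)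
          (hTr' _ (by unfold stepBound; omega))
        rw [hreg']
        by_cases hr : r = a
        · subst hr; simp
        · rw [Function.update_of_ne (by omega), Function.update_of_ne hr, hreg]
      · refine game_eq_zero_of_cost (B := T) forgeryAt_eq_zero_of_cost _ _ _ ?_
        by_contra hcost
        have h1 := hlen' a
        rw [hreg', Function.update_self] at h1
        have h2 := lt_two_pow_of_strLen h1
        have h3 : 2 ^ (B + c'.cost + 1) ≤ 2 ^ M := Nat.pow_le_pow_right (by norm_num) (by omega)
        omega
    -- arithmetic instructions
    have arith : ∀ op : Op, o = op.num →
        (Instr.ofCode (o, a, b, x)).exec noOracles c = PMF.pure (c.binop op.fn a b x) →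
        ev ((Instr.ofCode (o, a, b, x)).exec noOracles c) (fun c' =>
          game (cs.map Instr.ofCode) N d l (fun i h => accept K * challengeWeight N l j y i h)
            (forgeryAt (cs.map Instr.ofCode) N e T j) t c' (hashTable τ)) ≤
        valueAt C pay M (blockAddr c.pc) ρ m := by
      intro op ho hexec
      have h9 : o < 9 := by cases op <;> simp [ho, Op.num]
      have h0 : o ≠ 0 := by cases op <;> simp [ho, Op.num]
      have h7 : o ≠ 7 := by cases op <;> simp [ho, Op.num]
      have hn := next (c.binop op.fn a b x) (op.fn (c.reg b) (c.reg x)) (by rw [hexec]; simp)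
        (by simp [Config.binop, Config.put]) (by simp [Config.binop, Config.put]) h9
      rw [hexec, ev_pure]
      by_cases hv : op.fn (c.reg b) (c.reg x) < 2 ^ M
      · simp only [h9, h0, h7, if_true, if_false] at hat
        refine (hn.1 hv).trans ?_
        have := valueAt_op (o := op) (pay := pay) (n := m) (ho ▸ hat) hB (by rwa [hreg, hreg])
        rwa [hreg, hreg] at this
      · rw [hn.2 hv]; exact zero_le
    -- oracle calls
    have oracle : 9 ≤ o →
        (∀ h, ∃ c', (Instr.ofCode (o, a, b, x)).exec (answer N d h) c = PMF.pure c' ∧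
          c'.pc = c.pc + 1 ∧ c'.reg = Function.update c.reg a (if o = 9 then h else h ^ d % N) ∧
          (o ≠ 9 → c.reg b ∈ c'.signed)) →
        query (fun i h => accept K * challengeWeight N l j y i h) l (hashTable τ) (c.reg b)
          (fun _ h τ' => ev ((Instr.ofCode (o, a, b, x)).exec (answer N d h) c) fun c' =>
            game (cs.map Instr.ofCode) N d l (fun i h => accept K * challengeWeight N l j y i h)
              (forgeryAt (cs.map Instr.ofCode) N e T j) t c' τ') ≤
        valueAt C pay M (blockAddr c.pc) ρ m := by
      intro ho hexec
      simp only [not_lt.2 ho, if_false] at hat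
      have hx : c.reg b + 1 < 2 ^ S := by
        refine (lt_two_pow_of_strLen (hlen b)).trans_le (Nat.pow_le_pow_right (by norm_num) ?_)
        omega
      refine le_trans ?_ (valueAt_copy hat hB)
      rw [hreg]
      set ρ₁ := Function.update ρ 12 (c.reg b)
      have hB₁ : Bounded M ρ₁ := hB.update (by rw [← hreg]; exact hB _)
      have hρ₁ : Keeps (2 ^ S) N e d l j y τ ρ₁ :=
        hρ.congr fun r hr => Function.update_of_ne (by omega) ..
      have hcopy := hat.tail.right
      rw [Cmd.length_compile] at hcopy
      let F : (ℕ → ℕ) → ℕ → ℝ≥0∞ := fun ρ n => by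
        classical
        exact if Bounded M ρ then valueAt C pay M (blockAddr c.pc + 1 + answerQuery.size) ρ n else ⊤
      refine le_trans ?_ (wp_le_valueAt hM1 hpay0 answerQuery (F := F) answerQuery_safe hat.tail.left
        (fun ρ n hb _ => by simp only [F]; rw [if_pos hb]) ρ₁ (m + 1) hB₁ hρ₁.r4)
      refine answerQuery_spec hP hx hK (by omega) hρ₁ (by simp [ρ₁]) ?_
      intro i h s τ' ρ' n' hn' hρ' hτ' hlook hs hfr h14 h15
      simp only [F]
      split
      swap
      · exact le_top
      next hB' =>
      obtain ⟨c', hc', hpc', hreg', hsigned⟩ := hexec h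
      have hsupp : c' ∈ ((Instr.ofCode (o, a, b, x)).exec (answer N d h) c).support := by
        rw [hc']; simp
      rw [hc', ev_pure]
      by_cases hbad : o ≠ 9 ∧ i = j
      · rw [game_eq_zero_of_signed forgeryAt_eq_zero_of_signed]
        · exact zero_le
        · intro i' x' h' e hi'
          rw [← hbad.2] at hi'
          subst hi'
          rw [← lookup_inj hlook e]
          exact hsigned hbad.1
        · rw [← hbad.2]
          exact (lookup_index hlook).2
      · refine le_trans ?_ (valueAt_copy hcopy hB')
        have hres : ρ' (if o = 9 then 14 else 15) = if o = 9 then h else h ^ d % N := by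
          split
          · exact h14
          · next h9 => rw [h15, hs fun hij => hbad ⟨h9, hij⟩]
        rw [hres]
        have haddr : blockAddr c.pc + 1 + answerQuery.size + 1 = blockAddr (min c'.pc cs.length) := by
          rw [hpc', min_eq_left hp]
          simp only [blockAddr, blockSize]
          ring
        rw [haddr]
        have hb : (if o = 9 then h else h ^ d % N) < 2 ^ M := by rw [← hres]; exact hB' _
        refine ih c' τ' _ _ (hρ'.congr fun r hr => Function.update_of_ne (by omega) ..) (fun r => ?_)
          (hB'.update hb) (strLen_le_of_exec hsupp hlen) (by omega)
          (hTr' _ (by unfold stepBound; omega))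
        rw [hreg']
        by_cases hr : r = a
        · subst hr; simp
        · rw [Function.update_of_ne (by omega), Function.update_of_ne hr, hfr _ (by omega), ← hreg]
          exact Function.update_of_ne (by omega) ..
    match o, hat, next, arith, oracle with
    | 0, hat, next, _, _ =>
      have hn := next (c.put a b (strLen b)) b (by simp [Instr.ofCode, Instr.exec]) rfl rfl
        (by norm_num)
      simp only [Instr.ofCode, Instr.queryReg, Instr.exec, ev_pure]
      by_cases hv : b < 2 ^ M
      · exact (hn.1 hv).trans (valueAt_const (by simpa using hat) hv)
      · rw [hn.2 hv]; exact zero_le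
    | 1, hat, next, _, _ =>
      have hn := next (c.put a (c.reg b) (strLen (c.reg b))) (c.reg b)
        (by simp [Instr.ofCode, Instr.exec]) rfl rfl (by norm_num)
      simp only [Instr.ofCode, Instr.queryReg, Instr.exec, ev_pure]
      refine (hn.1 (by rw [← hreg]; exact hB _)).trans ?_
      rw [← hreg b]
      exact valueAt_copy (by simpa using hat) hB
    | 2, _, _, arith, _ => exact arith .add rfl rfl
    | 3, _, _, arith, _ => exact arith .sub rfl rfl
    | 4, _, _, arith, _ => exact arith .mul rfl rfl
    | 5, _, _, arith, _ => exact arith .div rfl rfl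
    | 6, _, _, arith, _ => exact arith .mod rfl rfl
    | 7, hat, _, _, _ =>
      simp only [Instr.ofCode, Instr.queryReg, Instr.exec, ev_pure]
      simp only [Nat.reduceLT, if_true, Nat.reduceEqDiff, OfNat.ofNat_ne_zero, if_false] at hat
      refine le_trans ?_ (valueAt_jump hat hB)
      rw [hreg]
      have hlen' : ∀ p r, strLen (({ c with pc := p, cost := c.cost + (1 + strLen (c.reg a)) } :
          Config).reg r) ≤ B + (c.cost + (1 + strLen (c.reg a))) := fun p r => by
        have := hlen r
        simp only
        omega
      split
      · exact ih _ τ ρ (m + 1) hρ hreg hB (hlen' _) (by omega) (hTr' _ (by unfold stepBound; omega))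
      · have hjump := valueAt_jump (pay := pay) (n := m + 1) hat.tail hB
        rw [if_pos hρ.r4] at hjump
        refine le_trans ?_ hjump
        have := ih { c with pc := c.pc + 1, cost := c.cost + (1 + strLen (c.reg a)) } τ ρ (m + 1 + 1)
          hρ hreg hB (hlen' _) (by omega) (hTr' _ (by unfold stepBound; omega))
        rwa [min_eq_left (by simpa using hp)] at this
    | 8, hat, next, _, _ =>
      simp only [Instr.ofCode, Instr.queryReg, Instr.exec, ev_map, ev_coin]
      have h1 : 1 < 2 ^ M := Nat.one_lt_two_pow (by omega)
      have hn : ∀ v : Bool, _ := fun v => (next (c.put a v.toNat 0) v.toNat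
        (by simp [Instr.ofCode, Instr.exec]) rfl rfl (by norm_num)).1 (by cases v <;> simp; omega)
      refine le_trans ?_ (valueAt_flip hpay0 (by simpa using hat))
      exact ENNReal.div_le_div_right (add_le_add (hn false) (hn true)) _
    | 9, hat, _, _, oracle =>
      exact oracle (by norm_num) fun h => ⟨_, rfl, rfl, rfl, by simp⟩
    | o + 10, hat, _, _, oracle =>
      exact oracle (by omega) fun h => ⟨_, rfl, rfl, by simp [Config.put, answer],
        fun _ => by simp⟩

/-! ### RSA keys -/

section keys
variable {n N e d : ℕ}

lemma pow_modEq_of_prime {p m x : ℕ} (hp : p.Prime) :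
    x ^ (1 + (p - 1) * m) ≡ x [MOD p] := by
  have := Fact.mk hp
  rw [← ZMod.natCast_eq_natCast_iff]
  push_cast
  by_cases hx : (x : ZMod p) = 0
  · simp [hx]
  · rw [pow_add, pow_one, pow_mul, ZMod.pow_card_sub_one_eq_one hx, one_pow, mul_one]

lemma IsRSAKey.pow_pow (h : IsRSAKey n N e d) (x : ℕ) : x ^ (e * d) ≡ x [MOD N] := by
  obtain ⟨p, q, hp, hq, hpq, -, -, rfl, he, hd, hed⟩ := h
  have h1 : 1 ≤ e * d := Nat.mul_pos he hd
  obtain ⟨m, hm⟩ := (Nat.modEq_iff_dvd' h1).1 hed.symm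
  have hed' : e * d = 1 + (p - 1) * (q - 1) * m := by omega
  rw [← Nat.modEq_and_modEq_iff_modEq_mul ((Nat.coprime_primes hp hq).2 hpq)]
  constructor
  · rw [hed', mul_assoc]; exact pow_modEq_of_prime hp
  · rw [hed', mul_comm (p - 1), mul_assoc]; exact pow_modEq_of_prime hq

lemma IsRSAKey.root (h : IsRSAKey n N e d) (s : ℕ) (hs : s < N) : (s ^ e % N) ^ d % N = s := by
  rw [← Nat.pow_mod, ← pow_mul]
  have := h.pow_pow s
  rwa [Nat.ModEq, Nat.mod_eq_of_lt hs] at this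

lemma IsRSAKey.root' (h : IsRSAKey n N e d) (x : ℕ) : (x ^ d % N) ^ e % N = x % N := by
  rw [← Nat.pow_mod, ← pow_mul, mul_comm]
  exact h.pow_pow x

lemma IsRSAKey.lt (h : IsRSAKey n N e d) : N < 2 ^ (2 * n) := by
  obtain ⟨p, q, hp, hq, -, hpn, hqn, rfl, -⟩ := h
  rw [two_mul, pow_add]
  exact Nat.mul_lt_mul'' (Nat.size_le.1 hpn.le) (Nat.size_le.1 hqn.le)

lemma IsRSAKey.ge (h : IsRSAKey n N e d) : 2 ^ (2 * n) ≤ 4 * N := by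
  obtain ⟨p, q, hp, hq, -, hpn, hqn, rfl, -⟩ := h
  have hn : 1 ≤ n := hpn ▸ Nat.size_pos.2 hp.pos
  obtain ⟨n, rfl⟩ := Nat.exists_eq_add_of_le' hn
  have h1 : 2 ^ n ≤ p := Nat.lt_size.1 (by omega)
  have h2 : 2 ^ n ≤ q := Nat.lt_size.1 (by omega)
  calc 2 ^ (2 * (n + 1)) = 4 * (2 ^ n * 2 ^ n) := by rw [mul_add, two_mul, pow_add, pow_add]; ring
    _ ≤ 4 * (p * q) := Nat.mul_le_mul_left _ (Nat.mul_le_mul h1 h2)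

lemma IsRSAKey.one_lt (h : IsRSAKey n N e d) : 1 < N := by
  obtain ⟨p, q, hp, hq, -, hpn, hqn, rfl, -⟩ := h
  exact Nat.one_lt_mul_iff.2 ⟨hp.pos, hq.pos, .inl hp.one_lt⟩

/-- Few numbers below `N` are not prime to `N`. -/
lemma IsRSAKey.card_nonunits (h : IsRSAKey n N e d) :
    ((Finset.range N).filter fun y => ¬ y.Coprime N).card ≤ 2 * 2 ^ n := by
  obtain ⟨p, q, hp, hq, hpq, hpn, hqn, rfl, -⟩ := h
  have h1 : p ≤ 2 ^ n := (Nat.size_le.1 hpn.le).le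
  have h2 : q ≤ 2 ^ n := (Nat.size_le.1 hqn.le).le
  have h3 := Finset.card_filter_add_card_filter_not (s := Finset.range (p * q))
    (fun y => (p * q).Coprime y)
  rw [← Nat.totient_eq_card_coprime, Nat.totient_mul ((Nat.coprime_primes hp hq).2 hpq),
    Nat.totient_prime hp, Nat.totient_prime hq, Finset.card_range] at h3
  rw [Finset.filter_congr fun y _ => not_congr (Nat.coprime_comm (n := y) (m := p * q))]
  have h4 := hp.one_lt
  have h5 := hq.one_lt
  obtain ⟨a, rfl⟩ := Nat.exists_eq_add_of_lt h4
  obtain ⟨b, rfl⟩ := Nat.exists_eq_add_of_lt h5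
  have h6 : (1 + a + 1 - 1) * (1 + b + 1 - 1) = (1 + a) * (1 + b) := by simp
  rw [h6] at h3
  nlinarith

lemma unitReps_nonempty (h : 1 < N) : (unitReps N).Nonempty :=
  ⟨1, by simp [unitReps, h]⟩

end keys

/-! ### The reduction for a single key -/

lemma inv_two_le_accept_pow (T : ℕ) : 2⁻¹ ≤ accept (T + 1) ^ (T + 1) := by
  have h : ∀ K, accept K = ENNReal.ofReal (1 - (1 / 2) ^ K) := by
    intro K
    induction K with
    | zero => simp [accept]
    | succ K ih =>
      have hK : (1 / 2 : ℝ) ^ K ≤ 1 := pow_le_one₀ (by norm_num) (by norm_num)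
      rw [accept, ih, ← ENNReal.ofReal_one, ← ENNReal.ofReal_add (by norm_num) (by linarith),
        ← ENNReal.ofReal_ofNat 2, ← ENNReal.ofReal_div_of_pos (by norm_num)]
      congr 1
      rw [pow_succ]
      ring
  have h1 : (1 / 2 : ℝ) ^ (T + 1) ≤ 1 := pow_le_one₀ (by norm_num) (by norm_num)
  rw [h, ← ENNReal.ofReal_pow (by linarith), ← ENNReal.ofReal_ofNat 2,
    ← ENNReal.ofReal_inv_of_pos (by norm_num)]
  refine ENNReal.ofReal_le_ofReal ?_
  have hB := one_add_mul_le_pow (a := -(1 / 2 : ℝ) ^ (T + 1)) (by linarith) (T + 1)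
  refine le_trans ?_ (hB.trans (le_of_eq (by ring)))
  have h2 : ((T + 1 : ℕ) : ℝ) ≤ 2 ^ T := by exact_mod_cast Nat.lt_two_pow_self (n := T)
  have h3 : (1 / 2 : ℝ) ^ (T + 1) * 2 ^ T = 1 / 2 := by
    rw [pow_succ, mul_right_comm, ← mul_pow]; norm_num
  have h4 : (0 : ℝ) < (1 / 2) ^ (T + 1) := by positivity
  nlinarith

/-- The weights of hash values in the lazy game if only those `j`-th hash values count that are congruent to
`y`. -/
noncomputable def residueWeight (N l j y i h : ℕ) : ℝ≥0∞ :=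
  if i = j then (2 ^ l)⁻¹ * (if h % N = y then 1 else 0) else (2 ^ l)⁻¹

section game
variable {P : List Instr} {N d e l j T : ℕ}

lemma forgeryAt_eq_zero_of_ne (c : Config) (i h : ℕ) (hij : i ≠ j) :
    forgeryAt P N e T j c i h = 0 :=
  forgeryAt_eq_zero_of_signed c i h (.inl hij)

lemma game_uniform_eq_sum (hN : 0 < N) (hj : 0 < j) (t : ℕ) (c : Config) :
    game P N d l (fun _ _ => (2 ^ l)⁻¹) (forgeryAt P N e T j) t c [] =
      ∑ y ∈ Finset.range N, game P N d l (residueWeight N l j y) (forgeryAt P N e T j) t c [] := by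
  rw [game_linear (Y := Finset.range N) (w := fun _ => 1) (μ' := residueWeight N l j)
    forgeryAt_eq_zero_of_ne _ _ t c [] hj]
  · simp
  · intro y _ i hi
    ext h
    simp [residueWeight, hi]
  · intro h _
    simp [residueWeight, Nat.mod_lt _ hN]

lemma game_challenge_eq {y : ℕ} (hj : 0 < j) (t : ℕ) (c : Config) :
    game P N d l (challengeWeight N l j y) (forgeryAt P N e T j) t c [] =
      N / 2 * game P N d l (residueWeight N l j y) (forgeryAt P N e T j) t c [] := by
  rw [game_linear (Y := {y}) (w := fun _ => (N : ℝ≥0∞) / 2) (μ' := residueWeight N l j)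
    forgeryAt_eq_zero_of_ne _ _ t c [] hj]
  · simp
  · intro y' hy i hi
    obtain rfl := Finset.mem_singleton.1 hy
    ext h
    simp [residueWeight, challengeWeight, hi]
  · intro h _
    simp [residueWeight, challengeWeight]

lemma sum_residueWeight_le {y : ℕ} (hN : 0 < N) (hNl : N ≤ 2 ^ l) :
    ∑ h ∈ Finset.range (2 ^ l), residueWeight N l j y j h ≤ 2 / N := by
  have h := sum_challengeWeight_le (j := j) (y := y) hN hNl
  simp only [challengeWeight, if_true, ← Finset.mul_sum] at h
  simp only [residueWeight, if_true, ← Finset.mul_sum]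
  rw [ENNReal.le_div_iff_mul_le (.inl (by simp; omega)) (.inl (by simp))]
  calc _ = 2 * ((N : ℝ≥0∞) / 2 * ((2 ^ l)⁻¹ * ∑ i ∈ Finset.range (2 ^ l), if i % N = y then 1 else 0)) := by
        rw [← mul_assoc 2, ENNReal.mul_div_cancel (by simp) (by simp), mul_comm]
    _ ≤ 2 * 1 := by gcongr
    _ = 2 := mul_one 2

lemma game_residue_le {y : ℕ} (hN : 0 < N) (hNl : N ≤ 2 ^ l) (hj : 0 < j) (t : ℕ) (c : Config) :
    game P N d l (residueWeight N l j y) (forgeryAt P N e T j) t c [] ≤ 2 / N := by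
  refine (game_le_mass (j := j) forgeryAt_eq_zero_of_ne (fun c i h => ?_) (fun i hi => ?_) t c []).trans ?_
  · unfold forgeryAt
    split
    · exact forgery_le_one ..
    · exact zero_le
  · simp only [residueWeight, hi, if_false, Finset.sum_const, Finset.card_range, nsmul_eq_mul]
    push_cast
    rw [ENNReal.mul_inv_cancel (by simp) (by simp)]
  · rw [List.length_nil, if_pos hj]
    exact sum_residueWeight_le hN hNl

end game

/-- The success probability of the reduction on a challenge `y`. -/
theorem game_le_inversion {cs : List Code} {n N e d y l j L T S q M Tr : ℕ} (hkey : IsRSAKey n N e d)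
    (hl : 2 * n ≤ l) (hn : 1 ≤ n) (hL : L = strLen n + strLen N + strLen e) (hS : S = L + T + l + 2)
    (hq : q = T + 1) (hM : M = 3 * S * (q + 1)) (hj0 : 0 < j) (hjq : j ≤ q) (hy : y < N)
    (hTr : (10 * (S + l + j) + 20 + T * stepBound (T + 1) l (L + 1) q + 1) * (1 + 3 * M) + M ≤ Tr) :
    game (cs.map Instr.ofCode) N d l (fun i h => accept (T + 1) * challengeWeight N l j y i h)
        (forgeryAt (cs.map Instr.ofCode) N e T j) T (start [n, N, e]) [] /
        (2 * j ^ 2) / (2 * l ^ 2) / (2 * S ^ 2) ≤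
      ev (steps ((reduction cs).map Instr.ofCode) noOracles Tr (start [n, N, e, y]))
        (inversion ((reduction cs).map Instr.ofCode) N e y Tr) := by
  have len_le : ∀ x, strLen x ≤ L → x < 2 ^ (L + 1) := fun x hx => by
    have := lt_two_pow_of_strLen hx
    omega
  have hNl : N ≤ 2 ^ l := hkey.lt.le.trans (Nat.pow_le_pow_right (by norm_num) hl)
  have hSM : S < M := by
    have : S * 3 ≤ S * (3 * (q + 1)) := Nat.mul_le_mul_left _ (by omega)
    rw [hM, mul_comm 3 S, mul_assoc]
    omega
  have hqM : q + 1 ≤ M := by rw [hM]; exact Nat.le_mul_of_pos_left _ (by omega)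
  have hP : Params M S N e d y l (L + 1) j q := by
    refine ⟨hkey.one_lt, hNl, by omega, hM.ge, len_le e (by omega), by omega, hy, hjq, hkey.root,
      hkey.root'⟩
  have hpay0 : ∀ c : Config, c.pc < ((reduction cs).map Instr.ofCode).length →
      inversion ((reduction cs).map Instr.ofCode) N e y Tr c = 0 := by
    intro c hc
    rw [inversion, if_neg]
    omega
  have hpow : 2 ^ (L + 1) ≤ 2 ^ M := Nat.pow_le_pow_right (by norm_num) (by omega)
  have hB : Bounded M (start [n, N, e, y]).reg := by
    intro r
    refine lt_of_lt_of_le ?_ hpow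
    match r with
    | 0 => exact len_le n (by omega)
    | 1 => exact len_le N (by omega)
    | 2 => exact len_le e (by omega)
    | 3 => exact hy.trans (len_le N (by omega))
    | r + 4 => simp [start]
  rw [← value_eq hpay0 (fun c hc => by rw [inversion, if_neg]; omega)]
  have hval : valueAt (reduction cs) (inversion ((reduction cs).map Instr.ofCode) N e y Tr) M 0
      (start [n, N, e, y]).reg 0 ≤ _ := iInf₂_le (start [n, N, e, y]) ⟨rfl, rfl, by simp [start]⟩
  refine le_trans ?_ hval
  let F : (ℕ → ℕ) → ℕ → ℝ≥0∞ := fun ρ m => by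
    classical
    exact if Bounded M ρ then valueAt (reduction cs)
      (inversion ((reduction cs).map Instr.ofCode) N e y Tr) M (blockAddr 0) ρ m else ⊤
  have hcode : CodeAt (reduction cs) 0 (prologue.compile 0) :=
    ⟨[], _, by rw [reduction, List.nil_append, List.append_assoc], rfl⟩
  refine le_trans ?_ (wp_le_valueAt (by omega) (by simpa using hpay0) prologue (F := F) prologue_safe hcode
    (fun ρ m hb _ => by simp only [F]; rw [if_pos hb, blockAddr]; simp) _ 0 hB (by simp [start]))
  refine prologue_spec (d := d) (by omega) (by omega) (by omega) (by omega) (by omega) (by omega)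
    fun ρ m hm hρ hreg => ?_
  simp only [F]
  split
  · next hb =>
    have := game_le_valueAt (cs := cs) (T := T) (B := L) (Tr := Tr) (K := T + 1) hP (Nat.succ_pos T) (by omega) T
      (start [n, N, e]) [] ρ m hρ hreg hb (fun r => ?_) (by simp; omega) ?_
    · simpa [hashTable, start] using this
    · match r with
      | 0 => simp [start]; omega
      | 1 => simp [start]; omega
      | 2 => simp [start]; omega
      | r + 3 => simp [start, strLen]
    · refine le_trans ?_ hTr
      gcongr ?_ * _ + _
      omega
  · exact le_top

lemma ev_randomUnit {N : ℕ} (hN : 1 < N) (f : ℕ → ℝ≥0∞) :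
    ev (randomUnit N) f = ((unitReps N).card : ℝ≥0∞)⁻¹ * ∑ y ∈ unitReps N, f y := by
  have h := unitReps_nonempty hN
  rw [randomUnit, dif_pos h, ev, tsum_eq_sum (s := unitReps N), Finset.mul_sum]
  · refine Finset.sum_congr rfl fun y hy => ?_
    rw [PMF.uniformOfFinset_apply, if_pos hy]
  · intro y hy
    rw [PMF.uniformOfFinset_apply, if_neg hy, zero_mul]

/-- The success probability of a forger in the lazy game, against that of the reduction: a factor of
`32 * S ^ 6` for each possible position of the forged message, and the possibility that its hash value is
not prime to `N`. -/
theorem game_le_rsa {cs : List Code} {n N e d l L T S : ℕ} {B : Machine} (hkey : IsRSAKey n N e d)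
    (hl : 2 * n ≤ l) (hn : 1 ≤ n) (hL : L = strLen n + strLen N + strLen e) (hS : S = L + T + l + 2)
    (hB : B.prog = (reduction cs).map Instr.ofCode)
    (hclock : ∀ y < N, ∀ j ≤ T + 1, (10 * (S + l + j) + 20 + T * stepBound (T + 1) l (L + 1) (T + 1) + 1) *
      (1 + 3 * (3 * S * (T + 1 + 1))) + 3 * S * (T + 1 + 1) ≤ B.clock [n, N, e, y]) :
    game (cs.map Instr.ofCode) N d l (fun _ _ => (2 ^ l)⁻¹)
        (fun c _ h => forgery (cs.map Instr.ofCode) N e T c h) T (start [n, N, e]) [] ≤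
      S * (32 * S ^ 6 * ev (randomUnit N) (fun y =>
        ev (steps B.prog noOracles (B.clock [n, N, e, y]) (start [n, N, e, y]))
          (inversion B.prog N e y (B.clock [n, N, e, y]))) + 16 / 2 ^ n) := by
  have hN1 := hkey.one_lt
  have hN : 0 < N := by omega
  have hN0 : (N : ℝ≥0∞) ≠ 0 := by simpa using hN.ne'
  have hNl : N ≤ 2 ^ l := hkey.lt.le.trans (Nat.pow_le_pow_right (by norm_num) hl)
  set p : ℕ → ℝ≥0∞ := fun y =>
    ev (steps B.prog noOracles (B.clock [n, N, e, y]) (start [n, N, e, y]))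
      (inversion B.prog N e y (B.clock [n, N, e, y])) with hp
  -- the contribution of one position and one residue
  have unit : ∀ j, 0 < j → j ≤ T + 1 → ∀ y < N,
      game (cs.map Instr.ofCode) N d l (residueWeight N l j y)
        (forgeryAt (cs.map Instr.ofCode) N e T j) T (start [n, N, e]) [] ≤
      32 * S ^ 6 * ((N : ℝ≥0∞)⁻¹ * p y) := by
    intro j hj0 hj y hy
    have h1 := game_le_inversion (cs := cs) hkey hl hn hL hS rfl rfl hj0 hj hy (hclock y hy j hj)
    rw [← hB] at h1
    change _ ≤ p y at h1
    have hj0' : (2 * j ^ 2 : ℝ≥0∞) ≠ 0 := by simp; omega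
    have hl0' : (2 * l ^ 2 : ℝ≥0∞) ≠ 0 := by simp; omega
    have hS0' : (2 * S ^ 2 : ℝ≥0∞) ≠ 0 := by simp; omega
    have top : ∀ x : ℕ, (2 * x ^ 2 : ℝ≥0∞) ≠ ⊤ := fun x => by finiteness
    rw [ENNReal.div_le_iff hS0' (top _), ENNReal.div_le_iff hl0' (top _),
      ENNReal.div_le_iff hj0' (top _)] at h1
    have h2 := pow_mul_game_le (P := cs.map Instr.ofCode) (N := N) (d := d) (l := l)
      (μ := challengeWeight N l j y) (fin := forgeryAt (cs.map Instr.ofCode) N e T j)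
      (accept_le_one (T + 1)) T (start [n, N, e]) []
    rw [game_challenge_eq hj0] at h2
    set g := game (cs.map Instr.ofCode) N d l (residueWeight N l j y)
        (forgeryAt (cs.map Instr.ofCode) N e T j) T (start [n, N, e]) []
    have h3 : 2⁻¹ * (N / 2 * g) ≤ p y * (2 * S ^ 2) * (2 * l ^ 2) * (2 * j ^ 2) :=
      le_trans (by gcongr; exact inv_two_le_accept_pow T) (h2.trans h1)
    have h4 : p y * (2 * S ^ 2) * (2 * l ^ 2) * (2 * j ^ 2) ≤
        p y * (2 * S ^ 2) * (2 * S ^ 2) * (2 * S ^ 2) := by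
      have e1 : (l : ℝ≥0∞) ≤ S := by exact_mod_cast (by omega : l ≤ S)
      have e2 : (j : ℝ≥0∞) ≤ S := by exact_mod_cast (by omega : j ≤ S)
      gcongr
    calc g = 4 * (N : ℝ≥0∞)⁻¹ * (2⁻¹ * (N / 2 * g)) := by
          rw [div_eq_mul_inv]
          calc g = ((N : ℝ≥0∞)⁻¹ * N) * (4 * 4⁻¹) * g := by
                rw [ENNReal.inv_mul_cancel hN0 (by simp), ENNReal.mul_inv_cancel (by simp) (by simp)]
                simp
            _ = _ := by
                rw [show (4 : ℝ≥0∞)⁻¹ = 2⁻¹ * 2⁻¹ by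
                  rw [← ENNReal.mul_inv (by simp) (by simp)]; norm_num]
                ring
      _ ≤ 4 * (N : ℝ≥0∞)⁻¹ * (p y * (2 * S ^ 2) * (2 * S ^ 2) * (2 * S ^ 2)) := by
          exact mul_le_mul_right (h3.trans h4) _
      _ = 32 * S ^ 6 * ((N : ℝ≥0∞)⁻¹ * p y) := by ring
  -- the contribution of one position
  have position : ∀ j, 0 < j → j ≤ T + 1 →
      game (cs.map Instr.ofCode) N d l (fun _ _ => (2 ^ l)⁻¹)
        (forgeryAt (cs.map Instr.ofCode) N e T j) T (start [n, N, e]) [] ≤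
      32 * S ^ 6 * ev (randomUnit N) p + 16 / 2 ^ n := by
    intro j hj0 hj
    rw [game_uniform_eq_sum hN hj0,
      ← Finset.sum_filter_add_sum_filter_not _ fun y : ℕ => y.Coprime N]
    refine add_le_add ?_ ?_
    · refine (Finset.sum_le_sum fun y hy => unit j hj0 hj y ?_).trans ?_
      · exact Finset.mem_range.1 (Finset.mem_filter.1 hy).1
      · rw [← Finset.mul_sum, ← Finset.mul_sum, ev_randomUnit hN1]
        change 32 * (S : ℝ≥0∞) ^ 6 * ((N : ℝ≥0∞)⁻¹ * ∑ y ∈ unitReps N, p y) ≤ _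
        gcongr
        exact (Finset.card_filter_le ..).trans (by simp)
    · refine (Finset.sum_le_sum fun y _ => game_residue_le (y := y) hN hNl hj0 T _).trans ?_
      rw [Finset.sum_const, nsmul_eq_mul]
      calc (((Finset.range N).filter fun y => ¬ y.Coprime N).card : ℝ≥0∞) * (2 / N)
          ≤ (2 * 2 ^ n) * (2 / N) := by
            gcongr
            exact_mod_cast hkey.card_nonunits
        _ ≤ 16 / 2 ^ n := by
            rw [ENNReal.le_div_iff_mul_le (.inl (by simp)) (.inl (by simp)), div_eq_mul_inv]
            have h1 : (2 : ℝ≥0∞) ^ (2 * n) ≤ 4 * N := by exact_mod_cast hkey.ge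
            calc (2 * 2 ^ n * (2 * (N : ℝ≥0∞)⁻¹)) * 2 ^ n = 4 * 2 ^ (2 * n) * (N : ℝ≥0∞)⁻¹ := by
                  rw [two_mul n, pow_add]; ring
              _ ≤ 4 * (4 * N) * (N : ℝ≥0∞)⁻¹ := by gcongr
              _ = 16 := by
                  rw [mul_assoc, mul_assoc, ENNReal.mul_inv_cancel hN0 (by simp)]
                  norm_num
  refine (game_le_sum (J := T + 1) (fun c _ h => forgery (cs.map Instr.ofCode) N e T c h) T
    (start [n, N, e]) [] (by simp)).trans ?_
  refine (Finset.sum_le_sum fun j hj => position j (by have := Finset.mem_Icc.1 hj; omega)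
    (Finset.mem_Icc.1 hj).2).trans ?_
  rw [Finset.sum_const, nsmul_eq_mul, Nat.card_Icc]
  gcongr
  omega

/-! ### Polynomial bounds -/

lemma steps_le_pow {L T l j S : ℕ} (hS : 4 ≤ S) (hL : L + 1 ≤ S) (hT : T + 2 ≤ S) (hl : l ≤ S)
    (hj : j ≤ S) :
    (10 * (S + l + j) + 20 + T * stepBound (T + 1) l (L + 1) (T + 1) + 1) *
      (1 + 3 * (3 * S * (T + 1 + 1))) + 3 * S * (T + 1 + 1) ≤ S ^ 10 := by
  have h16 : 16 ≤ S * S := Nat.mul_le_mul hS hS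
  have hSS : 4 * S ≤ S * S := Nat.mul_le_mul_right _ hS
  have h1 : stepBound (T + 1) l (L + 1) (T + 1) ≤ 36 * (S * S) := by
    unfold stepBound querySteps
    have h2 : 6 * l + 12 * (L + 1) + 25 ≤ 25 * S := by omega
    have h3 : (T + 1) * (6 * l + 12 * (L + 1) + 25) ≤ S * (25 * S) := Nat.mul_le_mul (by omega) h2
    have h4 : S * (25 * S) = 25 * (S * S) := by ring
    omega
  have h2 : T * stepBound (T + 1) l (L + 1) (T + 1) ≤ S * (36 * (S * S)) := Nat.mul_le_mul (by omega) h1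
  have h3 : 4 * (S * S) ≤ S * (S * S) := Nat.mul_le_mul_right _ hS
  have h4 : 10 * (S + l + j) + 20 + T * stepBound (T + 1) l (L + 1) (T + 1) + 1 ≤ 45 * (S * (S * S)) := by
    have : S * (36 * (S * S)) = 36 * (S * (S * S)) := by ring
    omega
  have h5 : 3 * S * (T + 1 + 1) ≤ 3 * (S * S) := by
    rw [mul_assoc]; exact Nat.mul_le_mul_left _ (Nat.mul_le_mul_left _ (by omega))
  have h6 : 1 + 3 * (3 * S * (T + 1 + 1)) ≤ 10 * (S * S) := by omega
  have h7 : 1024 ≤ S ^ 5 := (by norm_num : 1024 = 4 ^ 5).le.trans (Nat.pow_le_pow_left hS 5)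
  calc _ ≤ 45 * (S * (S * S)) * (10 * (S * S)) + 3 * (S * S) :=
        add_le_add (Nat.mul_le_mul h4 h6) h5
    _ ≤ 450 * S ^ 5 + 3 * S ^ 5 := by
        have : S * S ≤ S ^ 5 := by
          rw [← sq]; exact Nat.pow_le_pow_right (by omega) (by norm_num)
        have e1 : 45 * (S * (S * S)) * (10 * (S * S)) = 450 * S ^ 5 := by ring
        omega
    _ ≤ S ^ 5 * S ^ 5 := by nlinarith
    _ = S ^ 10 := by rw [← pow_add]

lemma sum_le_pow {X L T l k c : ℕ} (hX : 2 ≤ X) (hL : L ≤ X) (hT : T ≤ X ^ k + k) (hl : l + 2 ≤ X ^ c) :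
    L + T + l + 2 ≤ X ^ (k + c + 3) := by
  have pow_le : ∀ a, a ≤ k + c + 1 → X ^ a ≤ X ^ (k + c + 1) := fun a ha =>
    Nat.pow_le_pow_right (by omega) ha
  have h1 : X ≤ X ^ (k + c + 1) := by simpa using pow_le 1 (by omega)
  have h2 := pow_le k (by omega)
  have h3 := pow_le c (by omega)
  have h4 : k ≤ X ^ k := (Nat.lt_pow_self (by omega : 1 < X)).le
  have h5 : X ^ (k + c + 1) * 4 ≤ X ^ (k + c + 1) * X ^ 2 :=
    Nat.mul_le_mul_left _ ((by norm_num : 4 = 2 ^ 2).le.trans (Nat.pow_le_pow_left hX 2))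
  rw [← pow_add] at h5
  rw [show k + c + 3 = k + c + 1 + 2 by ring]
  omega

/-- Polynomials are bounded by powers. -/
lemma exists_eval_le_pow (l : Polynomial ℤ) :
    ∃ c : ℕ, ∀ n : ℕ, 1 ≤ n → |l.eval (n : ℤ)| ≤ ((n : ℤ) + 1) ^ c := by
  induction l using Polynomial.induction_on' with
  | add p q hp hq =>
    obtain ⟨c, hc⟩ := hp
    obtain ⟨c', hc'⟩ := hq
    refine ⟨max c c' + 1, fun n hn => ?_⟩
    have h1 : (1 : ℤ) ≤ (n : ℤ) + 1 := by omega
    have h2 := (hc n hn).trans (pow_le_pow_right₀ h1 (le_max_left c c'))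
    have h3 := (hc' n hn).trans (pow_le_pow_right₀ h1 (le_max_right c c'))
    rw [Polynomial.eval_add, pow_succ]
    refine (abs_add_le _ _).trans ?_
    have h4 : (0 : ℤ) < ((n : ℤ) + 1) ^ max c c' := by positivity
    have h5 : (2 : ℤ) ≤ (n : ℤ) + 1 := by omega
    nlinarith
  | monomial k a =>
    refine ⟨a.natAbs + k, fun n hn => ?_⟩
    rw [Polynomial.eval_monomial, abs_mul, pow_add, Int.abs_eq_natAbs]
    have h1 : (a.natAbs : ℤ) ≤ ((n : ℤ) + 1) ^ a.natAbs := by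
      exact_mod_cast (Nat.lt_pow_self (by omega : 1 < n + 1)).le
    have h2 : |(n : ℤ) ^ k| ≤ ((n : ℤ) + 1) ^ k := by
      rw [abs_of_nonneg (by positivity)]
      exact pow_le_pow_left₀ (by positivity) (by omega) k
    exact mul_le_mul h1 h2 (abs_nonneg _) (by positivity)

/-- Exponential functions outgrow powers. -/
lemma pow_le_two_pow {m n : ℕ} (h : 2 ^ (m + 7) ≤ n) : n ^ m ≤ 2 ^ n := by
  have hn : n ≠ 0 := by
    rintro rfl
    simp at h
  set s := Nat.log 2 n with hs
  have h1 : m + 7 ≤ s := Nat.le_log_of_pow_le (by norm_num) h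
  have h2 : 2 ^ s ≤ n := Nat.pow_log_le_self 2 hn
  have h3 : n < 2 ^ (s + 1) := Nat.lt_pow_succ_log_self (by norm_num) n
  have h4 : ∀ t, 7 ≤ t → (t + 1) * t ≤ 2 ^ t := by
    intro t ht
    induction t, ht using Nat.le_induction with
    | base => norm_num
    | succ t ht ih => rw [pow_succ]; nlinarith
  calc n ^ m ≤ (2 ^ (s + 1)) ^ m := Nat.pow_le_pow_left h3.le m
    _ = 2 ^ ((s + 1) * m) := by rw [← pow_mul]
    _ ≤ 2 ^ n := Nat.pow_le_pow_right (by norm_num)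
        ((Nat.mul_le_mul_left _ (by omega)).trans ((h4 s (by omega)).trans h2))

/-! ### The reduction is computable -/

lemma Cmd.primrec_compile (c : Cmd) : Primrec c.compile := by
  have add : ∀ k : ℕ, Primrec fun a : ℕ => a + k := fun k =>
    Primrec.nat_add.comp Primrec.id (Primrec.const k)
  have code : ∀ (o r x : ℕ) {f : ℕ → ℕ}, Primrec f → Primrec fun a => ((o, r, f a, x) : Code) :=
    fun o r x f hf => (Primrec.const o).pair ((Primrec.const r).pair (hf.pair (Primrec.const x)))
  induction c with
  | skip => exact Primrec.const _
  | const r v => exact Primrec.const _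
  | copy r s => exact Primrec.const _
  | op o r s t => exact Primrec.const _
  | flip r => exact Primrec.const _
  | seq c c' h h' => exact Primrec.list_append.comp h (h'.comp (add c.size))
  | ite r c c' h h' =>
    exact Primrec.list_cons.comp (code 7 r 0 (add _)) (Primrec.list_append.comp (h'.comp (add 1))
      (Primrec.list_cons.comp (code 7 4 0 (add _)) (h.comp (add _))))
  | loop r c h =>
    exact Primrec.list_cons.comp (code 7 r 0 (add _)) (Primrec.list_append.comp (h.comp (add 1))
      (Primrec.list_cons.comp (code 7 4 0 Primrec.id) (Primrec.const [])))

lemma primrec_blockAddr : Primrec blockAddr :=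
  Primrec.nat_add.comp (Primrec.const _) (Primrec.nat_mul.comp Primrec.id (Primrec.const _))

lemma primrec_instrBlock : Primrec fun a : (ℕ × ℕ) × Code => instrBlock a.1.1 a.1.2 a.2 := by
  have len : Primrec fun a : (ℕ × ℕ) × Code => a.1.1 := Primrec.fst.comp Primrec.fst
  have pos : Primrec fun a : (ℕ × ℕ) × Code => a.1.2 := Primrec.snd.comp Primrec.fst
  have c₀ : Primrec fun a : (ℕ × ℕ) × Code => a.2.1 := Primrec.fst.comp Primrec.snd
  have c' : Primrec fun a : (ℕ × ℕ) × Code => a.2.2 := Primrec.snd.comp Primrec.snd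
  have c₁ : Primrec fun a : (ℕ × ℕ) × Code => a.2.2.1 := Primrec.fst.comp c'
  have c'' : Primrec fun a : (ℕ × ℕ) × Code => a.2.2.2 := Primrec.snd.comp c'
  have c₂ : Primrec fun a : (ℕ × ℕ) × Code => a.2.2.2.1 := Primrec.fst.comp c''
  have c₃ : Primrec fun a : (ℕ × ℕ) × Code => a.2.2.2.2 := Primrec.snd.comp c''
  have add : ∀ (k : ℕ) {f : (ℕ × ℕ) × Code → ℕ}, Primrec f → Primrec fun a => f a + k :=
    fun k f hf => Primrec.nat_add.comp hf (Primrec.const k)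
  have is : ∀ k : ℕ, PrimrecPred fun a : (ℕ × ℕ) × Code => a.2.1 = k := fun k =>
    Primrec.eq.comp c₀ (Primrec.const k)
  unfold instrBlock
  refine Primrec.ite (Primrec.nat_lt.comp c₀ (Primrec.const 9)) ?_ ?_
  · refine Primrec.list_cons.comp (c₀.pair ((add 24 c₁).pair (Primrec.pair ?_ (add 24 c₃)))) ?_
    · exact Primrec.ite (is 0) c₂ (Primrec.ite (is 7)
        (primrec_blockAddr.comp (Primrec.nat_min.comp c₂ len)) (add 24 c₂))
    · exact Primrec.list_cons.comp ((Primrec.const 7).pair ((Primrec.const 4).pair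
        ((primrec_blockAddr.comp (add 1 pos)).pair (Primrec.const 0)))) (Primrec.const _)
  · refine Primrec.list_cons.comp ((Primrec.const 1).pair ((Primrec.const 12).pair
      ((add 24 c₂).pair (Primrec.const 0)))) (Primrec.list_append.comp
        (answerQuery.primrec_compile.comp (add 1 (primrec_blockAddr.comp pos)))
        (Primrec.list_cons.comp ((Primrec.const 1).pair ((add 24 c₁).pair
          (Primrec.pair ?_ (Primrec.const 0)))) (Primrec.const [])))
    exact Primrec.ite (is 9) (Primrec.const 14) (Primrec.const 15)

lemma primrec_reduction : Primrec reduction := by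
  refine Primrec.list_append.comp (Primrec.list_append.comp (Primrec.const _)
    (Primrec.list_flatMap (Primrec.list_range.comp Primrec.list_length) ?_)) (Primrec.const _)
  exact primrec_instrBlock.comp (((Primrec.list_length.comp Primrec.fst).pair Primrec.snd).pair
    ((Primrec.list_getD _).comp Primrec.fst Primrec.snd))

/-- The code of the program of the machine with index `i`. -/
def codes (i : ℕ) : List Code := Denumerable.ofNat (List Code) i.unpair.1

/-- The index of the RSA inverter that is made from the machine with index `i`, where `c` depends on the
length of the hash values only. -/
def reductionIndex (c i : ℕ) : ℕ :=
  Nat.pair (Encodable.encode (reduction (codes i))) (10 * (i.unpair.2 + c + 3))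

lemma ppt_reductionIndex (c i : ℕ) : ppt (reductionIndex c i) =
    ⟨(reduction (codes i)).map Instr.ofCode, 10 * (i.unpair.2 + c + 3)⟩ := by
  simp [ppt, reductionIndex]

lemma primrec_snd_unpair_add (k : ℕ) : Primrec fun i : ℕ => i.unpair.2 + k :=
  Primrec.nat_add.comp (Primrec.snd.comp Primrec.unpair) (Primrec.const k)

lemma primrec_reductionIndex (c : ℕ) : Primrec (reductionIndex c) := by
  refine Primrec₂.natPair.comp ?_ ?_
  · exact Primrec.encode.comp (primrec_reduction.comp
      ((Primrec.ofNat (List Code)).comp (Primrec.fst.comp Primrec.unpair)))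
  · exact Primrec.nat_mul.comp (Primrec.const 10) (primrec_snd_unpair_add (c + 3))

lemma primrec_two_pow : Primrec fun n : ℕ => 2 ^ n := by
  refine (Primrec.nat_rec₁ (f := fun _ x => x * 2) 1
    (Primrec.nat_mul.comp₂ Primrec₂.right (Primrec₂.const 2))).of_eq fun n => ?_
  induction n with
  | zero => rfl
  | succ n ih => rw [pow_succ, ← ih]

/-- The security parameter from which on the success probability of the machine with index `i` is at most
`1 / n ^ d`, computed from the bound `f` of the RSA assumption. Here `g` is the exponent of the key generator. The loss of
the reduction is a factor `n ^ (20 * b)`, with `b = (g + 4) * (k + c + 3)` and the exponent `k` of the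
machine; one more factor `n` pays for the constants. The second number makes the contribution of the hash
values that are not units negligible. -/
def threshold (f : ℕ → ℕ → ℕ) (g c i d : ℕ) : ℕ :=
  max (f (reductionIndex c i) (d + 1 + 20 * ((g + 4) * (i.unpair.2 + c + 3))))
    (2 ^ (5 + 2 * ((g + 4) * (i.unpair.2 + c + 3)) + d + 7))

lemma computable_threshold {f : ℕ → ℕ → ℕ} (hf : Computable₂ f) (g c : ℕ) :
    Computable₂ (threshold f g c) := by
  have b : Primrec fun a : ℕ × ℕ => (g + 4) * (a.1.unpair.2 + c + 3) :=
    Primrec.nat_mul.comp (Primrec.const _) ((primrec_snd_unpair_add (c + 3)).comp Primrec.fst)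
  have e₁ : Primrec fun a : ℕ × ℕ => a.2 + 1 + 20 * ((g + 4) * (a.1.unpair.2 + c + 3)) :=
    Primrec.nat_add.comp (Primrec.nat_add.comp Primrec.snd (Primrec.const 1))
      (Primrec.nat_mul.comp (Primrec.const 20) b)
  have e₂ : Primrec fun a : ℕ × ℕ =>
      2 ^ (5 + 2 * ((g + 4) * (a.1.unpair.2 + c + 3)) + a.2 + 7) :=
    primrec_two_pow.comp (Primrec.nat_add.comp (Primrec.nat_add.comp (Primrec.nat_add.comp
      (Primrec.const 5) (Primrec.nat_mul.comp (Primrec.const 2) b)) Primrec.snd) (Primrec.const 7))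
  exact Primrec.nat_max.to_comp.comp (hf.comp ((primrec_reductionIndex c).comp Primrec.fst).to_comp
    e₁.to_comp) e₂.to_comp

/-! ### The experiments as expectations -/

lemma sigForge_true (gen A : Machine) (n : ℕ) (H : ℕ → ℕ) :
    sigForge gen A n H true = ev (genKey gen n) fun key => match key with
      | none => 0
      | some (N, e, d) => ev (steps A.prog ⟨H, fdhSign N d H⟩ (A.clock [n, N, e]) (start [n, N, e]))
          fun c => forgery A.prog N e (A.clock [n, N, e]) c (H (c.reg 0)) := by
  rw [ev_indicator, sigForge, ev_bind]
  congr 1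
  funext key
  match key with
  | none => simp
  | some (N, e, d) =>
    simp only [ev_map, Machine.run]
    congr 1
    funext c
    by_cases h1 : A.prog.length ≤ c.pc ∧
        c.cost + ∑ j ∈ Finset.range 2, strLen (c.reg j) ≤ A.clock [n, N, e]
    · rw [if_pos h1]
      by_cases h2 : c.reg 0 ∉ c.signed ∧ FDHValid N e H (c.reg 0) (c.reg 1)
      · have h3 : forgery A.prog N e (A.clock [n, N, e]) c (H (c.reg 0)) = 1 :=
          if_pos ⟨h1.1, h1.2, h2⟩
        rw [h3]
        simp [h2]
      · rw [forgery_eq_zero fun h => h2 h.2.2]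
        simp only [h2, decide_false, Bool.false_eq_true, if_false]
    · rw [if_neg h1, forgery_eq_zero fun h => h1 ⟨h.1, h.2.1⟩]
      simp

lemma rsaInv_true (gen A : Machine) (n : ℕ) :
    rsaInv gen A n true = ev (genKey gen n) fun key => match key with
      | none => 0
      | some (N, e, _) => ev (randomUnit N) fun y =>
          ev (steps A.prog noOracles (A.clock [n, N, e, y]) (start [n, N, e, y]))
            (inversion A.prog N e y (A.clock [n, N, e, y])) := by
  rw [ev_indicator, rsaInv, ev_bind]
  congr 1
  funext key
  match key with
  | none => simp
  | some (N, e, d) =>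
    simp only [ev_bind, ev_map, Machine.run]
    congr 1
    funext y
    congr 1
    funext c
    by_cases h1 : A.prog.length ≤ c.pc ∧
        c.cost + ∑ j ∈ Finset.range 1, strLen (c.reg j) ≤ A.clock [n, N, e, y]
    · rw [if_pos h1]
      by_cases h2 : c.reg 0 ^ e ≡ y [MOD N]
      · have h3 : inversion A.prog N e y (A.clock [n, N, e, y]) c = 1 :=
          if_pos ⟨h1.1, by simpa using h1.2, h2⟩
        simp [h2, h3]
      · have h3 : inversion A.prog N e y (A.clock [n, N, e, y]) c = 0 :=
          if_neg fun h => h2 h.2.2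
        simp [h2, h3]
    · have h3 : inversion A.prog N e y (A.clock [n, N, e, y]) c = 0 :=
        if_neg fun h => h1 ⟨h.1, by simpa using h.2.1⟩
      rw [if_neg h1, h3]
      simp

/-- The key generator has no time to output a long exponent. -/
lemma strLen_le_of_genKey {gen : Machine} {n N e d : ℕ}
    (h : some (N, e, d) ∈ (genKey gen n).support) : strLen e ≤ n ^ gen.exponent + gen.exponent := by
  have hlen : strLen (2 ^ (n + 1) - 2) ≤ n := by
    have h2 : 2 ≤ 2 ^ (n + 1) := by rw [pow_succ]; have := Nat.one_le_two_pow (n := n); omega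
    have h3 : Nat.log 2 (2 ^ (n + 1) - 2 + 1) < n + 1 := Nat.log_lt_of_lt_pow (by omega) (by omega)
    unfold strLen
    omega
  simp only [genKey, Machine.run, PMF.mem_support_map_iff] at h
  obtain ⟨o, ⟨c, -, rfl⟩, ho⟩ := h
  split at ho
  · next hc =>
    simp only [Option.map_some, Option.some.injEq, Prod.mk.injEq] at ho
    obtain ⟨-, rfl, -⟩ := ho
    have h1 := hc.2
    simp only [Finset.sum_range_succ, Machine.clock, List.map_cons, List.map_nil, List.sum_cons,
      List.sum_nil, add_zero] at h1
    have h2 := Nat.pow_le_pow_left hlen gen.exponent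
    omega
  · simp at ho

/-! ### Security of RSA-FDH -/

/-- For a single key: summing over all hash functions is playing the lazy game, which the reduction turns
into an RSA inversion. The parameter `S` that the reduction has to guess (a bound for the input, the clock of
the adversary and the hash values together) is at most `(n + 1) ^ ((g + 4) * (k + c + 3))`, where `g` and `k`
are the exponents of the key generator and of the adversary. -/
theorem sum_forgery_le {gen : Machine} {n N e d l q c i : ℕ} (hkey : IsRSAKey n N e d)
    (he : strLen e ≤ n ^ gen.exponent + gen.exponent) (hn : 1 ≤ n) (hl : 2 * n ≤ l)
    (hlc : l + 2 ≤ (n + 1) ^ c) (hq : (ppt i).clock [n, N, e] ≤ q) :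
    ∑ G : Func q l, ev (steps (ppt i).prog ⟨G.oracle, fdhSign N d G.oracle⟩
        ((ppt i).clock [n, N, e]) (start [n, N, e]))
        (fun x => forgery (ppt i).prog N e ((ppt i).clock [n, N, e]) x (G.oracle (x.reg 0))) ≤
      Fintype.card (Func q l) *
        ((((n + 1) ^ ((gen.exponent + 4) * (i.unpair.2 + c + 3)) : ℕ) : ℝ≥0∞) ^ 10 *
          ev (randomUnit N) (fun y => ev (steps (ppt (reductionIndex c i)).prog noOracles
            ((ppt (reductionIndex c i)).clock [n, N, e, y]) (start [n, N, e, y]))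
            (inversion (ppt (reductionIndex c i)).prog N e y
              ((ppt (reductionIndex c i)).clock [n, N, e, y]))) +
          ((n + 1) ^ ((gen.exponent + 4) * (i.unpair.2 + c + 3)) : ℕ) * (16 / 2 ^ n)) := by
  set T := (ppt i).clock [n, N, e] with hT
  set B := ppt (reductionIndex c i) with hBdef
  set L := strLen n + strLen N + strLen e with hL
  set S := L + T + l + 2 with hS
  set k := i.unpair.2 with hk
  have hTL : T ≤ L ^ k + k := by
    rw [hT, hL]
    simp [Machine.clock, ppt, hk, add_assoc]
  -- the length of the public key
  have he0 : 1 ≤ strLen e := by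
    obtain ⟨-, -, -, -, -, -, -, -, he, -⟩ := hkey
    exact Nat.log_pos (by norm_num) (by omega)
  have hn0 : 1 ≤ strLen n := Nat.log_pos (by norm_num) (by omega)
  have hN1 : 2 * n - 2 ≤ strLen N := by
    have h1 := hkey.ge
    refine Nat.le_log_of_pow_le (by norm_num) ?_
    have h2 : 2 ^ (2 * n) = 2 ^ (2 * n - 2) * 4 := by
      rw [show (4 : ℕ) = 2 ^ 2 by norm_num, ← pow_add]
      congr 1
      omega
    omega
  have hN2 : strLen N ≤ 2 * n := strLen_le_of_lt hkey.lt
  have hn2 : strLen n ≤ n := strLen_le_of_lt Nat.lt_two_pow_self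
  have hnL : n + 1 ≤ L := by omega
  have hlL : l + 2 ≤ L ^ c := hlc.trans (Nat.pow_le_pow_left hnL c)
  have hSn : S ≤ (n + 1) ^ ((gen.exponent + 4) * (k + c + 3)) := by
    have h1 : L ≤ (n + 1) ^ (gen.exponent + 4) := by
      set g := gen.exponent
      have h2 : n ^ g ≤ (n + 1) ^ g := Nat.pow_le_pow_left (by omega) g
      have h3 : g ≤ (n + 1) ^ g := (Nat.lt_pow_self (by omega : 1 < n + 1)).le
      have h4 : (n + 1) ^ g * 1 ≤ (n + 1) ^ g * (n + 1) := Nat.mul_le_mul_left _ (by omega)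
      have h5 : 1 * (n + 1) ≤ (n + 1) ^ g * (n + 1) := Nat.mul_le_mul_right _ (Nat.one_le_pow _ _ (by omega))
      have h6 : (n + 1) ^ g * (n + 1) * 8 ≤ (n + 1) ^ g * (n + 1) * (n + 1) ^ 3 :=
        Nat.mul_le_mul_left _ ((by norm_num : 8 = 2 ^ 3).le.trans (Nat.pow_le_pow_left (by omega) 3))
      have h7 : (n + 1) ^ (g + 4) = (n + 1) ^ g * (n + 1) * (n + 1) ^ 3 := by ring
      omega
    rw [pow_mul]
    exact (sum_le_pow (by omega) le_rfl hTL hlL).trans (Nat.pow_le_pow_left h1 _)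
  have hclock : ∀ y < N, ∀ j ≤ T + 1,
      (10 * (S + l + j) + 20 + T * stepBound (T + 1) l (L + 1) (T + 1) + 1) *
        (1 + 3 * (3 * S * (T + 1 + 1))) + 3 * S * (T + 1 + 1) ≤ B.clock [n, N, e, y] := by
    intro y _ j hj
    refine (steps_le_pow (by omega) (by omega) (by omega) (by omega) (by omega)).trans ?_
    have h1 : B.clock [n, N, e, y] =
        (L + strLen y) ^ (10 * (k + c + 3)) + 10 * (k + c + 3) := by
      rw [hBdef, ppt_reductionIndex]
      simp [Machine.clock, hL, hk, add_assoc]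
    have h2 : S ≤ (L + strLen y) ^ (k + c + 3) := sum_le_pow (by omega) (by omega)
      (hTL.trans (Nat.add_le_add_right (Nat.pow_le_pow_left (by omega) k) k))
      (hlL.trans (Nat.pow_le_pow_left (by omega) c))
    rw [h1, mul_comm 10, pow_mul]
    exact (Nat.pow_le_pow_left h2 10).trans (Nat.le_add_right _ _)
  have hgame := game_le_rsa (cs := codes i) (T := T) (B := B) hkey hl hn hL hS
    (by rw [hBdef, ppt_reductionIndex]) hclock
  have heager := sum_ev_steps_le_game (P := (ppt i).prog) (N := N) (d := d) (q := q) (l := l)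
    (fin := forgery (ppt i).prog N e T) (fun x h hx => forgery_eq_zero fun hh => by
      have := hh.2.1
      simp only [Finset.sum_range_succ, Finset.range_zero, Finset.sum_empty, zero_add] at this
      omega) T (start [n, N, e]) []
  have huniv : extensions q l [] = Finset.univ := by
    ext G
    simp [mem_extensions, lookup]
  rw [huniv, Finset.card_univ] at heager
  refine heager.trans (mul_le_mul_right (hgame.trans ?_) _)
  set r := ev (randomUnit N) fun y => ev (steps B.prog noOracles (B.clock [n, N, e, y])
    (start [n, N, e, y])) (inversion B.prog N e y (B.clock [n, N, e, y]))
  have hS' : (S : ℝ≥0∞) ≤ ((n + 1) ^ ((gen.exponent + 4) * (k + c + 3)) : ℕ) := by exact_mod_cast hSn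
  have h32 : 32 * (S : ℝ≥0∞) ^ 7 ≤ S ^ 10 := by
    have h1 : 32 * S ^ 7 ≤ S ^ 10 := by
      rw [show 10 = 3 + 7 by norm_num, pow_add]
      refine Nat.mul_le_mul_right _ (le_trans (by norm_num) (Nat.pow_le_pow_left (?_ : 4 ≤ S) 3))
      omega
    exact_mod_cast h1
  rw [mul_add]
  refine add_le_add ?_ (mul_le_mul_left hS' _)
  calc (S : ℝ≥0∞) * (32 * S ^ 6 * r) = 32 * S ^ 7 * r := by ring
    _ ≤ S ^ 10 * r := by gcongr
    _ ≤ _ := by gcongr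

/-- The probability of a forgery, in terms of the success probability of the reduction. -/
theorem romForge_le {gen : Machine} (hgen : IsRSAGenerator gen) {n l q c i : ℕ} (hn : 1 ≤ n)
    (hl : 2 * n ≤ l) (hlc : l + 2 ≤ (n + 1) ^ c) (hq : BoundsTime gen (ppt i) n q) :
    romForge gen (ppt i) n q l ≤
      ((n + 1 : ℝ) ^ ((gen.exponent + 4) * (i.unpair.2 + c + 3))) ^ 10 *
        rsaSucc gen (ppt (reductionIndex c i)) n +
      (n + 1 : ℝ) ^ ((gen.exponent + 4) * (i.unpair.2 + c + 3)) * (16 / 2 ^ n) := by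
  set b := (gen.exponent + 4) * (i.unpair.2 + c + 3) with hb
  have hcard : 0 < Fintype.card (Func q l) := Fintype.card_pos
  have key : ∑ G : Func q l, sigForge gen (ppt i) n G.oracle true ≤ Fintype.card (Func q l) *
      ((((n + 1) ^ b : ℕ) : ℝ≥0∞) ^ 10 * rsaInv gen (ppt (reductionIndex c i)) n true +
        ((n + 1) ^ b : ℕ) * (16 / 2 ^ n)) := by
    simp_rw [sigForge_true, rsaInv_true]
    rw [← ev_finset_sum, ← ev_mul_left,
      ← ev_const (genKey gen n) ((((n + 1) ^ b : ℕ) : ℝ≥0∞) * (16 / 2 ^ n)), ← ev_add, ← ev_mul_left]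
    refine ev_mono_support fun key hk => ?_
    match key, hk with
    | none, _ => simp
    | some (N, e, d), hk =>
      exact sum_forgery_le (hgen n hn N e d hk) (strLen_le_of_genKey hk) hn hl hlc (hq N e d hk)
  have hfin : ((((n + 1) ^ b : ℕ) : ℝ≥0∞) * (16 / 2 ^ n)) ≠ ⊤ := by
    finiteness
  have hinv : rsaInv gen (ppt (reductionIndex c i)) n true ≠ ⊤ := PMF.apply_ne_top _ _
  have hfin' : (((n + 1) ^ b : ℕ) : ℝ≥0∞) ^ 10 * rsaInv gen (ppt (reductionIndex c i)) n true ≠ ⊤ :=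
    ENNReal.mul_ne_top (by finiteness) hinv
  rw [romForge, div_le_iff₀ (by exact_mod_cast hcard), ← ENNReal.toReal_sum fun G _ => PMF.apply_ne_top _ _]
  refine (ENNReal.toReal_mono (ENNReal.mul_ne_top (by simp) (ENNReal.add_ne_top.2 ⟨hfin', hfin⟩))
    key).trans (le_of_eq ?_)
  rw [ENNReal.toReal_mul, ENNReal.toReal_add hfin' hfin, ENNReal.toReal_mul, ENNReal.toReal_mul, rsaSucc]
  simp only [ENNReal.toReal_pow, ENNReal.toReal_natCast, ENNReal.toReal_div,
    ENNReal.toReal_ofNat]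
  push_cast
  ring

lemma final_bound {n b d : ℕ} {s : ℝ} (hn : 2 ^ (5 + 2 * b + d + 7) ≤ n)
    (hs : s ≤ 1 / (n : ℝ) ^ (d + 1 + 20 * b)) :
    ((n + 1 : ℝ) ^ b) ^ 10 * s + (n + 1 : ℝ) ^ b * (16 / 2 ^ n) ≤ 1 / (n : ℝ) ^ d := by
  have hn2 : 2 ≤ n := by
    refine le_trans ?_ hn
    calc 2 = 2 ^ 1 := by norm_num
      _ ≤ _ := Nat.pow_le_pow_right (by norm_num) (by omega)
  have hn2' : (2 : ℝ) ≤ n := by exact_mod_cast hn2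
  have hn0 : (0 : ℝ) < n := by linarith
  have hsq : (n + 1 : ℝ) ^ b ≤ (n : ℝ) ^ (2 * b) := by
    rw [pow_mul]
    gcongr
    nlinarith
  have h1 : ((n + 1 : ℝ) ^ b) ^ 10 * s ≤ 1 / (2 * (n : ℝ) ^ d) := by
    calc ((n + 1 : ℝ) ^ b) ^ 10 * s ≤ ((n + 1 : ℝ) ^ b) ^ 10 * (1 / (n : ℝ) ^ (d + 1 + 20 * b)) := by
          gcongr
      _ ≤ ((n : ℝ) ^ (2 * b)) ^ 10 * (1 / (n : ℝ) ^ (d + 1 + 20 * b)) := by gcongr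
      _ = 1 / ((n : ℝ) * (n : ℝ) ^ d) := by
          rw [← pow_mul, show 2 * b * 10 = 20 * b by ring, pow_add, pow_succ]
          field_simp
      _ ≤ 1 / (2 * (n : ℝ) ^ d) := by gcongr
  have h2 : (n + 1 : ℝ) ^ b * (16 / 2 ^ n) ≤ 1 / (2 * (n : ℝ) ^ d) := by
    have h3 : (n : ℝ) ^ (5 + 2 * b + d) ≤ 2 ^ n := by exact_mod_cast pow_le_two_pow hn
    have h4 : (32 : ℝ) ≤ (n : ℝ) ^ 5 := by
      calc (32 : ℝ) = 2 ^ 5 := by norm_num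
        _ ≤ _ := by gcongr
    rw [mul_div_assoc', div_le_div_iff₀ (by positivity) (by positivity), one_mul]
    calc (n + 1 : ℝ) ^ b * 16 * (2 * (n : ℝ) ^ d) = 32 * (n + 1 : ℝ) ^ b * (n : ℝ) ^ d := by ring
      _ ≤ (n : ℝ) ^ 5 * (n : ℝ) ^ (2 * b) * (n : ℝ) ^ d := by gcongr
      _ = (n : ℝ) ^ (5 + 2 * b + d) := by rw [← pow_add, ← pow_add]
      _ ≤ 2 ^ n := h3
  calc _ ≤ 1 / (2 * (n : ℝ) ^ d) + 1 / (2 * (n : ℝ) ^ d) := add_le_add h1 h2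
    _ = 1 / (n : ℝ) ^ d := by field_simp; norm_num

end RSAFDH

theorem theorem6p2 (gen : RSAFDH.Machine) (hgen : RSAFDH.IsRSAGenerator gen)
    (l : Polynomial ℤ) (hl : ∀ n : ℕ, 1 ≤ n → 2 * (n : ℤ) ≤ l.eval (n : ℤ))
    (hRSA : RSAFDH.EffectiveRSAAssumption gen) :
    RSAFDH.EffectivelyEUFACMASecureROM gen (fun n => (l.eval (n : ℤ)).toNat) := by
  obtain ⟨f, hf, hsecure⟩ := hRSA
  obtain ⟨c, hc⟩ := RSAFDH.exists_eval_le_pow (l + 2)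
  refine ⟨RSAFDH.threshold f gen.exponent c, RSAFDH.computable_threshold hf _ _, ?_⟩
  intro i d n hd hn hthreshold q hq
  have h1 := (le_max_left _ _).trans hthreshold
  have h2 := (le_max_right _ _).trans hthreshold
  have hln := hl n hn
  have hlc : (l.eval (n : ℤ)).toNat + 2 ≤ (n + 1) ^ c := by
    have h3 := (le_abs_self _).trans (hc n hn)
    simp only [Polynomial.eval_add, Polynomial.eval_ofNat] at h3
    have h4 : ((l.eval (n : ℤ)).toNat : ℤ) = l.eval (n : ℤ) := Int.toNat_of_nonneg (by omega)
    zify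
    rw [h4]
    exact h3
  refine (RSAFDH.romForge_le hgen hn (by omega) hlc hq).trans (RSAFDH.final_bound h2 ?_)
  exact hsecure _ _ n (by omega) hn h1
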